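/- There exists an absolute constant $C$ such that for all $k,s\in\mathbb{N}$ the following holds. Let $G$ be a finite simple graph that does not contain the complete bipartite graph $K_{s,s}$ as a (not necessarily induced) subgraph, and suppose that its average degree $2|E(G)|/|V(G)|$ is at least $k^{Cs^3}$. Then $G$ contains an induced subdivision of the complete graph $K_k$, that is, some induced subgraph of $G$ is a subdivision of $K_k$. (A subdivision of a graph $H$ is a graph obtained from $H$ by replacing the edges $uv$ of $H$ by internally disjoint paths between $u$ and $v$.) -/

import Mathlib

namespace SimpleGraph

/-- The average degree `2 e(G) / |G|` of a finite graph (it is `0` for the graph without vertices). -/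
noncomputable def averageDegree {V : Type*} [Fintype V] (G : SimpleGraph V) : ℝ :=
  2 * (G.edgeSet.ncard : ℝ) / (Fintype.card V : ℝ)

/-- `S` is a subdivision of `H`: the vertices `w` of `H` are mapped injectively to branch vertices
`b w` of `S`, each edge `uv` of `H` is replaced by a path `p u v` of `S` from `b u` to `b v`
(the same path, reversed, for `vu`), these paths are internally disjoint and have no branch vertices
in their interiors, and `S` has no vertices and edges besides the branch vertices and the vertices
and edges of these paths. -/
def IsSubdivision {V W : Type*} (S : SimpleGraph V) (H : SimpleGraph W) : Prop :=
  ∃ (b : W ↪ V) (p : ∀ u v : W, H.Adj u v → S.Walk (b u) (b v)),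
    (∀ u v (h : H.Adj u v), (p u v h).IsPath) ∧
    (∀ u v (h : H.Adj u v), p v u h.symm = (p u v h).reverse) ∧
    (∀ u v (h : H.Adj u v) (w : W), b w ∈ (p u v h).support → w = u ∨ w = v) ∧
    (∀ u v (h : H.Adj u v) u' v' (h' : H.Adj u' v'), s(u, v) ≠ s(u', v') →
      ∀ x ∈ (p u v h).support, x ∈ (p u' v' h').support → x ∈ Set.range b) ∧
    (∀ x : V, x ∈ Set.range b ∨ ∃ u v, ∃ h : H.Adj u v, x ∈ (p u v h).support) ∧
    (∀ e ∈ S.edgeSet, ∃ u v, ∃ h : H.Adj u v, e ∈ (p u v h).edges)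

/-- Some induced subgraph of `G` is a subdivision of `H`. -/
def ContainsInducedSubdivision {V W : Type*} (G : SimpleGraph V) (H : SimpleGraph W) : Prop :=
  ∃ T : Set V, (G.induce T).IsSubdivision H

end SimpleGraph

/-! Let θ be the largest average degree of an induced subgraph, attained on a set `S`, and write θ =
l ^ (110 s). Then l ≥ k ^ (70 s²), so one factor l outweighs each constant loss below, and by
maximality all edges of the graph can be oriented with out-degrees at most θ.

It suffices to find disjoint independent sets A', B' with |B'| ≥ 2^42 k^12 |A'| such that every
vertex of B' has exactly two neighbours in A' and no two have the same pair (`IsOneSubdivision`).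
Then A' ∪ B' induces the 1-subdivision of a graph on A' of average degree at least 2^43 k^12. That
graph contains a topological K_k (`hasTopologicalClique_of_adjCount`), and its lift is induced
(`IsOneSubdivision.containsInducedSubdivision`): there are no edges inside A' or inside B', and a
subdividing vertex that is used has both its neighbours on its own path.

To find A' and B', consider cherries: a centre b together with two nonadjacent neighbours in a set
A. Sample a random R ⊆ A and keep the cherries whose pair lies in R, while R avoids the centre, its
other neighbours and the out-neighbours of the pair. Two survivors conflict if their centres are
adjacent or their pairs agree; the centres of an independent set of survivors form B'. This works if
cherries are plentiful compared with |A| and conflicts are rare. Two cases arise.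

If vertices of huge degree account for half of the edges, they form a tiny set L, and more than
|S|/32 other vertices have between s and θ neighbours in L. By K_{s,s}-freeness some A ⊆ L then has
many pairs with common neighbours (`exists_secondNeighbors`). Choosing one cherry per pair leaves
only conflicts along edges of G, which are sparse.

Otherwise a pigeonhole over degree scales gives nearly regular sides A and B. Here the
Kővári–Sós–Turán bound (`Free.mul_adjCount_le`) makes neighbourhoods sparse to each other, which
yields many cherries and few conflicts.

The topological clique comes from a highly connected subgraph with a large clique minor. Fans at 8k
vertices are linked to the minor by Menger's theorem, and a linkage with the fewest steps outside
the branch sets roots a clique minor at half of the fan ends (`exists_rooted_cliqueModel`). -/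

namespace SimpleGraph
-- Menger's theorem for vertex sets.
section Menger
open Classical

variable {V : Type*}

/-- Every walk from `A` to `B` meets `S`. -/
def Separates (G : SimpleGraph V) (A B S : Finset V) : Prop :=
  ∀ a ∈ A, ∀ b ∈ B, ∀ w : G.Walk a b, ∃ v ∈ w.support, v ∈ S

/-- There are `k` pairwise disjoint paths from `A` to `B`. -/
def HasDisjointPaths (G : SimpleGraph V) (A B : Finset V) (k : ℕ) : Prop :=
  ∃ (a b : Fin k → V) (w : ∀ i, G.Walk (a i) (b i)), (∀ i, (w i).IsPath) ∧ (∀ i, a i ∈ A) ∧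
    (∀ i, b i ∈ B) ∧ ∀ i j, i ≠ j → ∀ v ∈ (w i).support, v ∉ (w j).support

/-- `u` and `v` are joined by a walk avoiding `S`. -/
def ReachAvoiding (G : SimpleGraph V) (S : Finset V) (u v : V) : Prop :=
  ∃ w : G.Walk u v, ∀ z ∈ w.support, z ∉ S

theorem ReachAvoiding.refl {G : SimpleGraph V} {S : Finset V} {u : V} (h : u ∉ S) :
    G.ReachAvoiding S u u := ⟨.nil, by simpa using h⟩

theorem ReachAvoiding.trans {G : SimpleGraph V} {S : Finset V} {u v w : V}
    (h : G.ReachAvoiding S u v) (h' : G.ReachAvoiding S v w) : G.ReachAvoiding S u w := by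
  obtain ⟨p, hp⟩ := h
  obtain ⟨q, hq⟩ := h'
  refine ⟨p.append q, fun z hz => ?_⟩
  rw [Walk.mem_support_append_iff] at hz
  exact hz.elim (hp z) (hq z)

theorem ReachAvoiding.symm {G : SimpleGraph V} {S : Finset V} {u v : V}
    (h : G.ReachAvoiding S u v) : G.ReachAvoiding S v u := by
  obtain ⟨p, hp⟩ := h
  exact ⟨p.reverse, by simpa using hp⟩

theorem Separates.symm {G : SimpleGraph V} {A B S : Finset V} (h : G.Separates A B S) :
    G.Separates B A S := by
  intro b hb a ha w
  obtain ⟨v, hv, hS⟩ := h a ha b hb w.reverse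
  exact ⟨v, by simpa using hv, hS⟩

theorem HasDisjointPaths.symm {G : SimpleGraph V} {A B : Finset V} {k : ℕ}
    (h : G.HasDisjointPaths A B k) : G.HasDisjointPaths B A k := by
  obtain ⟨a, b, w, h1, h2, h3, h4⟩ := h
  exact ⟨b, a, fun i => (w i).reverse, fun i => (h1 i).reverse, h3, h2, by simpa using h4⟩

theorem HasDisjointPaths.mono {G G' : SimpleGraph V} (hG : G ≤ G') {A B : Finset V} {k : ℕ}
    (h : G.HasDisjointPaths A B k) : G'.HasDisjointPaths A B k := by
  obtain ⟨a, b, w, h1, h2, h3, h4⟩ := h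
  refine ⟨a, b, fun i => (w i).mapLe hG, fun i => (h1 i).mapLe hG, h2, h3, ?_⟩
  simpa using h4

/-- Disjoint paths to a target set of the same size, indexed by the target set. -/
theorem HasDisjointPaths.exists_of_card_eq {G : SimpleGraph V} {A T : Finset V} {k : ℕ}
    (h : G.HasDisjointPaths A T k) (hT : T.card = k) :
    ∃ (a : V → V) (w : ∀ t, G.Walk (a t) t), (∀ t ∈ T, (w t).IsPath ∧ a t ∈ A) ∧
      ∀ t ∈ T, ∀ t' ∈ T, t ≠ t' → ∀ v ∈ (w t).support, v ∉ (w t').support := by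
  obtain ⟨a, b, w, h1, h2, h3, h4⟩ := h
  have hinj : Function.Injective b := by
    intro i j hij
    by_contra hne
    exact h4 i j hne (b i) (by simp) (by rw [hij]; simp)
  have himg : Finset.univ.image b = T := by
    apply Finset.eq_of_subset_of_card_le
    · intro x hx
      obtain ⟨i, -, rfl⟩ := Finset.mem_image.1 hx
      exact h3 i
    · rw [Finset.card_image_of_injective _ hinj, hT]; simp
  have hsurj : ∀ t ∈ T, ∃ i, b i = t := by
    intro t ht
    rw [← himg] at ht
    obtain ⟨i, -, hi⟩ := Finset.mem_image.1 ht
    exact ⟨i, hi⟩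
  have key : ∀ t, ∃ (x : V) (p : G.Walk x t), t ∈ T → ∃ i, b i = t ∧ p.IsPath ∧ x ∈ A ∧
      p.support = (w i).support := by
    intro t
    by_cases ht : t ∈ T
    · obtain ⟨i, rfl⟩ := hsurj t ht
      exact ⟨a i, w i, fun _ => ⟨i, rfl, h1 i, h2 i, rfl⟩⟩
    · exact ⟨t, .nil, fun h => absurd h ht⟩
  choose x p hp using key
  refine ⟨x, p, fun t ht => ?_, fun t ht t' ht' hne v hv hv' => ?_⟩
  · obtain ⟨i, -, h, h', -⟩ := hp t ht
    exact ⟨h, h'⟩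
  · obtain ⟨i, hi, -, -, hs⟩ := hp t ht
    obtain ⟨j, hj, -, -, hs'⟩ := hp t' ht'
    rw [hs] at hv
    rw [hs'] at hv'
    exact h4 i j (fun h => hne (by rw [← hi, ← hj, h])) v hv hv'

/-- The segment before `v` cannot contain `t`, the only vertex of the path that may lie in `S`. In
Menger's theorem this shows that paths from the two sides of a separator meet only in it. -/
theorem reachAvoiding_of_mem_path {G : SimpleGraph V} {S : Finset V} {a t v : V} {p : G.Walk a t}
    (hp : p.IsPath) (hS : ∀ z ∈ p.support, z ∈ S → z = t) (hv : v ∈ p.support) (hvS : v ∉ S) :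
    G.ReachAvoiding S a v := by
  refine ⟨p.takeUntil v hv, fun z hz hzS => ?_⟩
  obtain rfl := hS z (p.support_takeUntil_subset_support hv hz) hzS
  exact Walk.endpoint_notMem_support_takeUntil hp hv (fun h => hvS (h ▸ hzS)) hz

theorem ReachAvoiding.of_deleteEdge {G : SimpleGraph V} {S : Finset V} {x y u b : V}
    (h : G.ReachAvoiding S u b) :
    (G.deleteEdges {s(x, y)}).ReachAvoiding S u b ∨
    ((G.deleteEdges {s(x, y)}).ReachAvoiding S u x ∧ (G.deleteEdges {s(x, y)}).ReachAvoiding S y b) ∨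
    ((G.deleteEdges {s(x, y)}).ReachAvoiding S u y ∧
      (G.deleteEdges {s(x, y)}).ReachAvoiding S x b) := by
  obtain ⟨w, hw⟩ := h
  induction w with
  | nil => exact .inl (ReachAvoiding.refl (hw _ (by simp)))
  | @cons u v b huv p ih =>
    have hu : u ∉ S := hw _ (by simp)
    have ih := ih (fun z hz => hw z (by simp [hz]))
    by_cases he : s(u, v) = s(x, y)
    · rcases Sym2.eq_iff.1 he with ⟨rfl, rfl⟩ | ⟨rfl, rfl⟩
      · rcases ih with h | ⟨-, h⟩ | ⟨-, h⟩
        · exact .inr (.inl ⟨.refl hu, h⟩)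
        · exact .inr (.inl ⟨.refl hu, h⟩)
        · exact .inl h
      · rcases ih with h | ⟨-, h⟩ | ⟨-, h⟩
        · exact .inr (.inr ⟨.refl hu, h⟩)
        · exact .inl h
        · exact .inr (.inr ⟨.refl hu, h⟩)
    · have huv' : (G.deleteEdges {s(x, y)}).ReachAvoiding S u v := by
        have hv : v ∉ S := hw _ (by simp)
        have hadj : (G.deleteEdges {s(x, y)}).Adj u v := by
          rw [deleteEdges_adj]; exact ⟨huv, by simpa using he⟩
        refine ⟨hadj.toWalk, fun z hz => ?_⟩
        have : z = u ∨ z = v := by simpa using hz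
        rcases this with rfl | rfl <;> assumption
      rcases ih with h | ⟨h, h'⟩ | ⟨h, h'⟩
      · exact .inl (huv'.trans h)
      · exact .inr (.inl ⟨huv'.trans h, h'⟩)
      · exact .inr (.inr ⟨huv'.trans h, h'⟩)

theorem separates_iff {G : SimpleGraph V} {A B S : Finset V} :
    G.Separates A B S ↔ ∀ a ∈ A, ∀ b ∈ B, ¬ G.ReachAvoiding S a b := by
  simp only [Separates, ReachAvoiding, not_exists]
  refine forall₂_congr fun a _ => forall₂_congr fun b _ => forall_congr' fun w => ?_
  push Not
  rfl

/-- If `T` separates `A` from `insert x S` after deleting `xy`, it separates `A` from `B`. -/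
theorem separates_of_separates_insert {G : SimpleGraph V} {A B S T : Finset V} {x y b : V}
    (hS : (G.deleteEdges {s(x, y)}).Separates A B S) (hb : b ∈ B)
    (hy : (G.deleteEdges {s(x, y)}).ReachAvoiding S y b)
    (hT : (G.deleteEdges {s(x, y)}).Separates A (insert x S) T) : G.Separates A B T := by
  rw [separates_iff] at hS hT ⊢
  intro a ha b' hb' h
  -- reach something in `insert x S` while avoiding `T`
  have key : ∀ v, (G.deleteEdges {s(x, y)}).ReachAvoiding T a v →
      ¬ (G.deleteEdges {s(x, y)}).ReachAvoiding S a v →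
      ∃ z ∈ insert x S, (G.deleteEdges {s(x, y)}).ReachAvoiding T a z := by
    rintro v ⟨w, hw⟩ hv
    have : ∃ z ∈ w.support, z ∈ S := by
      by_contra hcon
      push Not at hcon
      exact hv ⟨w, hcon⟩
    obtain ⟨z, hz, hzS⟩ := this
    exact ⟨z, by simp [hzS], w.takeUntil z hz,
      fun v hv => hw v (w.support_takeUntil_subset_support hz hv)⟩
  have : ∃ z ∈ insert x S, (G.deleteEdges {s(x, y)}).ReachAvoiding T a z := by
    rcases h.of_deleteEdge (x := x) (y := y) with h | ⟨h, -⟩ | ⟨h, -⟩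
    · exact key b' h (hS a ha b' hb')
    · exact ⟨x, by simp, h⟩
    -- Reaching `y` without meeting `S` would extend to `b`, against `hS`.
    · exact key y h (fun h' => hS a ha b hb (h'.trans hy))
  obtain ⟨z, hz, h⟩ := this
  exact hT a ha z hz h

/-- **Menger's theorem** for two vertex sets. -/
theorem hasDisjointPaths_of_forall_separates [Finite V] (G : SimpleGraph V) (A B : Finset V) (k : ℕ)
    (h : ∀ S : Finset V, G.Separates A B S → k ≤ S.card) : G.HasDisjointPaths A B k := by
  obtain ⟨n, hn⟩ : ∃ n, G.edgeSet.ncard = n := ⟨_, rfl⟩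
  induction n using Nat.strong_induction_on generalizing G A B with
  | _ n ih =>
  by_cases hG : G = ⊥
  · subst hG
    have hAB : k ≤ (A ∩ B).card := by
      apply h
      intro a ha b hb w
      have hab : a = b := by
        cases w with
        | nil => rfl
        | cons h _ => exact absurd h (by simp)
      subst hab
      exact ⟨a, by simp, Finset.mem_inter.2 ⟨ha, hb⟩⟩
    obtain ⟨f⟩ : Nonempty (Fin k ↪ (A ∩ B : Finset V)) := by
      apply Function.Embedding.nonempty_of_card_le; simpa using hAB
    refine ⟨fun i => f i, fun i => f i, fun i => .nil, by simp, fun i => ?_, fun i => ?_, ?_⟩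
    · exact (Finset.mem_inter.1 (f i).2).1
    · exact (Finset.mem_inter.1 (f i).2).2
    · intro i j hij v hv hv'
      simp only [Walk.support_nil, List.mem_singleton] at hv hv'
      exact hij (f.injective (Subtype.ext (hv.symm.trans hv')))
  obtain ⟨x₀, y₀, hxy₀⟩ : ∃ x y, G.Adj x y := by
    by_contra hcon
    push Not at hcon
    exact hG (by ext x y; simp [hcon])
  have hlt : ∀ x y, G.Adj x y → (G.deleteEdges {s(x, y)}).edgeSet.ncard < n := by
    intro x y hxy
    rw [← hn]
    apply Set.ncard_lt_ncard _ (Set.toFinite _)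
    rw [edgeSet_deleteEdges]
    refine ⟨Set.sdiff_subset, fun hcon => ?_⟩
    have := hcon (show s(x, y) ∈ G.edgeSet from hxy)
    simp at this
  -- Either deleting an edge xy keeps all separators large, or the smaller graph has a separator `S`
  -- with fewer than `k` vertices. In the second case induction is applied twice, from `A` to `S ∪
  -- {x}` and from `S ∪ {y}` to `B`, and the two path systems are glued along `S` and the edge xy.
  by_cases hsep : ∀ S : Finset V, (G.deleteEdges {s(x₀, y₀)}).Separates A B S → k ≤ S.card
  · exact (ih _ (hlt _ _ hxy₀) _ A B hsep rfl).mono (deleteEdges_le _)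
  push Not at hsep
  obtain ⟨S, hS, hSk⟩ := hsep
  -- orient the edge
  obtain ⟨x, y, a₀, b₀, hxy, he, ha₀, hb₀, hax, hyb⟩ : ∃ x y a b, G.Adj x y ∧ s(x, y) = s(x₀, y₀) ∧
      a ∈ A ∧ b ∈ B ∧ (G.deleteEdges {s(x₀, y₀)}).ReachAvoiding S a x ∧
      (G.deleteEdges {s(x₀, y₀)}).ReachAvoiding S y b := by
    have : ¬ G.Separates A B S := fun h' => absurd (h S h') (by omega)
    rw [separates_iff] at this hS
    push Not at this
    obtain ⟨a, ha, b, hb, hab⟩ := this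
    rcases hab.of_deleteEdge (x := x₀) (y := y₀) with h' | ⟨h1, h2⟩ | ⟨h1, h2⟩
    · exact absurd h' (hS a ha b hb)
    · exact ⟨x₀, y₀, a, b, hxy₀, rfl, ha, hb, h1, h2⟩
    · exact ⟨y₀, x₀, a, b, hxy₀.symm, Sym2.eq_swap, ha, hb, h1, h2⟩
  rw [← he] at hS hax hyb
  have he' : ({s(y, x)} : Set (Sym2 V)) = {s(x, y)} := by rw [Sym2.eq_swap]
  have hxS : x ∉ S := by obtain ⟨w, hw⟩ := hax; exact hw x (by simp)
  have hyS : y ∉ S := by obtain ⟨w, hw⟩ := hyb; exact hw y (by simp)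
  have hcx : ∀ T : Finset V, (G.deleteEdges {s(x, y)}).Separates A (insert x S) T → k ≤ T.card :=
    fun T hT => h T (separates_of_separates_insert hS hb₀ hyb hT)
  have hcy : ∀ T : Finset V, (G.deleteEdges {s(x, y)}).Separates (insert y S) B T → k ≤ T.card := by
    intro T hT
    refine h T (Separates.symm ?_)
    apply separates_of_separates_insert (x := y) (y := x) (b := a₀) (S := S)
    · rw [he']; exact hS.symm
    · exact ha₀
    · rw [he']; exact hax.symm
    · rw [he']; exact hT.symm
  have hSc : S.card + 1 = k := by
    have := hcx (insert x S) (fun a _ b hb w => ⟨b, by simp, hb⟩)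
    rw [Finset.card_insert_of_notMem hxS] at this
    omega
  obtain ⟨a, P, hP, hPd⟩ := (ih _ (hlt _ _ hxy) _ A (insert x S) hcx rfl).exists_of_card_eq
    (by rw [Finset.card_insert_of_notMem hxS, hSc])
  obtain ⟨b, Q, hQ, hQd⟩ := (ih _ (hlt _ _ hxy) _ (insert y S) B hcy rfl).symm.exists_of_card_eq
    (by rw [Finset.card_insert_of_notMem hyS, hSc])
  -- description of the vertices of the two families
  have hPS : ∀ t ∈ insert x S, ∀ z ∈ (P t).support, z ∈ S → z = t := by
    intro t ht z hz hzS
    by_contra hne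
    exact hPd t ht z (by simp [hzS]) (Ne.symm hne) z hz (by simp)
  have hQS : ∀ t ∈ insert y S, ∀ z ∈ (Q t).support, z ∈ S → z = t := by
    intro t ht z hz hzS
    by_contra hne
    exact hQd t ht z (by simp [hzS]) (Ne.symm hne) z hz (by simp)
  have hPQ : ∀ t ∈ insert x S, ∀ t' ∈ insert y S, ∀ z ∈ (P t).support, z ∈ (Q t').support →
      z ∈ S ∧ z = t ∧ z = t' := by
    intro t ht t' ht' z hz hz'
    by_cases hzS : z ∈ S
    · exact ⟨hzS, hPS t ht z hz hzS, hQS t' ht' z hz' hzS⟩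
    · have h1 := reachAvoiding_of_mem_path (hP t ht).1 (hPS t ht) hz hzS
      have h2 := reachAvoiding_of_mem_path (hQ t' ht').1 (hQS t' ht') hz' hzS
      exact absurd (h1.trans h2.symm) (separates_iff.1 hS _ (hP t ht).2 _ (hQ t' ht').2)
  -- The gluing map: paths ending in `S` continue at the same vertex, and the path ending at `x`
  -- continues at `y` through the deleted edge.
  let σ : V → V := fun t => if t = x then y else t
  have hσ : ∀ t ∈ insert x S, σ t ∈ insert y S := by
    intro t ht
    by_cases h : t = x
    · simp [σ, h]
    · simp only [σ, h, if_false]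
      rcases Finset.mem_insert.1 ht with h' | h'
      · exact absurd h' h
      · simp [h']
  have hσi : ∀ t ∈ insert x S, ∀ t' ∈ insert x S, t ≠ t' → σ t ≠ σ t' := by
    intro t ht t' ht' hne
    simp only [σ]
    simp only [Finset.mem_insert] at ht ht'
    split_ifs with h1 h2 h2
    · exact absurd (h1.trans h2.symm) hne
    · rintro rfl; rcases ht' with h | h
      · exact h2 h
      · exact hyS h
    · rintro rfl; rcases ht with h | h
      · exact h1 h
      · exact hyS h
    · exact hne
  have hconn : ∀ t, ∃ c : G.Walk t (σ t), ∀ z ∈ c.support, z = t ∨ z = σ t := by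
    intro t
    by_cases h : t = x
    · subst h
      refine ⟨(hxy.toWalk).copy rfl (by simp [σ]), ?_⟩
      simp [σ]
    · refine ⟨(Walk.nil : G.Walk t t).copy rfl (by simp [σ, h]), ?_⟩
      simp
  choose c hc using hconn
  let W : ∀ t, G.Walk (a t) (b (σ t)) := fun t =>
    ((P t).mapLe (deleteEdges_le _)).append ((c t).append ((Q (σ t)).reverse.mapLe (deleteEdges_le _)))
  have hW : ∀ t, ∀ z ∈ (W t).support, z ∈ (P t).support ∨ z ∈ (Q (σ t)).support := by
    intro t z hz
    simp only [W, Walk.mem_support_append_iff, Walk.support_mapLe_eq_support, Walk.support_reverse,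
      List.mem_reverse] at hz
    rcases hz with hz | hz | hz
    · exact .inl hz
    · rcases hc t z hz with rfl | rfl
      · left; simp
      · right; simp
    · exact .inr hz
  have hWd : ∀ t ∈ insert x S, ∀ t' ∈ insert x S, t ≠ t' → ∀ z ∈ (W t).support,
      z ∉ (W t').support := by
    intro t ht t' ht' hne z hz hz'
    have aux : ∀ t ∈ insert x S, ∀ t' ∈ insert x S, t ≠ t' → z ∈ (P t).support →
        z ∉ (Q (σ t')).support := by
      intro t ht t' ht' hne hz hz'
      obtain ⟨hzS, rfl, h2⟩ := hPQ t ht _ (hσ t' ht') z hz hz'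
      simp only [σ] at h2
      split_ifs at h2 with h3
      · exact hyS (h2 ▸ hzS)
      · exact hne h2
    rcases hW t z hz with h1 | h1 <;> rcases hW t' z hz' with h2 | h2
    · exact hPd t ht t' ht' hne z h1 h2
    · exact aux t ht t' ht' hne h1 h2
    · exact aux t' ht' t ht (Ne.symm hne) h2 h1
    · exact hQd _ (hσ t ht) _ (hσ t' ht') (hσi t ht t' ht' hne) z h1 h2
  obtain ⟨f⟩ : Nonempty (Fin k ↪ (insert x S : Finset V)) := by
    apply Function.Embedding.nonempty_of_card_le
    rw [Fintype.card_coe, Finset.card_insert_of_notMem hxS, hSc]; simp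
  refine ⟨fun i => a (f i), fun i => b (σ (f i)), fun i => (W (f i)).bypass,
    fun i => Walk.bypass_isPath _, fun i => (hP _ (f i).2).2, fun i => (hQ _ (hσ _ (f i).2)).2, ?_⟩
  intro i j hij v hv hv'
  exact hWd _ (f i).2 _ (f j).2 (fun h => hij (f.injective (Subtype.ext h))) v
    (Walk.support_bypass_subset_support _ hv) (Walk.support_bypass_subset_support _ hv')

end Menger
end SimpleGraph

namespace SimpleGraph
-- Counting adjacent pairs, and connected vertex sets.
section Counting
open Finset Classical

variable {V : Type*}

/-- The number of neighbours of `v` in `Y`. -/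
noncomputable def degIn (G : SimpleGraph V) (v : V) (Y : Finset V) : ℕ := #{y ∈ Y | G.Adj v y}

/-- The number of ordered adjacent pairs in `X × Y`. -/
noncomputable def adjCount (G : SimpleGraph V) (X Y : Finset V) : ℕ := ∑ x ∈ X, G.degIn x Y

variable {G : SimpleGraph V} {X X' Y Y' : Finset V} {v : V}

theorem degIn_le_card : G.degIn v Y ≤ #Y := card_filter_le _ _

theorem degIn_mono (h : Y ⊆ Y') : G.degIn v Y ≤ G.degIn v Y' :=
  card_le_card (filter_subset_filter _ h)

theorem degIn_eq_sum : G.degIn v Y = ∑ y ∈ Y, if G.Adj v y then 1 else 0 := by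
  rw [degIn, card_filter]

theorem adjCount_eq_sum : G.adjCount X Y = ∑ x ∈ X, ∑ y ∈ Y, if G.Adj x y then 1 else 0 := by
  simp only [adjCount, degIn_eq_sum]

theorem adjCount_comm : G.adjCount X Y = G.adjCount Y X := by
  rw [adjCount_eq_sum, adjCount_eq_sum, sum_comm]
  simp only [G.adj_comm]

theorem adjCount_mono (h : X ⊆ X') (h' : Y ⊆ Y') : G.adjCount X Y ≤ G.adjCount X' Y' :=
  (sum_le_sum fun _ _ => degIn_mono h').trans (sum_le_sum_of_subset h)

theorem adjCount_le_card_mul : G.adjCount X Y ≤ #X * #Y := by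
  rw [adjCount, ← smul_eq_mul]
  exact sum_le_card_nsmul _ _ _ fun _ _ => degIn_le_card

theorem degIn_union (h : Disjoint Y Y') : G.degIn v (Y ∪ Y') = G.degIn v Y + G.degIn v Y' := by
  simp only [degIn_eq_sum, sum_union h]

theorem adjCount_union_left (h : Disjoint X X') :
    G.adjCount (X ∪ X') Y = G.adjCount X Y + G.adjCount X' Y := sum_union h

theorem adjCount_union_right (h : Disjoint Y Y') :
    G.adjCount X (Y ∪ Y') = G.adjCount X Y + G.adjCount X Y' := by
  simp only [adjCount, degIn_union h, sum_add_distrib]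

theorem adjCount_union_self (h : Disjoint X Y) :
    G.adjCount (X ∪ Y) (X ∪ Y) = G.adjCount X X + 2 * G.adjCount X Y + G.adjCount Y Y := by
  rw [adjCount_union_left h, adjCount_union_right h, adjCount_union_right h, adjCount_comm (X := Y)]
  ring

theorem adjCount_singleton_left : G.adjCount {v} Y = G.degIn v Y := by simp [adjCount]

theorem adjCount_erase_self (h : v ∈ X) :
    G.adjCount X X = G.adjCount (X.erase v) (X.erase v) + 2 * G.degIn v X := by
  have h1 : X = {v} ∪ X.erase v := by rw [← insert_eq, insert_erase h]
  have hd : Disjoint {v} (X.erase v) := by simp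
  have h2 : G.degIn v X = G.degIn v (X.erase v) := by
    rw [degIn, degIn]; congr 1; ext y
    simp only [mem_filter, mem_erase]
    exact ⟨fun h => ⟨⟨h.2.ne', h.1⟩, h.2⟩, fun h => ⟨h.1.2, h.2⟩⟩
  conv_lhs => rw [h1]
  rw [adjCount_union_self hd, adjCount_singleton_left, adjCount_singleton_left, h2]
  have h3 : G.degIn v {v} = 0 := by simp [degIn, filter_singleton]
  rw [h3]; ring

theorem adjCount_eq_card :
    G.adjCount X Y = #{e ∈ X ×ˢ Y | G.Adj e.1 e.2} := by
  rw [adjCount_eq_sum, card_filter, sum_product]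

theorem two_mul_ncard_edgeSet [Fintype V] (G : SimpleGraph V) :
    2 * G.edgeSet.ncard = G.adjCount univ univ := by
  have h1 : G.edgeSet.ncard = #G.edgeFinset := by
    rw [Set.ncard_eq_toFinset_card']; rfl
  rw [h1, ← sum_degrees_eq_twice_card_edges, adjCount]
  refine sum_congr rfl fun v _ => ?_
  rw [degIn, ← card_neighborFinset_eq_degree]
  congr 1; ext; simp

/-- The subgraph of `G` on the same vertex type formed by the edges inside `S`. -/
def restrict (G : SimpleGraph V) (S : Finset V) : SimpleGraph V where
  Adj x y := G.Adj x y ∧ x ∈ S ∧ y ∈ S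
  symm := ⟨fun _ _ h => ⟨h.1.symm, h.2.2, h.2.1⟩⟩
  loopless := ⟨fun _ h => h.1.ne rfl⟩

theorem restrict_le (S : Finset V) : G.restrict S ≤ G := fun _ _ h => h.1

theorem mem_of_mem_support_restrict {S : Finset V} {x y z : V} (w : (G.restrict S).Walk x y)
    (hx : x ∈ S) (hz : z ∈ w.support) : z ∈ S := by
  induction w with
  | nil => simp at hz; exact hz ▸ hx
  | cons h p ih =>
    rcases List.mem_cons.1 (by simpa using hz) with rfl | hz
    · exact hx
    · exact ih h.2.2 hz

/-- A system of distinct representatives for sets that are all large. -/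
theorem exists_injective_mem {ι α : Type*} [Fintype ι] (S : ι → Finset α)
    (h : ∀ i, Fintype.card ι ≤ #(S i)) : ∃ f : ι → α, Function.Injective f ∧ ∀ i, f i ∈ S i := by
  refine (all_card_le_biUnion_card_iff_exists_injective S).1 fun s => ?_
  rcases s.eq_empty_or_nonempty with rfl | ⟨i, hi⟩
  · simp
  · exact (card_le_univ s).trans ((h i).trans (card_le_card (subset_biUnion_of_mem S hi)))

/-- Any two vertices of the nonempty set `X` are joined by a walk inside `X`. -/
def ConnectedOn (G : SimpleGraph V) (X : Finset V) : Prop :=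
  X.Nonempty ∧ ∀ x ∈ X, ∀ y ∈ X, ∃ w : G.Walk x y, ∀ v ∈ w.support, v ∈ X

theorem connectedOn_of_root {r : V} (hr : r ∈ X)
    (h : ∀ x ∈ X, ∃ w : G.Walk x r, ∀ v ∈ w.support, v ∈ X) : G.ConnectedOn X := by
  refine ⟨⟨r, hr⟩, fun x hx y hy => ?_⟩
  obtain ⟨p, hp⟩ := h x hx
  obtain ⟨q, hq⟩ := h y hy
  refine ⟨p.append q.reverse, fun v hv => ?_⟩
  rw [Walk.mem_support_append_iff, Walk.support_reverse, List.mem_reverse] at hv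
  exact hv.elim (hp v) (hq v)

theorem connectedOn_singleton (v : V) : G.ConnectedOn {v} :=
  connectedOn_of_root (mem_singleton_self v) fun x hx => by
    rw [mem_singleton] at hx; subst hx; exact ⟨.nil, by simp⟩

theorem connectedOn_support {x y : V} (w : G.Walk x y) : G.ConnectedOn w.support.toFinset :=
  connectedOn_of_root (r := y) (by simp) fun z hz => by
    have hz : z ∈ w.support := by simpa using hz
    exact ⟨w.dropUntil z hz, fun v hv => by
      simpa using w.support_dropUntil_subset_support hz hv⟩

theorem ConnectedOn.mono {G' : SimpleGraph V} (hG : G ≤ G') (h : G.ConnectedOn X) :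
    G'.ConnectedOn X := by
  refine ⟨h.1, fun x hx y hy => ?_⟩
  obtain ⟨w, hw⟩ := h.2 x hx y hy
  exact ⟨w.mapLe hG, by simpa using hw⟩

theorem ConnectedOn.union_of_adj (hX : G.ConnectedOn X) (hY : G.ConnectedOn Y) {x y : V}
    (hx : x ∈ X) (hy : y ∈ Y) (h : G.Adj x y) : G.ConnectedOn (X ∪ Y) := by
  refine connectedOn_of_root (r := y) (by simp [hy]) fun z hz => ?_
  rcases mem_union.1 hz with hz | hz
  · obtain ⟨w, hw⟩ := hX.2 z hz x hx
    refine ⟨w.append h.toWalk, fun v hv => ?_⟩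
    rw [Walk.mem_support_append_iff] at hv
    rcases hv with hv | hv
    · simp [hw v hv]
    · have : v = x ∨ v = y := by simpa using hv
      rcases this with rfl | rfl <;> simp [*]
  · obtain ⟨w, hw⟩ := hY.2 z hz y hy
    exact ⟨w, fun v hv => by simp [hw v hv]⟩

theorem ConnectedOn.union_of_mem (hX : G.ConnectedOn X) (hY : G.ConnectedOn Y) {x : V}
    (hx : x ∈ X) (hy : x ∈ Y) : G.ConnectedOn (X ∪ Y) := by
  refine connectedOn_of_root (r := x) (by simp [hy]) fun z hz => ?_
  rcases mem_union.1 hz with hz | hz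
  · obtain ⟨w, hw⟩ := hX.2 z hz x hx
    exact ⟨w, fun v hv => by simp [hw v hv]⟩
  · obtain ⟨w, hw⟩ := hY.2 z hz x hy
    exact ⟨w, fun v hv => by simp [hw v hv]⟩

theorem ConnectedOn.union_biUnion {ι : Type*} {B : Finset V} (hB : G.ConnectedOn B) (s : Finset ι)
    (D : ι → Finset V) (hD : ∀ i ∈ s, G.ConnectedOn (D i))
    (h : ∀ i ∈ s, ∃ x ∈ B, ∃ y ∈ D i, G.Adj x y) : G.ConnectedOn (B ∪ s.biUnion D) := by
  induction s using Finset.induction_on with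
  | empty => simpa using hB
  | insert i s his ih =>
    have ih := ih (fun j hj => hD j (by simp [hj])) (fun j hj => h j (by simp [hj]))
    obtain ⟨x, hx, y, hy, hxy⟩ := h i (by simp)
    have := ih.union_of_adj (hD i (by simp)) (x := x) (by simp [hx]) hy hxy
    convert this using 1
    ext z; simp only [biUnion_insert, mem_union]; tauto

end Counting

/-! ### Random subsets and the deletion method. -/

section Sampling
open Finset Classical

variable {α : Type*}

/-- The expectation of `F R` for a random subset `R` of `A` containing each element of `A`
independently with probability `p`. -/
noncomputable def randomSubsetExp (p : ℝ) (A : Finset α) (F : Finset α → ℝ) : ℝ :=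
  ∑ R ∈ A.powerset, p ^ #R * (1 - p) ^ (#A - #R) * F R

variable {p : ℝ} {A : Finset α} {F F' : Finset α → ℝ}

theorem randomSubsetExp_mono (hp : 0 ≤ p) (hp1 : p ≤ 1) (h : ∀ R ⊆ A, F R ≤ F' R) :
    randomSubsetExp p A F ≤ randomSubsetExp p A F' := by
  refine sum_le_sum fun R hR => ?_
  have : 0 ≤ 1 - p := by linarith
  exact mul_le_mul_of_nonneg_left (h R (mem_powerset.1 hR)) (by positivity)

theorem randomSubsetExp_sub : randomSubsetExp p A (fun R => F R - F' R) =
    randomSubsetExp p A F - randomSubsetExp p A F' := by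
  simp only [randomSubsetExp, mul_sub, sum_sub_distrib]

theorem randomSubsetExp_const_mul (c : ℝ) : randomSubsetExp p A (fun R => c * F R) =
    c * randomSubsetExp p A F := by
  simp only [randomSubsetExp, mul_sum]
  exact sum_congr rfl fun _ _ => by ring

theorem randomSubsetExp_sum {ι : Type*} (s : Finset ι) (f : ι → Finset α → ℝ) :
    randomSubsetExp p A (fun R => ∑ i ∈ s, f i R) = ∑ i ∈ s, randomSubsetExp p A (f i) := by
  simp only [randomSubsetExp, mul_sum]
  exact sum_comm

/-- The sets between `T` and `A` are `T ∪ R'` with `R' ⊆ A \ T`; after the factor `p ^ #T` is taken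
out, the weights of the `R'` sum to 1 by the binomial theorem. -/
theorem randomSubsetExp_subset {T : Finset α} (hT : T ⊆ A) :
    randomSubsetExp p A (fun R => if T ⊆ R then 1 else 0) = p ^ #T := by
  have h1 : ∀ R ∈ (A \ T).powerset, p ^ #(T ∪ R) * (1 - p) ^ (#A - #(T ∪ R)) =
      p ^ #T * (p ^ #R * (1 - p) ^ (#(A \ T) - #R)) := by
    intro R hR
    have hd : Disjoint T R := by
      rw [mem_powerset] at hR
      exact disjoint_of_subset_right hR disjoint_sdiff
    rw [card_union_of_disjoint hd, card_sdiff_of_subset hT, pow_add, Nat.sub_sub]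
    ring
  have h2 : randomSubsetExp p A (fun R => if T ⊆ R then 1 else 0) =
      ∑ R ∈ Icc T A, p ^ #R * (1 - p) ^ (#A - #R) := by
    simp only [randomSubsetExp, mul_ite, mul_one, mul_zero]
    rw [← sum_filter]
    refine sum_congr ?_ fun _ _ => rfl
    ext R; simp only [mem_filter, mem_powerset, mem_Icc]; tauto
  rw [h2, Icc_eq_image_powerset hT, sum_image, sum_congr rfl h1, ← mul_sum,
    sum_pow_mul_eq_add_pow]
  · simp
  · intro R hR R' hR' h
    have e : ∀ R ∈ (A \ T).powerset, (T ∪ R) \ T = R := by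
      intro R hR
      rw [union_sdiff_left]
      rw [mem_powerset] at hR
      exact sdiff_eq_self_of_disjoint (disjoint_of_subset_left hR sdiff_disjoint)
    rw [← e R hR, ← e R' hR']
    exact congrArg (· \ T) h

theorem randomSubsetExp_one : randomSubsetExp p A (fun _ => 1) = 1 := by
  have := randomSubsetExp_subset (p := p) (empty_subset A)
  simpa using this

theorem randomSubsetExp_card : randomSubsetExp p A (fun R => (#R : ℝ)) = p * #A := by
  have : randomSubsetExp p A (fun R => (#R : ℝ)) =
      randomSubsetExp p A (fun R => ∑ a ∈ A, if {a} ⊆ R then 1 else 0) := by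
    refine sum_congr rfl fun R hR => ?_
    rw [mem_powerset] at hR
    congr 1
    simp only [singleton_subset_iff]
    rw [← sum_filter, filter_mem_eq_inter, inter_eq_right.2 hR]
    simp
  rw [this, randomSubsetExp_sum, sum_congr rfl fun a ha =>
    randomSubsetExp_subset (singleton_subset_iff.2 ha)]
  simp [mul_comm]

/-- The first moment method: the maximum is at least the weighted mean. -/
theorem exists_le_of_randomSubsetExp (hp : 0 ≤ p) (hp1 : p ≤ 1) :
    ∃ R ⊆ A, randomSubsetExp p A F ≤ F R := by
  by_contra hcon
  push Not at hcon
  obtain ⟨R, hR, hmax⟩ := A.powerset.exists_max_image F ⟨∅, by simp⟩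
  have h1 := randomSubsetExp_mono (F := F) (F' := fun _ => F R * 1) hp hp1
    (fun R' hR' => by simpa using hmax R' (mem_powerset.2 hR'))
  rw [randomSubsetExp_const_mul, randomSubsetExp_one, mul_one] at h1
  exact absurd (hcon R (mem_powerset.1 hR)) (not_lt.2 h1)

/-- A set with few adjacent pairs contains a large independent set. -/
theorem exists_independent_subset {V : Type*} (Q : SimpleGraph V) (X : Finset V) {ρ : ℝ}
    (h0 : 0 ≤ ρ) (h1 : ρ ≤ 1) : ∃ I ⊆ X, (∀ x ∈ I, ∀ y ∈ I, ¬ Q.Adj x y) ∧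
      ρ * #X - ρ ^ 2 * Q.adjCount X X ≤ #I := by
  obtain ⟨R, hR, h⟩ := exists_le_of_randomSubsetExp (A := X)
    (F := fun R => (#R : ℝ) - ∑ x ∈ X, ∑ y ∈ X with Q.Adj x y, if {x, y} ⊆ R then 1 else 0) h0 h1
  rw [randomSubsetExp_sub, randomSubsetExp_card, randomSubsetExp_sum] at h
  have e : ∀ x ∈ X, randomSubsetExp ρ X
      (fun R => ∑ y ∈ X with Q.Adj x y, if {x, y} ⊆ R then 1 else 0) = ρ ^ 2 * Q.degIn x X := by
    intro x hx
    rw [randomSubsetExp_sum, sum_congr rfl (g := fun _ => ρ ^ 2), sum_const, degIn, nsmul_eq_mul,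
      mul_comm]
    intro y hy
    rw [mem_filter] at hy
    rw [randomSubsetExp_subset (insert_subset hx (singleton_subset_iff.2 hy.1)),
      card_pair hy.2.ne]
  rw [sum_congr rfl e, ← mul_sum] at h
  -- Every vertex with a neighbour in the sample is discarded; there are at most as many of these as
  -- ordered adjacent pairs in the sample.
  refine ⟨{x ∈ R | ∀ y ∈ R, ¬ Q.Adj x y}, (filter_subset _ _).trans hR, ?_, ?_⟩
  · intro x hx y hy
    exact (mem_filter.1 hx).2 y (mem_filter.1 hy).1
  · rw [adjCount]; push_cast
    refine h.trans ?_
    have h2 : #R ≤ #{x ∈ R | ∀ y ∈ R, ¬ Q.Adj x y} + Q.adjCount R R := by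
      rw [← card_filter_add_card_filter_not (s := R) (fun x => ∀ y ∈ R, ¬ Q.Adj x y)]
      gcongr
      rw [card_filter, adjCount]
      refine sum_le_sum fun x hx => ?_
      by_cases hh : ∀ y ∈ R, ¬ Q.Adj x y
      · rw [if_neg (not_not.2 hh)]
        exact Nat.zero_le _
      · rw [if_pos hh]
        push Not at hh
        obtain ⟨y, hy, hxy⟩ := hh
        exact card_pos.2 ⟨y, by simp [hy, hxy]⟩
    have h3 : (Q.adjCount R R : ℝ) ≤
        ∑ x ∈ X, ∑ y ∈ X with Q.Adj x y, if {x, y} ⊆ R then 1 else 0 := by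
      rw [adjCount]; push_cast
      refine (sum_le_sum fun x hx => ?_).trans (sum_le_sum_of_subset_of_nonneg hR fun _ _ _ => by
        positivity)
      rw [← sum_filter, sum_const, nsmul_eq_mul, mul_one, degIn]
      norm_cast
      refine card_le_card fun y hy => ?_
      rw [mem_filter] at hy
      simp only [mem_filter]
      refine ⟨⟨hR hy.1, hy.2⟩, ?_⟩
      intro z hz
      rcases mem_insert.1 hz with rfl | hz
      · exact hx
      · rw [mem_singleton.1 hz]; exact hy.1
    have h2' : (#R : ℝ) ≤ #{x ∈ R | ∀ y ∈ R, ¬ Q.Adj x y} + Q.adjCount R R := by exact_mod_cast h2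
    linarith

end Sampling
end SimpleGraph

namespace SimpleGraph
-- Highly connected subgraphs, after Mader.
section HighlyConnected
open Finset Classical

variable {V : Type*}

/-- A graph of large average degree contains a set `S` inducing a subgraph of large minimum degree
and large average degree without separations of small order. -/
theorem exists_highly_connected_set (G : SimpleGraph V) (S₀ : Finset V) (γ c : ℕ) (hc : 1 ≤ c)
    (hγ : 2 * c ≤ γ) (hS₀ : S₀.Nonempty) (h : 2 * γ * #S₀ ≤ G.adjCount S₀ S₀) :
    ∃ S : Finset V, 2 * c < #S ∧ (∀ v ∈ S, γ < G.degIn v S) ∧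
      2 * γ * #S < G.adjCount S S + 2 * γ * c ∧
      ∀ X Y : Finset V, X ∪ Y = S → #(X ∩ Y) ≤ c → (∀ x ∈ X \ Y, ∀ y ∈ Y \ X, ¬ G.Adj x y) →
        (X \ Y).Nonempty → (Y \ X).Nonempty → False := by
  -- The surplus `adjCount - 2γ(#S - c)` is to be positive, and `S` minimal. A separation of order
  -- at most `c` would split `S` into two proper subsets whose surpluses add up to at least that of
  -- `S`, while minimality makes both nonpositive.
  let P : Finset V → Prop := fun S => 2 * c ≤ #S ∧ 2 * γ * #S < G.adjCount S S + 2 * γ * c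
  have hP0 : P S₀ := by
    have h1 := hS₀.card_pos
    have h2 : 2 * γ * #S₀ ≤ #S₀ * #S₀ := h.trans adjCount_le_card_mul
    have h3 : 2 * γ ≤ #S₀ := Nat.le_of_mul_le_mul_right h2 h1
    refine ⟨by omega, ?_⟩
    have : 0 < 2 * γ * c := Nat.mul_pos (by omega) (by omega)
    omega
  obtain ⟨S, hS⟩ : ∃ S, Minimal P S := by
    have : ∃ n, ∃ S, P S ∧ #S = n := ⟨_, S₀, hP0, rfl⟩
    obtain ⟨S, hPS, hn⟩ := Nat.find_spec this
    refine ⟨S, hPS, fun T hT hle => ?_⟩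
    have := Nat.find_min' this ⟨T, hT, rfl⟩
    exact (eq_of_subset_of_card_le hle (by omega)).ge
  have hmin : ∀ T ⊂ S, 2 * c ≤ #T → G.adjCount T T + 2 * γ * c ≤ 2 * γ * #T := by
    intro T hT hcT
    by_contra hcon
    push Not at hcon
    exact hT.2 (hS.2 ⟨hcT, hcon⟩ hT.1)
  obtain ⟨hS1, hS2⟩ := hS.1
  -- With exactly `2c` vertices there would be more than `2γc ≥ 4c²` adjacent pairs, too many for
  -- `(2c)²` places. Strictness leaves room to erase a vertex.
  have hcard : 2 * c < #S := by
    rcases hS1.lt_or_eq with h | h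
    · exact h
    · have h1 := adjCount_le_card_mul (G := G) (X := S) (Y := S)
      rw [← h] at hS2 h1
      nlinarith
  have hdeg : ∀ v ∈ S, γ < G.degIn v S := by
    intro v hv
    have h1 := hmin (S.erase v) (erase_ssubset hv) (by rw [card_erase_of_mem hv]; omega)
    have h2 := adjCount_erase_self (G := G) hv
    have h3 : #S = #(S.erase v) + 1 := by rw [card_erase_of_mem hv]; omega
    rw [h3] at hS2
    have : 2 * γ * (#(S.erase v) + 1) = 2 * γ * #(S.erase v) + 2 * γ := by ring
    omega
  refine ⟨S, hcard, hdeg, hS2, fun X Y hXY hc' hno hX hY => ?_⟩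
  have aux : ∀ X Y : Finset V, X ∪ Y = S → (∀ x ∈ X \ Y, ∀ y ∈ Y \ X, ¬ G.Adj x y) →
      (X \ Y).Nonempty → 2 * c ≤ #X := by
    intro X Y hXY hno hX
    obtain ⟨v, hv⟩ := hX
    have h1 := hdeg v (hXY ▸ mem_union_left _ (mem_sdiff.1 hv).1)
    have h2 : G.degIn v S ≤ #X := by
      refine card_le_card fun y hy => ?_
      rw [mem_filter, ← hXY, mem_union] at hy
      by_contra hyX
      exact hno v hv y (mem_sdiff.2 ⟨hy.1.resolve_left hyX, hyX⟩) hy.2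
    omega
  have hcX := aux X Y hXY hno hX
  have hcY := aux Y X (by rw [union_comm, hXY]) (fun x hx y hy h => hno y hy x hx h.symm) hY
  have h1 := hmin X (by
    rw [← hXY]; refine ⟨subset_union_left, fun h => ?_⟩
    obtain ⟨y, hy⟩ := hY
    exact (mem_sdiff.1 hy).2 (h (mem_union_right _ (mem_sdiff.1 hy).1))) hcX
  have h2 := hmin Y (by
    rw [← hXY]; refine ⟨subset_union_right, fun h => ?_⟩
    obtain ⟨y, hy⟩ := hX
    exact (mem_sdiff.1 hy).2 (h (mem_union_left _ (mem_sdiff.1 hy).1))) hcY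
  have h3 : G.adjCount S S ≤ G.adjCount X X + G.adjCount Y Y := by
    simp only [adjCount_eq_card]
    refine le_trans (card_le_card ?_) (card_union_le _ _)
    intro e he
    simp only [← hXY, mem_filter, mem_product, mem_union] at he
    simp only [mem_filter, mem_product, mem_union]
    have a1 := hno e.1
    have a2 := hno e.2
    simp only [mem_sdiff] at a1 a2
    by_contra hcon
    have hadj := he.2
    by_cases p1 : e.1 ∈ X <;> by_cases p2 : e.2 ∈ X <;> by_cases p3 : e.1 ∈ Y <;>
      by_cases p4 : e.2 ∈ Y <;> simp [p1, p2, p3, p4, he.2] at he hcon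
    · exact a1 ⟨p1, p3⟩ e.2 ⟨p4, p2⟩ hadj
    · exact a2 ⟨p2, p4⟩ e.1 ⟨p3, p1⟩ hadj.symm
  have h4 : #S + #(X ∩ Y) = #X + #Y := by rw [← hXY]; exact card_union_add_card_inter X Y
  have h5 : 2 * γ * #S + 2 * γ * #(X ∩ Y) = 2 * γ * #X + 2 * γ * #Y := by
    rw [← mul_add, ← mul_add, h4]
  have h6 : 2 * γ * #(X ∩ Y) ≤ 2 * γ * c := Nat.mul_le_mul_left _ hc'
  omega

/-- In a set without separations of small order, disjoint paths between large sets exist even after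
the deletion of few vertices. -/
theorem hasDisjointPaths_of_no_separation [Finite V] {G : SimpleGraph V} {S F A B : Finset V}
    {c n : ℕ}
    (hS : ∀ X Y : Finset V, X ∪ Y = S → #(X ∩ Y) ≤ c → (∀ x ∈ X \ Y, ∀ y ∈ Y \ X, ¬ G.Adj x y) →
      (X \ Y).Nonempty → (Y \ X).Nonempty → False)
    (hA : A ⊆ S \ F) (hB : B ⊆ S \ F) (hnA : n ≤ #A) (hnB : n ≤ #B)
    (hc : n + #F ≤ c) : (G.restrict (S \ F)).HasDisjointPaths A B n := by
  refine hasDisjointPaths_of_forall_separates _ A B n fun T hT => ?_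
  by_contra hlt
  push Not at hlt
  have ex : ∀ A : Finset V, n ≤ #A → ∃ a ∈ A, a ∉ T := by
    intro A hnA
    by_contra hcon
    push Not at hcon
    have := card_le_card (show A ⊆ T from hcon)
    omega
  obtain ⟨a, haA, haT⟩ := ex A hnA
  obtain ⟨b, hbB, hbT⟩ := ex B hnB
  rw [separates_iff] at hT
  -- If fewer than `n` vertices `T` separated `A` from `B`, this component together with `T ∪ F`
  -- would be one side of a separation of `S` of order less than `n + #F ≤ c`.
  let C : Finset V := {v ∈ S \ F | (G.restrict (S \ F)).ReachAvoiding T a v}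
  have hCT : ∀ v ∈ C, v ∉ T := by
    intro v hv
    obtain ⟨w, hw⟩ := (mem_filter.1 hv).2
    exact hw v (by simp)
  have hCF : ∀ v ∈ C, v ∉ F := fun v hv => (mem_sdiff.1 (mem_filter.1 hv).1).2
  have hCS : ∀ v ∈ C, v ∈ S := fun v hv => (mem_sdiff.1 (mem_filter.1 hv).1).1
  refine hS (C ∪ (S ∩ (T ∪ F))) (S \ C) ?_ ?_ ?_ ⟨a, ?_⟩ ⟨b, ?_⟩
  · ext v
    have := hCS v
    simp only [mem_union, mem_inter, mem_sdiff]
    tauto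
  · refine le_trans (card_le_card ?_) ((card_union_le T F).trans (by omega))
    intro v
    simp only [mem_union, mem_inter, mem_sdiff]
    tauto
  · intro x hx y hy hxy
    simp only [mem_union, mem_inter, mem_sdiff, not_or, not_and, not_not] at hx hy
    have hxC : x ∈ C := by
      rcases hx.1 with h | h
      · exact h
      · exact hx.2 h.1
    obtain ⟨⟨hyS, hyC⟩, -, hyTF⟩ := hy
    have hyTF := hyTF hyS
    apply hyC
    have hySF : y ∈ S \ F := by simp [hyS, hyTF]
    refine mem_filter.2 ⟨hySF, (mem_filter.1 hxC).2.trans ?_⟩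
    have hadj : (G.restrict (S \ F)).Adj x y := ⟨hxy, (mem_filter.1 hxC).1, hySF⟩
    refine ⟨hadj.toWalk, fun z hz => ?_⟩
    have : z = x ∨ z = y := by simpa using hz
    rcases this with rfl | rfl
    · exact hCT _ hxC
    · exact hyTF.1
  · have : a ∈ C := mem_filter.2 ⟨hA haA, .refl haT⟩
    simp [this]
  · have hbC : b ∉ C := fun h => hT a haA b hbB (mem_filter.1 h).2
    have := mem_sdiff.1 (hB hbB)
    simp [hbC, this.1, this.2, hbT]

end HighlyConnected
end SimpleGraph

namespace SimpleGraph
-- Clique minors in dense graphs.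
section CliqueModel
open Finset Classical

variable {V : Type*}

/-- In a dense graph there are `t` vertices any two of which have many common neighbours. -/
theorem exists_common_neighbours_of_dense (Q : SimpleGraph V) (U : Finset V) (D t : ℕ)
    (ht : 1 ≤ t) (hD : 16 * t ^ 3 ≤ D) (hU : U.Nonempty) (hm : #U ≤ 2 * D)
    (hdeg : ∀ u ∈ U, D ≤ Q.degIn u U) :
    ∃ X ⊆ U, #X = t ∧ ∀ x ∈ X, ∀ y ∈ X, 2 * t ^ 2 ≤ #{z ∈ U | Q.Adj x z ∧ Q.Adj y z} := by
  set h : ℕ := 2 * t ^ 2 with hh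
  let bad : SimpleGraph V :=
    { Adj := fun x y => x ≠ y ∧ #{z ∈ U | Q.Adj x z ∧ Q.Adj y z} < h
      symm := ⟨fun x y hxy => ⟨hxy.1.symm, by simpa only [and_comm] using hxy.2⟩⟩
      loopless := ⟨fun x hx => hx.1 rfl⟩ }
  let N : V → Finset V := fun r => {u ∈ U | Q.Adj r u}
  have hsum : ∑ r ∈ U, bad.adjCount (N r) (N r) ≤ #U * (#U * h) := by
    have e : ∀ r ∈ U, bad.adjCount (N r) (N r) =
        ∑ x ∈ U, ∑ y ∈ U, if (Q.Adj r x ∧ Q.Adj r y) ∧ bad.Adj x y then 1 else 0 := by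
      intro r _
      rw [adjCount_eq_sum, sum_filter]
      refine sum_congr rfl fun x _ => ?_
      rw [sum_filter]
      split_ifs with hx
      · refine sum_congr rfl fun y _ => ?_
        by_cases h1 : Q.Adj r y <;> by_cases h2 : bad.Adj x y <;> simp [hx, h1, h2]
      · simp [hx]
    rw [sum_congr rfl e, sum_comm]
    calc _ ≤ ∑ x ∈ U, #U * h := sum_le_sum fun x _ => ?_
      _ = _ := by simp
    rw [sum_comm]
    calc _ ≤ ∑ y ∈ U, h := sum_le_sum fun y _ => ?_
      _ = _ := by simp
    by_cases hb : bad.Adj x y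
    · have := hb.2
      rw [card_filter] at this
      refine le_trans (le_of_eq ?_) this.le
      refine sum_congr rfl fun r _ => ?_
      simp only [hb, and_true, Q.adj_comm r]
    · simp [hb]
  -- A bad pair lies in fewer than `h` neighbourhoods, so an average neighbourhood contains few bad
  -- pairs.
  obtain ⟨r, hr, hrbad⟩ : ∃ r ∈ U, bad.adjCount (N r) (N r) ≤ #U * h := by
    by_contra hcon
    push Not at hcon
    have := sum_lt_sum_of_nonempty hU hcon
    rw [sum_const, smul_eq_mul] at this
    omega
  have hhpos : (0 : ℝ) < h := by rw [hh]; positivity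
  have hh1 : (1 : ℝ) ≤ h := by exact_mod_cast (show 0 < h by rw [hh]; positivity)
  -- With at least `D` vertices and at most `2Dh` bad ordered pairs, this density leaves `D / (8h) =
  -- D / (16t²) ≥ t` vertices.
  obtain ⟨I, hIN, hI, hIc⟩ := exists_independent_subset bad (N r) (ρ := 1 / (4 * h))
    (by positivity) (by rw [div_le_one (by positivity)]; linarith)
  have hNr : (D : ℝ) ≤ #(N r) := by exact_mod_cast hdeg r hr
  have htI : t ≤ #I := by
    have h1 : (bad.adjCount (N r) (N r) : ℝ) ≤ 2 * D * h := by
      have : bad.adjCount (N r) (N r) ≤ 2 * D * h := hrbad.trans (Nat.mul_le_mul_right _ hm)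
      exact_mod_cast this
    have h2 : (1 / (4 * h) : ℝ) * D - (1 / (4 * h)) ^ 2 * (2 * D * h) ≤ #I := by
      refine le_trans ?_ hIc
      gcongr
    have h3 : (1 / (4 * h) : ℝ) * D - (1 / (4 * h)) ^ 2 * (2 * D * h) = D / (8 * h) := by
      field_simp; ring
    have h4 : (t : ℝ) ≤ D / (8 * h) := by
      rw [le_div_iff₀ (by positivity), hh]
      have : (16 * t ^ 3 : ℝ) ≤ D := by exact_mod_cast hD
      push_cast
      linarith
    exact_mod_cast h4.trans (h3 ▸ h2)
  obtain ⟨X, hXI, hXt⟩ := exists_subset_card_eq htI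
  refine ⟨X, (hXI.trans hIN).trans (filter_subset _ _), hXt, fun x hx y hy => ?_⟩
  by_cases hxy : x = y
  · subst hxy
    have h1 := hdeg x (mem_of_mem_filter x (hIN (hXI hx)))
    have h2 : h ≤ D := by
      refine le_trans ?_ hD
      rw [hh]
      nlinarith [pow_pos (show 0 < t from ht) 2]
    simp only [and_self]
    exact h2.trans h1
  · by_contra hlt
    exact hI x (hXI hx) y (hXI hy) ⟨hxy, not_le.1 hlt⟩

/-- `B` models the graph `Q` on the vertex set `I` as a minor of `G` inside `S`. -/
structure IsMinorModel (G : SimpleGraph V) (S I : Finset V) (Q : SimpleGraph V)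
    (B : V → Finset V) : Prop where
  connectedOn : ∀ i ∈ I, G.ConnectedOn (B i)
  subset : ∀ i ∈ I, B i ⊆ S
  disjoint : ∀ i ∈ I, ∀ j ∈ I, i ≠ j → Disjoint (B i) (B j)
  adj : ∀ i ∈ I, ∀ j ∈ I, Q.Adj i j → ∃ x ∈ B i, ∃ y ∈ B j, G.Adj x y

/-- The graph obtained by contracting `j` into `i` (the vertex `j` is kept). -/
def contractInto (Q : SimpleGraph V) (i j : V) : SimpleGraph V where
  Adj u v := u ≠ v ∧ (Q.Adj u v ∨ (u = i ∧ Q.Adj j v) ∨ (v = i ∧ Q.Adj u j))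
  symm := ⟨fun u v h => ⟨h.1.symm, by
    rcases h.2 with h | ⟨h, h'⟩ | ⟨h, h'⟩
    · exact .inl h.symm
    · exact .inr (.inr ⟨h, h'.symm⟩)
    · exact .inr (.inl ⟨h, h'.symm⟩)⟩⟩
  loopless := ⟨fun _ h => h.1 rfl⟩

theorem IsMinorModel.contract {G : SimpleGraph V} {S I : Finset V} {Q : SimpleGraph V}
    {B : V → Finset V} (h : IsMinorModel G S I Q B) {i j : V} (hi : i ∈ I) (hj : j ∈ I)
    (hij : Q.Adj i j) : IsMinorModel G S (I.erase j) (Q.contractInto i j)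
      (fun v => if v = i then B i ∪ B j else B v) := by
  have hne := hij.ne
  refine ⟨fun v hv => ?_, fun v hv => ?_, fun u hu v hv huv => ?_, fun u hu v hv huv => ?_⟩
  · split_ifs with hvi
    · obtain ⟨x, hx, y, hy, hxy⟩ := h.adj i hi j hj hij
      exact (h.connectedOn i hi).union_of_adj (h.connectedOn j hj) hx hy hxy
    · exact h.connectedOn v (mem_of_mem_erase hv)
  · split_ifs with hvi
    · exact union_subset (h.subset i hi) (h.subset j hj)
    · exact h.subset v (mem_of_mem_erase hv)
  · rw [mem_erase] at hu hv
    split_ifs with h1 h2 h2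
    · exact absurd (h1.trans h2.symm) huv
    · exact disjoint_union_left.2 ⟨h.disjoint i hi v hv.2 (Ne.symm h2),
        h.disjoint j hj v hv.2 (Ne.symm hv.1)⟩
    · exact disjoint_union_right.2 ⟨h.disjoint u hu.2 i hi h1, h.disjoint u hu.2 j hj hu.1⟩
    · exact h.disjoint u hu.2 v hv.2 huv
  · rw [mem_erase] at hu hv
    have mono : ∀ v ∈ I, ∀ x ∈ B v, x ∈ (if v = i then B i ∪ B j else B v) := by
      intro v hv x hx
      split_ifs with hvi
      · subst hvi; exact mem_union_left _ hx
      · exact hx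
    obtain ⟨-, h1 | ⟨rfl, h1⟩ | ⟨rfl, h1⟩⟩ := huv
    · obtain ⟨x, hx, y, hy, hxy⟩ := h.adj u hu.2 v hv.2 h1
      exact ⟨x, mono u hu.2 x hx, y, mono v hv.2 y hy, hxy⟩
    · obtain ⟨x, hx, y, hy, hxy⟩ := h.adj j hj v hv.2 h1
      exact ⟨x, by simp [hx], y, mono v hv.2 y hy, hxy⟩
    · obtain ⟨x, hx, y, hy, hxy⟩ := h.adj u hu.2 j hj h1
      exact ⟨x, mono u hu.2 x hx, y, by simp [hy], hxy⟩

/-- Only the edge `ij` and one edge for each common neighbour are lost: the other neighbours of `j`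
become new neighbours of `i`. -/
theorem adjCount_contractInto (Q : SimpleGraph V) {I : Finset V} {i j : V} (hi : i ∈ I)
    (hj : j ∈ I) (hij : Q.Adj i j) :
    Q.adjCount I I ≤ (Q.contractInto i j).adjCount (I.erase j) (I.erase j) +
      2 * (1 + #{v ∈ I | Q.Adj i v ∧ Q.Adj j v}) := by
  set U : Finset V := {v ∈ I | Q.Adj j v ∧ v ≠ i ∧ ¬ Q.Adj i v} with hU
  have hdeg : Q.degIn j I ≤ 1 + #{v ∈ I | Q.Adj i v ∧ Q.Adj j v} + #U := by
    rw [degIn]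
    calc _ ≤ #(({i} ∪ {v ∈ I | Q.Adj i v ∧ Q.Adj j v}) ∪ U) := card_le_card fun v hv => ?_
      _ ≤ _ := (card_union_le _ _).trans (by
        gcongr; exact (card_union_le _ _).trans (by simp))
    simp only [hU, mem_union, mem_filter, mem_singleton] at hv ⊢
    tauto
  have hUI : ∀ u ∈ U, u ∈ I.erase j ∧ u ≠ i ∧ Q.Adj j u ∧ ¬ Q.Adj i u := by
    intro u hu
    simp only [hU, mem_filter] at hu
    exact ⟨mem_erase.2 ⟨hu.2.1.ne', hu.1⟩, hu.2.2.1, hu.2.1, hu.2.2.2⟩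
  have hiI : i ∈ I.erase j := mem_erase.2 ⟨hij.ne, hi⟩
  have hcount : Q.adjCount (I.erase j) (I.erase j) + 2 * #U ≤
      (Q.contractInto i j).adjCount (I.erase j) (I.erase j) := by
    rw [adjCount_eq_card, adjCount_eq_card]
    have d1 : Disjoint {e ∈ I.erase j ×ˢ I.erase j | Q.Adj e.1 e.2} ({i} ×ˢ U) := by
      rw [Finset.disjoint_left]
      rintro ⟨a, b⟩ h1 h2
      simp only [mem_filter, mem_product, mem_singleton] at h1 h2
      obtain ⟨rfl, h2⟩ := h2
      exact (hUI b h2).2.2.2 h1.2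
    have d2 : Disjoint ({e ∈ I.erase j ×ˢ I.erase j | Q.Adj e.1 e.2} ∪ {i} ×ˢ U) (U ×ˢ {i}) := by
      rw [Finset.disjoint_left]
      rintro ⟨a, b⟩ h1 h2
      simp only [mem_union, mem_filter, mem_product, mem_singleton] at h1 h2
      obtain ⟨h2, rfl⟩ := h2
      rcases h1 with h1 | h1
      · exact (hUI a h2).2.2.2 h1.2.symm
      · exact (hUI a h2).2.1 h1.1
    calc _ = #(({e ∈ I.erase j ×ˢ I.erase j | Q.Adj e.1 e.2} ∪ {i} ×ˢ U) ∪ U ×ˢ {i}) := by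
          rw [card_union_of_disjoint d2, card_union_of_disjoint d1, card_product, card_product]
          simp; ring
      _ ≤ _ := card_le_card ?_
    rintro ⟨a, b⟩ he
    simp only [mem_union, mem_filter, mem_product, mem_singleton] at he ⊢
    rcases he with (he | ⟨rfl, hb⟩) | ⟨ha, rfl⟩
    · exact ⟨he.1, he.2.ne, .inl he.2⟩
    · have := hUI b hb
      exact ⟨⟨hiI, this.1⟩, this.2.1.symm, .inr (.inl ⟨rfl, this.2.2.1⟩)⟩
    · have := hUI a ha
      exact ⟨⟨this.1, hiI⟩, this.2.1, .inr (.inr ⟨rfl, this.2.2.1.symm⟩)⟩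
  have := adjCount_erase_self (G := Q) hj
  omega

theorem adjCount_deleteEdge (Q : SimpleGraph V) {I : Finset V} {i j : V} (hi : i ∈ I)
    (hj : j ∈ I) (hij : Q.Adj i j) :
    (Q.deleteEdges {s(i, j)}).adjCount I I + 2 = Q.adjCount I I := by
  rw [adjCount_eq_card, adjCount_eq_card]
  have h2 : #({(i, j), (j, i)} : Finset (V × V)) = 2 := by
    apply card_pair
    intro h
    exact hij.ne (congrArg Prod.fst h)
  rw [← h2, ← card_union_of_disjoint]
  · congr 1
    ext ⟨a, b⟩
    simp only [mem_union, mem_filter, mem_product, deleteEdges_adj, Set.mem_singleton_iff,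
      mem_insert, mem_singleton, Prod.mk.injEq, Sym2.eq_iff]
    constructor
    · rintro (h | ⟨rfl, rfl⟩ | ⟨rfl, rfl⟩)
      · exact ⟨h.1, h.2.1⟩
      · exact ⟨⟨hi, hj⟩, hij⟩
      · exact ⟨⟨hj, hi⟩, hij.symm⟩
    · rintro ⟨h, h'⟩
      tauto
  · rw [Finset.disjoint_left]
    rintro ⟨a, b⟩ h h'
    simp only [mem_filter, mem_product, deleteEdges_adj, Set.mem_singleton_iff,
      mem_insert, mem_singleton, Prod.mk.injEq, Sym2.eq_iff] at h h'
    exact h.2.2 h'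

/-- Disjoint connected subsets of `S`, pairwise joined by an edge: a model of a complete minor. -/
structure IsCliqueModel {ι : Type*} (G : SimpleGraph V) (S : Finset V) (B : ι → Finset V) :
    Prop where
  connectedOn : ∀ i, G.ConnectedOn (B i)
  subset : ∀ i, B i ⊆ S
  disjoint : ∀ i j, i ≠ j → Disjoint (B i) (B j)
  adj : ∀ i j, i ≠ j → ∃ x ∈ B i, ∃ y ∈ B j, G.Adj x y

/-- A graph of average degree at least `32 t ^ 3` contains a complete minor on `t` vertices. -/
theorem exists_isCliqueModel (G : SimpleGraph V) (S : Finset V) (D t : ℕ)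
    (ht : 1 ≤ t) (hD : 16 * t ^ 3 ≤ D) (hS : S.Nonempty) (h : 2 * D * #S ≤ G.adjCount S S) :
    ∃ B : Fin t → Finset V, IsCliqueModel G S B := by
  have hDpos : 1 ≤ D := le_trans (by nlinarith [pow_pos (show 0 < t from ht) 3]) hD
  -- A minor of at least the given density is chosen with as few vertices, and then as few edges, as
  -- possible. Contractions then show that each edge lies in `D` triangles, and edge deletions that
  -- some degree is at most `2D`. The neighbourhood of such a vertex has at most `2D` vertices and
  -- minimum degree at least `D`.
  let P : Finset V → SimpleGraph V → Prop := fun I Q =>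
    I.Nonempty ∧ 2 * D * #I ≤ Q.adjCount I I ∧ ∃ B, IsMinorModel G S I Q B
  have hP0 : P S G := by
    refine ⟨hS, h, fun v => {v}, fun v _ => connectedOn_singleton v, fun v hv => by simpa using hv,
      fun u _ v _ huv => by simpa using huv, fun u _ v _ huv => ?_⟩
    exact ⟨u, by simp, v, by simp, huv⟩
  have ex1 : ∃ n, ∃ I Q, P I Q ∧ #I = n := ⟨_, S, G, hP0, rfl⟩
  have ex2 : ∃ m, ∃ I Q, P I Q ∧ #I = Nat.find ex1 ∧ Q.adjCount I I = m := by
    obtain ⟨I, Q, h1, h2⟩ := Nat.find_spec ex1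
    exact ⟨_, I, Q, h1, h2, rfl⟩
  obtain ⟨I, Q, ⟨hI, hIQ, B, hB⟩, hcard, hcount⟩ := Nat.find_spec ex2
  have hmin1 : ∀ I' Q', P I' Q' → #I ≤ #I' := fun I' Q' h' => by
    rw [hcard]; exact Nat.find_min' ex1 ⟨I', Q', h', rfl⟩
  have hmin2 : ∀ Q', P I Q' → Q.adjCount I I ≤ Q'.adjCount I I := fun Q' h' => by
    rw [hcount]; exact Nat.find_min' ex2 ⟨I, Q', h', hcard, rfl⟩
  have hI2 : 2 ≤ #I := by
    have h1 : 2 * D * #I ≤ #I * #I := hIQ.trans adjCount_le_card_mul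
    have h3 : 2 * D ≤ #I := Nat.le_of_mul_le_mul_right h1 hI.card_pos
    omega
  -- edges lie in many triangles
  have htri : ∀ i ∈ I, ∀ j ∈ I, Q.Adj i j → D ≤ #{v ∈ I | Q.Adj i v ∧ Q.Adj j v} := by
    intro i hi j hj hij
    by_contra hlt
    push Not at hlt
    have h1 := adjCount_contractInto Q hi hj hij
    have hce : #(I.erase j) + 1 = #I := by rw [card_erase_of_mem hj]; omega
    have h2 : P (I.erase j) (Q.contractInto i j) := by
      refine ⟨card_pos.1 (by omega), ?_, _, hB.contract hi hj hij⟩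
      have : 2 * D * #I = 2 * D * #(I.erase j) + 2 * D := by rw [← hce]; ring
      omega
    have := hmin1 _ _ h2
    omega
  have hupper : Q.adjCount I I ≤ 2 * D * #I + 1 := by
    by_contra hlt
    push Not at hlt
    have hpos : 0 < Q.adjCount I I := by omega
    rw [adjCount_eq_card, card_pos] at hpos
    obtain ⟨⟨i, j⟩, he⟩ := hpos
    simp only [mem_filter, mem_product] at he
    have h1 := adjCount_deleteEdge Q he.1.1 he.1.2 he.2
    have h2 : P I (Q.deleteEdges {s(i, j)}) :=
      ⟨hI, by omega, B, hB.1, hB.2, hB.3, fun u hu v hv huv =>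
        hB.adj u hu v hv (deleteEdges_le _ huv)⟩
    have := hmin2 _ h2
    omega
  obtain ⟨v, hv, hvdeg⟩ : ∃ v ∈ I, Q.degIn v I ≤ 2 * D := by
    by_contra hcon
    push Not at hcon
    have h1 : ∑ _v ∈ I, (2 * D + 1) ≤ ∑ v ∈ I, Q.degIn v I := sum_le_sum fun v hv => hcon v hv
    rw [sum_const, smul_eq_mul] at h1
    have h2 : #I * (2 * D + 1) = 2 * D * #I + #I := by ring
    have : Q.adjCount I I = ∑ v ∈ I, Q.degIn v I := rfl
    omega
  have hvpos : 0 < Q.degIn v I := by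
    by_contra h0
    have h0 : Q.degIn v I = 0 := by omega
    have h1 := adjCount_erase_self (G := Q) hv
    have hce : #(I.erase v) + 1 = #I := by rw [card_erase_of_mem hv]; omega
    have h2 : P (I.erase v) Q := by
      refine ⟨card_pos.1 (by omega), ?_, B, fun i hi => hB.1 i (mem_of_mem_erase hi),
        fun i hi => hB.2 i (mem_of_mem_erase hi), fun i hi j hj =>
          hB.3 i (mem_of_mem_erase hi) j (mem_of_mem_erase hj), fun i hi j hj =>
          hB.4 i (mem_of_mem_erase hi) j (mem_of_mem_erase hj)⟩
      have : 2 * D * #I = 2 * D * #(I.erase v) + 2 * D := by rw [← hce]; ring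
      omega
    have := hmin1 _ _ h2
    omega
  let U : Finset V := {u ∈ I | Q.Adj v u}
  have hUI : U ⊆ I := filter_subset _ _
  obtain ⟨X, hXU, hXt, hX⟩ := exists_common_neighbours_of_dense Q U D t ht hD (card_pos.1 hvpos)
    hvdeg (fun u hu => by
      have hu := mem_filter.1 hu
      refine (htri v hv u hu.1 hu.2).trans (card_le_card fun z hz => ?_)
      simp only [U, mem_filter] at hz ⊢
      tauto)
  obtain ⟨f⟩ : Nonempty (Fin t ≃ X) := ⟨(Fintype.equivFinOfCardEq (by simpa using hXt)).symm⟩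
  -- Distinct connectors for all ordered pairs: each pair has `2t²` common neighbours, of which at
  -- least `2t² - t ≥ t²` lie outside `X`.
  obtain ⟨c, hcinj, hc⟩ := exists_injective_mem
    (fun ij : Fin t × Fin t => {z ∈ U | Q.Adj (f ij.1) z ∧ Q.Adj (f ij.2) z} \ X) (by
      intro ij
      have h1 := hX _ (f ij.1).2 _ (f ij.2).2
      have h2 := le_card_sdiff X {z ∈ U | Q.Adj (f ij.1) z ∧ Q.Adj (f ij.2) z}
      simp only [Fintype.card_prod, Fintype.card_fin]
      have : t ≤ t ^ 2 := by nlinarith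
      have : t * t = t ^ 2 := by ring
      omega)
  simp only [mem_sdiff, mem_filter] at hc
  have hfI : ∀ i, (f i : V) ∈ I := fun i => hUI (hXU (f i).2)
  have hcI : ∀ ij, c ij ∈ I := fun ij => hUI (hc ij).1.1
  -- The `i`-th set absorbs all connectors `c (i, j)`, and `c (i, j)` is adjacent to the centre of
  -- the `j`-th set.
  refine ⟨fun i => B (f i) ∪ univ.biUnion fun j => B (c (i, j)), fun i => ?_, fun i => ?_,
    fun i j hij => ?_, fun i j hij => ?_⟩
  · refine (hB.connectedOn _ (hfI i)).union_biUnion _ _ (fun j _ => hB.connectedOn _ (hcI _))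
      fun j _ => ?_
    exact hB.adj _ (hfI i) _ (hcI _) (hc (i, j)).1.2.1
  · refine union_subset (hB.subset _ (hfI i)) (biUnion_subset.2 fun j _ => hB.subset _ (hcI _))
  · have hne : ∀ i' ij, (f i' : V) ≠ c ij := fun i' ij h' => (hc ij).2 (h' ▸ (f i').2)
    simp only [disjoint_union_left, disjoint_union_right, disjoint_biUnion_left,
      disjoint_biUnion_right]
    refine ⟨⟨hB.disjoint _ (hfI i) _ (hfI j) fun h' => hij (f.injective (Subtype.ext h')),
      fun l _ => ?_⟩, fun l _ => ⟨?_, fun l' _ => ?_⟩⟩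
    all_goals first
      | exact hB.disjoint _ (hcI _) _ (hfI _) (Ne.symm (hne _ _))
      | exact hB.disjoint _ (hfI _) _ (hcI _) (hne _ _)
      | exact hB.disjoint _ (hcI _) _ (hcI _) fun h' => hij (congrArg Prod.fst (hcinj h'))
  · obtain ⟨x, hx, y, hy, hxy⟩ := hB.adj _ (hcI (i, j)) _ (hfI j) (hc (i, j)).1.2.2.symm
    exact ⟨x, mem_union_right _ (mem_biUnion.2 ⟨j, mem_univ _, hx⟩), y, mem_union_left _ hy, hxy⟩

end CliqueModel
end SimpleGraph

namespace SimpleGraph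
-- Rooting a clique minor at linked vertices.
section RootedModel
open Finset Classical

variable {V ι τ : Type*} {G : SimpleGraph V} {B : τ → Finset V}

/-- The number of steps of a walk that do not stay inside one of the sets `B c`. -/
noncomputable def Walk.externalSteps (B : τ → Finset V) {u v : V} (w : G.Walk u v) : ℕ :=
  w.darts.countP fun d => decide (¬ ∃ c, d.fst ∈ B c ∧ d.snd ∈ B c)

theorem Walk.externalSteps_append {u v x : V} (p : G.Walk u v) (q : G.Walk v x) :
    (p.append q).externalSteps B = p.externalSteps B + q.externalSteps B := by
  simp [externalSteps, Walk.darts_append, List.countP_append]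

theorem Walk.externalSteps_eq_zero {u v : V} (p : G.Walk u v) {c : τ}
    (h : ∀ x ∈ p.support, x ∈ B c) : p.externalSteps B = 0 := by
  rw [externalSteps, List.countP_eq_zero]
  intro d hd
  simp only [decide_eq_true_eq, not_not]
  exact ⟨c, h _ (p.dart_fst_mem_support_of_mem_darts hd),
    h _ (p.dart_snd_mem_support_of_mem_darts hd)⟩

theorem Walk.externalSteps_toWalk_le {u v : V} (h : G.Adj u v) :
    h.toWalk.externalSteps B ≤ 1 := by
  rw [externalSteps]
  exact List.countP_le_length.trans (by simp)

theorem Walk.mem_of_externalSteps_eq_zero (hB : ∀ c c', c ≠ c' → Disjoint (B c) (B c'))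
    {u v : V} (p : G.Walk u v) (h : p.externalSteps B = 0) {c : τ} (hu : u ∈ B c) : v ∈ B c := by
  induction p with
  | nil => exact hu
  | @cons u x v hux p ih =>
    rw [externalSteps, darts_cons, List.countP_cons] at h
    have h1 : p.externalSteps B = 0 := by rw [externalSteps]; omega
    have h2 : ∃ c, u ∈ B c ∧ x ∈ B c := by
      by_contra hcon
      simp [hcon] at h
    obtain ⟨c', hu', hx'⟩ := h2
    obtain rfl : c' = c := by
      by_contra hne
      exact Finset.disjoint_left.1 (hB c' c hne) hu' hu
    exact ih h1 hx'

theorem Walk.one_le_externalSteps (hB : ∀ c c', c ≠ c' → Disjoint (B c) (B c'))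
    {u v : V} (p : G.Walk u v) {c c' : τ} (hc : c ≠ c') (hu : u ∈ B c) (hv : v ∈ B c') :
    1 ≤ p.externalSteps B := by
  by_contra h
  exact Finset.disjoint_left.1 (hB c c' hc)
    (p.mem_of_externalSteps_eq_zero hB (by omega) hu) hv

theorem Walk.externalSteps_takeUntil_add {u v x : V} (p : G.Walk u v) (h : x ∈ p.support) :
    (p.takeUntil x h).externalSteps B + (p.dropUntil x h).externalSteps B =
      p.externalSteps B := by
  rw [← externalSteps_append, take_spec]

theorem Walk.mem_dropUntil_or {u v x y : V} (p : G.Walk u v) (hx : x ∈ p.support)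
    (hy : y ∈ p.support) :
    y ∈ (p.dropUntil x hx).support ∨ x ∈ (p.dropUntil y hy).support := by
  induction p with
  | nil =>
    simp only [support_nil, List.mem_singleton] at hx hy
    subst hx; subst hy; simp
  | @cons u z v h p ih =>
    by_cases hxu : u = x
    · subst hxu; left; rw [dropUntil_first]; exact hy
    by_cases hyu : u = y
    · subst hyu; right; rw [dropUntil_first]; exact hx
    have hx' : x ∈ p.support := by
      rcases List.mem_cons.1 (by simpa using hx) with h | h
      · exact absurd h.symm hxu
      · exact h
    have hy' : y ∈ p.support := by
      rcases List.mem_cons.1 (by simpa using hy) with h | h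
      · exact absurd h.symm hyu
      · exact h
    have := ih hx' hy'
    simpa [dropUntil, hxu, hyu] using this

/-- The initial segment of a walk up to the first vertex with property `q`. -/
theorem Walk.exists_first {u v : V} (p : G.Walk u v) (q : V → Prop) (hv : q v) :
    ∃ y, ∃ w : G.Walk u y, (∀ z ∈ w.support, z ∈ p.support) ∧ q y ∧ ∀ z ∈ w.support, q z → z = y := by
  induction p with
  | nil => exact ⟨_, .nil, by simp, hv, by simp⟩
  | @cons u x v h p ih =>
    by_cases hu : q u
    · exact ⟨u, .nil, by simp, hu, by simp⟩
    · obtain ⟨y, w, h1, h2, h3⟩ := ih hv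
      refine ⟨y, .cons h w, ?_, h2, ?_⟩
      · intro z hz
        rcases List.mem_cons.1 (by simpa using hz) with rfl | hz
        · simp
        · simp [h1 z hz]
      · intro z hz hqz
        rcases List.mem_cons.1 (by simpa using hz) with rfl | hz
        · exact absurd hqz hu
        · exact h3 z hz hqz

variable {z : ι → V}

/-- Disjoint walks from the roots `z i` to distinct sets `B (e i)`. -/
structure IsRootedLinkage (B : τ → Finset V) (e : ι → τ) (P : ∀ i, Σ x, G.Walk (z i) x) :
    Prop where
  injective : Function.Injective e
  mem : ∀ i, (P i).1 ∈ B (e i)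
  disjoint : ∀ i j, i ≠ j → ∀ v ∈ (P i).2.support, v ∉ (P j).2.support

/-- The total number of external steps is minimal among all linkages. -/
structure IsMinimalLinkage [Fintype ι] (B : τ → Finset V) (e : ι → τ)
    (P : ∀ i, Σ x, G.Walk (z i) x) : Prop extends IsRootedLinkage B e P where
  le : ∀ e' (P' : ∀ i, Σ x, G.Walk (z i) x), IsRootedLinkage B e' P' →
    ∑ i, (P i).2.externalSteps B ≤ ∑ i, (P' i).2.externalSteps B

theorem IsRootedLinkage.exists_minimal [Fintype ι] {e : ι → τ} {P : ∀ i, Σ x, G.Walk (z i) x}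
    (h : IsRootedLinkage B e P) :
    ∃ (e' : ι → τ) (P' : ∀ i, Σ x, G.Walk (z i) x), IsMinimalLinkage B e' P' := by
  have ex : ∃ m, ∃ (e : ι → τ) (P : ∀ i, Σ x, G.Walk (z i) x), IsRootedLinkage B e P ∧
    ∑ i, (P i).2.externalSteps B = m := ⟨_, e, P, h, rfl⟩
  obtain ⟨e', P', h1, h2⟩ := Nat.find_spec ex
  exact ⟨e', P', h1, fun e'' P'' h'' => h2 ▸ Nat.find_min' ex ⟨e'', P'', h'', rfl⟩⟩

section
variable [Fintype ι] {e : ι → τ} {P : ∀ i, Σ x, G.Walk (z i) x}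

/-- Rerouting one walk of a minimal linkage does not save external steps. -/
theorem IsMinimalLinkage.le_of_reroute (h : IsMinimalLinkage B e P) (l : ι) (c : τ) {x : V}
    (w : G.Walk (z l) x) (hx : x ∈ B c) (hc : ∀ j, j ≠ l → c ≠ e j)
    (hw : ∀ j, j ≠ l → ∀ v ∈ w.support, v ∉ (P j).2.support) :
    (P l).2.externalSteps B ≤ w.externalSteps B := by
  have hs : IsRootedLinkage B (Function.update e l c) (Function.update P l ⟨x, w⟩) := by
    refine ⟨fun i j hij => ?_, fun i => ?_, fun i j hij => ?_⟩
    · by_cases hi : i = l <;> by_cases hj : j = l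
      · rw [hi, hj]
      · subst hi
        rw [Function.update_self, Function.update_of_ne hj] at hij
        exact absurd hij (hc j hj)
      · subst hj
        rw [Function.update_self, Function.update_of_ne hi] at hij
        exact absurd hij.symm (hc i hi)
      · rw [Function.update_of_ne hi, Function.update_of_ne hj] at hij
        exact h.injective hij
    · by_cases hi : i = l
      · subst hi; simpa using hx
      · rw [Function.update_of_ne hi, Function.update_of_ne hi]; exact h.mem i
    · by_cases hi : i = l <;> by_cases hj : j = l
      · exact absurd (hi.trans hj.symm) hij
      · subst hi
        rw [Function.update_self, Function.update_of_ne hj]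
        exact hw j hj
      · subst hj
        rw [Function.update_self, Function.update_of_ne hi]
        exact fun v hv hv' => hw i hi v hv' hv
      · rw [Function.update_of_ne hi, Function.update_of_ne hj]
        exact h.disjoint i j hij
  have := h.le _ _ hs
  rw [← add_sum_erase _ _ (mem_univ l), ← add_sum_erase (a := l) _ _ (mem_univ l)] at this
  rw [Function.update_self] at this
  have e2 : ∑ i ∈ univ.erase l, (Function.update P l ⟨x, w⟩ i).2.externalSteps B =
      ∑ i ∈ univ.erase l, (P i).2.externalSteps B := by
    refine sum_congr rfl fun i hi => ?_
    rw [Function.update_of_ne (ne_of_mem_erase hi)]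
  simp only at this e2
  omega

/-- A walk that meets an unused set could stop there, saving at least one external step on its way
to its own set. -/
theorem IsMinimalLinkage.notMem_of_unused (h : IsMinimalLinkage B e P)
    (hB : ∀ c c', c ≠ c' → Disjoint (B c) (B c')) {W : τ} (hW : ∀ i, e i ≠ W) {i : ι} {v : V}
    (hv : v ∈ (P i).2.support) : v ∉ B W := by
  intro hvW
  have h1 := h.le_of_reroute i W ((P i).2.takeUntil v hv) hvW (fun j _ => (hW j).symm)
    (fun j hj u hu => h.disjoint i j hj.symm u ((P i).2.support_takeUntil_subset_support hv hu))
  have h2 := (P i).2.externalSteps_takeUntil_add (B := B) hv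
  have h3 := ((P i).2.dropUntil v hv).one_le_externalSteps hB (hW i).symm hvW (h.mem i)
  omega

/-- From an unused set `W` one reaches some walk of the linkage inside `B (e i)`, at a point from
where this walk makes at most one external step. -/
theorem IsMinimalLinkage.exists_hit {S : Finset V} (h : IsMinimalLinkage B e P)
    (hB : IsCliqueModel G S B) {W : τ} (hW : ∀ i, e i ≠ W) (i : ι) :
    ∃ (l : ι) (a y : V) (L : G.Walk a y) (hy : y ∈ (P l).2.support),
      (∀ v ∈ L.support, v ∈ B (e i)) ∧ (∃ b ∈ B W, G.Adj a b) ∧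
      (∀ v ∈ L.support, ∀ j, v ∈ (P j).2.support → v = y) ∧
      ((P l).2.dropUntil y hy).externalSteps B ≤ 1 := by
  obtain ⟨a, ha, b, hb, hab⟩ := hB.adj (e i) W (hW i)
  obtain ⟨w, hw⟩ := (hB.connectedOn (e i)).2 a ha _ (h.mem i)
  obtain ⟨y, L, hL, ⟨l, hl⟩, hfirst⟩ := w.exists_first (fun v => ∃ j, v ∈ (P j).2.support)
    ⟨i, by simp⟩
  have hLB : ∀ v ∈ L.support, v ∈ B (e i) := fun v hv => hw v (hL v hv)
  have hLP : ∀ v ∈ L.support, ∀ j, v ∈ (P j).2.support → v = y :=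
    fun v hv j hj => hfirst v hv ⟨j, hj⟩
  refine ⟨l, a, y, L, hl, hLB, ⟨b, hb, hab⟩, hLP, ?_⟩
  -- The walk `P l` is rerouted at `y`: back along `L` inside `B (e i)`, and then by one step into
  -- `W`. This costs at most one external step after `y`, so the original tail costs at most one.
  have h1 := h.le_of_reroute l W
    (((P l).2.takeUntil y hl).append (L.reverse.append hab.toWalk)) hb (fun j _ => (hW j).symm) (by
      intro j hj v hv hv'
      simp only [Walk.mem_support_append_iff, Walk.support_reverse, List.mem_reverse] at hv
      rcases hv with hv | hv | hv
      · exact h.disjoint l j hj.symm v ((P l).2.support_takeUntil_subset_support hl hv) hv'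
      · obtain rfl := hLP v hv j hv'
        exact h.disjoint l j hj.symm v hl hv'
      · have : v = a ∨ v = b := by simpa using hv
        rcases this with rfl | rfl
        · obtain rfl := hLP v (by simp) j hv'
          exact h.disjoint l j hj.symm v hl hv'
        · exact h.notMem_of_unused hB.disjoint hW hv' hb)
  rw [Walk.externalSteps_append, Walk.externalSteps_append] at h1
  have h2 := (P l).2.externalSteps_takeUntil_add (B := B) hl
  have h3 : L.reverse.externalSteps B = 0 :=
    L.reverse.externalSteps_eq_zero (c := e i) (by simpa using hLB)
  have h4 := Walk.externalSteps_toWalk_le (B := B) hab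
  omega

/-- Otherwise the walk, from the earlier of the two points, would pass through three different sets
and make two external steps. -/
theorem IsMinimalLinkage.eq_of_externalSteps_le_one (h : IsMinimalLinkage B e P)
    (hB : ∀ c c', c ≠ c' → Disjoint (B c) (B c')) {l : ι} {y y' : V} {c c' : τ}
    (hy : y ∈ (P l).2.support) (hy' : y' ∈ (P l).2.support)
    (h1 : ((P l).2.dropUntil y hy).externalSteps B ≤ 1)
    (h1' : ((P l).2.dropUntil y' hy').externalSteps B ≤ 1)
    (hc : y ∈ B c) (hc' : y' ∈ B c') (hcl : c ≠ e l) (hcl' : c' ≠ e l) : c = c' := by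
  by_contra hne
  rcases (P l).2.mem_dropUntil_or hy hy' with hm | hm
  · have a1 := ((P l).2.dropUntil y hy).externalSteps_takeUntil_add (B := B) hm
    have a2 := (((P l).2.dropUntil y hy).takeUntil y' hm).one_le_externalSteps hB hne hc hc'
    have a3 := (((P l).2.dropUntil y hy).dropUntil y' hm).one_le_externalSteps hB hcl' hc' (h.mem l)
    omega
  · have a1 := ((P l).2.dropUntil y' hy').externalSteps_takeUntil_add (B := B) hm
    have a2 := (((P l).2.dropUntil y' hy').takeUntil y hm).one_le_externalSteps hB
      (Ne.symm hne) hc' hc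
    have a3 := (((P l).2.dropUntil y' hy').dropUntil y hm).one_le_externalSteps hB hcl hc (h.mem l)
    omega

end

/-- If the roots `z i` are linked to distinct branch sets of a large complete minor, then at least
half of them lie in distinct branch sets of a complete minor. -/
theorem exists_rooted_cliqueModel [Fintype ι] [Fintype τ] {S : Finset V}
    (hB : IsCliqueModel G S B)
    (hτ : Fintype.card ι * Fintype.card ι + Fintype.card ι ≤ Fintype.card τ)
    {e : ι → τ} {P : ∀ i, Σ x, G.Walk (z i) x} (hP : IsRootedLinkage B e P) :
    ∃ (J : Finset ι) (Q : J → Finset V), Fintype.card ι ≤ 2 * #J ∧ (∀ l : J, z l ∈ Q l) ∧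
      (∀ l, G.ConnectedOn (Q l)) ∧ (∀ l l', l ≠ l' → Disjoint (Q l) (Q l')) ∧
      ∀ l l', l ≠ l' → ∃ x ∈ Q l, ∃ y ∈ Q l', G.Adj x y := by
  obtain ⟨e, P, h⟩ := hP.exists_minimal
  have key := fun (i : ι) (W : {W : τ // ∀ i, e i ≠ W}) => h.exists_hit hB W.2 i
  choose hit a y L hy hLB hab hLP hcost using key
  have hcardW : Fintype.card ι * Fintype.card ι ≤ Fintype.card {W : τ // ∀ i, e i ≠ W} := by
    have h1 : Fintype.card {W : τ // ∀ i, e i ≠ W} =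
        Fintype.card τ - #(univ.image e) := by
      rw [Fintype.card_subtype, ← card_univ, ← card_sdiff_of_subset (subset_univ _)]
      congr 1; ext W; simp
    rw [card_image_of_injective _ h.injective, card_univ] at h1
    omega
  -- There are at least `n²` unused sets for `n` roots, so one walk `ψ i` is hit from at least `n`
  -- of them. This leaves enough choice for distinct representatives `W l` below.
  have hmaj : ∀ i, ∃ l, Fintype.card ι ≤ #{W | hit i W = l} := by
    intro i
    have : Nonempty ι := ⟨i⟩
    exact Fintype.exists_le_card_fiber_of_mul_le_card (hit i) hcardW
  choose ψ hψ using hmaj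
  -- A walk `l` is `ψ i` for at most two `i`: possibly `l` itself, and at most one other, since the
  -- hit points lie in `B (e i)` on the last stretch of `P l`.
  have hfib : Fintype.card ι ≤ 2 * #(univ.image ψ) := by
    rw [← card_univ]
    refine card_le_mul_card_image _ 2 fun l _ => ?_
    have h1 : #(({i | ψ i = l} : Finset ι).erase l) ≤ 1 := by
      rw [card_le_one]
      intro i hi i' hi'
      simp only [mem_erase, mem_filter, mem_univ, true_and] at hi hi'
      have hW : ∀ i, ψ i = l → ∃ W, hit i W = l := by
        intro i hi
        have : 0 < #{W | hit i W = ψ i} :=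
          lt_of_lt_of_le (Fintype.card_pos_iff.2 ⟨i⟩) (hψ i)
        obtain ⟨W, hW⟩ := card_pos.1 this
        exact ⟨W, by simpa [hi] using hW⟩
      obtain ⟨W, rfl⟩ := hW i hi.2
      obtain ⟨W', hW'⟩ := hW i' hi'.2
      have hy' := hy i' W'
      have hc' := hcost i' W'
      have e1 : ∀ l', hit i' W' = l' → ∃ hy' : y i' W' ∈ (P l').2.support,
          ((P l').2.dropUntil _ hy').externalSteps B ≤ 1 := by
        rintro l' rfl
        exact ⟨hy', hc'⟩
      obtain ⟨hy'', hc''⟩ := e1 _ hW'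
      exact h.injective (h.eq_of_externalSteps_le_one hB.disjoint (hy i W) hy'' (hcost i W) hc''
        (hLB i W _ (by simp)) (hLB i' W' _ (by simp)) (fun h' => hi.1 (h.injective h'))
        (fun h' => hi'.1 (h.injective h')))
    have h2 := pred_card_le_card_erase (s := ({i | ψ i = l} : Finset ι)) (a := l)
    omega
  have hJ : ∀ l : (univ.image ψ : Finset ι), ∃ i, ψ i = l := by
    intro l
    obtain ⟨i, -, hi⟩ := mem_image.1 l.2
    exact ⟨i, hi⟩
  choose i hi using hJ
  have hiinj : ∀ l l', l ≠ l' → i l ≠ i l' := by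
    intro l l' hne heq
    exact hne (Subtype.ext (by rw [← hi l, ← hi l', heq]))
  obtain ⟨W, hWinj, hW⟩ := exists_injective_mem
    (fun l : (univ.image ψ : Finset ι) => ({W | hit (i l) W = l} : Finset _)) (by
      intro l
      rw [← hi l, Fintype.card_coe]
      exact (card_le_univ _).trans (hψ (i l)))
  simp only [mem_filter, mem_univ, true_and] at hW
  have hyP : ∀ l : (univ.image ψ : Finset ι), y (i l) (W l) ∈ (P l).2.support := by
    intro l
    have h1 := hy (i l) (W l)
    have : ∀ l', hit (i l) (W l) = l' → y (i l) (W l) ∈ (P l').2.support := by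
      rintro l' rfl; exact h1
    exact this _ (hW l)
  -- The walk from the root, the connection that hits it, and an unused branch set of its own.
  -- Connections for different `l` run in different sets `B (e (i l))`.
  refine ⟨univ.image ψ, fun l => (P l).2.support.toFinset ∪ (L (i l) (W l)).support.toFinset ∪
    B (W l), hfib, fun l => ?_, fun l => ?_, fun l l' hne => ?_, fun l l' hne => ?_⟩
  · simp
  · obtain ⟨b, hb, hadj⟩ := hab (i l) (W l)
    refine ConnectedOn.union_of_adj (x := a (i l) (W l)) (y := b) ?_ (hB.connectedOn _) ?_ hb hadj
    · exact (connectedOn_support _).union_of_mem (connectedOn_support _)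
        (x := y (i l) (W l)) (by simpa using hyP l) (by simp)
    · simp
  · have hne' : (l : ι) ≠ l' := fun h' => hne (Subtype.ext h')
    have d1 : ∀ l l' : (univ.image ψ : Finset ι), l ≠ l' → ∀ v ∈ (P l).2.support,
        v ∉ (L (i l') (W l')).support := by
      intro l l' hne v hv hv'
      obtain rfl := hLP _ _ v hv' l hv
      exact h.disjoint l l' (fun h' => hne (Subtype.ext h')) _ hv (hyP l')
    have d2 : ∀ l l' : (univ.image ψ : Finset ι), ∀ v ∈ (P l).2.support, v ∉ B (W l') := by
      intro l l' v hv
      exact h.notMem_of_unused hB.disjoint (W l').2 hv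
    have d3 : ∀ l l' : (univ.image ψ : Finset ι), ∀ v ∈ (L (i l) (W l)).support, v ∉ B (W l') := by
      intro l l' v hv
      exact Finset.disjoint_left.1 (hB.disjoint _ _ ((W l').2 (i l))) (hLB _ _ v hv)
    rw [Finset.disjoint_left]
    intro v hv hv'
    simp only [mem_union, List.mem_toFinset] at hv hv'
    rcases hv with (hv | hv) | hv <;> rcases hv' with (hv' | hv') | hv'
    · exact h.disjoint l l' hne' v hv hv'
    · exact d1 l l' hne v hv hv'
    · exact d2 l l' v hv hv'
    · exact d1 l' l hne.symm v hv' hv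
    · exact Finset.disjoint_left.1
        (hB.disjoint _ _ fun h' => hiinj l l' hne (h.injective h')) (hLB _ _ v hv) (hLB _ _ v hv')
    · exact d3 l l' v hv hv'
    · exact d2 l' l v hv' hv
    · exact d3 l' l v hv' hv
    · exact Finset.disjoint_left.1
        (hB.disjoint _ _ fun h' => hne (hWinj (Subtype.ext h'))) hv hv'
  · obtain ⟨x, hx, y, hy, hxy⟩ := hB.adj (W l) (W l')
      (fun h' => hne (hWinj (Subtype.ext h')))
    exact ⟨x, mem_union_right _ hx, y, mem_union_right _ hy, hxy⟩

end RootedModel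
end SimpleGraph

namespace SimpleGraph
-- Topological cliques from polynomial average degree.
section TopologicalClique
open Finset Classical

variable {V : Type*}

/-- `G` contains `k` branch vertices, any two joined by a connected set, these sets meeting in
branch vertices only. -/
def HasTopologicalClique (G : SimpleGraph V) (k : ℕ) : Prop :=
  ∃ (b : Fin k ↪ V) (T : Fin k → Fin k → Finset V),
    (∀ i j, T i j = T j i) ∧
    (∀ i j, i ≠ j → G.ConnectedOn (T i j) ∧ b i ∈ T i j ∧ b j ∈ T i j) ∧
    (∀ i j, i ≠ j → ∀ l, b l ∈ T i j → l = i ∨ l = j) ∧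
    ∀ i j i' j', i ≠ j → i' ≠ j' → s(i, j) ≠ s(i', j') → ∀ x ∈ T i j, x ∈ T i' j' →
      x ∈ Set.range b

/-- Many fans with disjoint connected pairwise adjacent sets at their ends yield a topological
clique. -/
theorem hasTopologicalClique_of_fans {G : SimpleGraph V} {N m k : ℕ} (hm : 0 < m) (v : Fin N ↪ V)
    (z : Fin N × Fin m → V) (hz : ∀ p, G.Adj (v p.1) (z p)) (J : Finset (Fin N × Fin m))
    (Q : J → Finset V) (hJ : N * k + k * m ≤ #J) (hzQ : ∀ p : J, z p ∈ Q p)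
    (hQc : ∀ p, G.ConnectedOn (Q p)) (hQd : ∀ p q, p ≠ q → Disjoint (Q p) (Q q))
    (hQa : ∀ p q, p ≠ q → ∃ x ∈ Q p, ∃ y ∈ Q q, G.Adj x y) (hQv : ∀ p i, v i ∉ Q p) :
    G.HasTopologicalClique k := by
  let Ji : Fin N → Finset (Fin m) := fun i => {j | (i, j) ∈ J}
  let good : Finset (Fin N) := {i | k ≤ #(Ji i)}
  -- A fan that is not good keeps fewer than `k` of its ends, and a good one at most `m`; hence at
  -- least `k` fans are good.
  have hcount : #J ≤ N * k + #good * m := by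
    have h1 : #J = ∑ i, #(Ji i) := by
      rw [card_eq_sum_card_fiberwise (f := Prod.fst) (t := univ) (by simp)]
      refine sum_congr rfl fun i _ => ?_
      refine card_bij' (fun p _ => p.2) (fun j _ => (i, j)) ?_ ?_ ?_ ?_
      · rintro ⟨a, b⟩ h
        simp only [mem_filter] at h
        obtain ⟨h, rfl⟩ := h
        simpa [Ji] using h
      · intro j hj; simpa [Ji] using hj
      · rintro ⟨a, b⟩ h
        simp only [mem_filter] at h
        obtain ⟨h, rfl⟩ := h; rfl
      · intros; rfl
    have h2 : ∀ i ∈ (univ : Finset (Fin N)), #(Ji i) ≤ k + if i ∈ good then m else 0 := by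
      intro i _
      split_ifs with hi
      · exact ((card_le_univ _).trans (by simp)).trans (Nat.le_add_left m k)
      · simp only [good, mem_filter, mem_univ, true_and, not_le] at hi
        omega
    rw [h1]
    refine (sum_le_sum h2).trans ?_
    rw [sum_add_distrib, sum_ite_mem]
    simp
  have hgood : k ≤ #good := by
    have : k * m ≤ #good * m := by omega
    exact Nat.le_of_mul_le_mul_right this hm
  obtain ⟨g⟩ : Nonempty (Fin k ↪ good) := by
    apply Function.Embedding.nonempty_of_card_le; simpa using hgood
  have hq : ∀ i : Fin k, Nonempty (Fin k ↪ Ji (g i)) := by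
    intro i
    apply Function.Embedding.nonempty_of_card_le
    have := (mem_filter.1 (g i).2).2
    simpa using this
  let q := fun i => (hq i).some
  -- The end of the `i`-th fan reserved for the connection to the `j`-th branch vertex.
  let p : Fin k → Fin k → J := fun i j => ⟨((g i : Fin N), (q i j : Fin m)),
    (mem_filter.1 (q i j).2).2⟩
  have hp : ∀ i j i' j', p i j = p i' j' → i = i' ∧ j = j' := by
    intro i j i' j' h
    have h1 := congrArg Subtype.val h
    simp only [p, Prod.mk.injEq] at h1
    obtain rfl : i = i' := g.injective (Subtype.ext h1.1)
    exact ⟨rfl, (q i).injective (Subtype.ext h1.2)⟩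
  let b : Fin k ↪ V := ⟨fun i => v (g i), fun i j h => g.injective (Subtype.ext (v.injective h))⟩
  refine ⟨b, fun i j => ({b i} ∪ Q (p i j)) ∪ ({b j} ∪ Q (p j i)), ?_, ?_, ?_, ?_⟩
  · intro i j; exact union_comm _ _
  · intro i j hij
    refine ⟨?_, by simp, by simp⟩
    have hc : ∀ i j, G.ConnectedOn ({b i} ∪ Q (p i j)) := fun i j =>
      (connectedOn_singleton (b i)).union_of_adj (hQc (p i j)) (mem_singleton_self _)
        (hzQ (p i j)) (hz (p i j))
    obtain ⟨x, hx, y, hy, hxy⟩ := hQa (p i j) (p j i) (fun h => hij (hp _ _ _ _ h).1)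
    exact (hc i j).union_of_adj (hc j i) (mem_union_right _ hx) (mem_union_right _ hy) hxy
  · intro i j hij l hl
    simp only [mem_union, mem_singleton] at hl
    rcases hl with (h | h) | (h | h)
    · exact .inl (b.injective h)
    · exact absurd h (hQv _ _)
    · exact .inr (b.injective h)
    · exact absurd h (hQv _ _)
  · intro i j i' j' hij hij' hne x hx hx'
    by_contra hxb
    have hxb' : ∀ l, x ≠ b l := fun l h => hxb ⟨l, h.symm⟩
    simp only [mem_union, mem_singleton, hxb', false_or] at hx hx'
    have heq : ∀ r r', x ∈ Q r → x ∈ Q r' → r = r' := by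
      intro r r' hr hr'
      by_contra h
      exact Finset.disjoint_left.1 (hQd r r' h) hr hr'
    rcases hx with hx | hx <;> rcases hx' with hx' | hx' <;>
      obtain ⟨rfl, rfl⟩ := hp _ _ _ _ (heq _ _ hx hx')
    · exact hne rfl
    · exact hne Sym2.eq_swap
    · exact hne Sym2.eq_swap
    · exact hne rfl

/-- A graph of average degree at least `2 ^ 43 * k ^ 12` contains a topological `K_k`. -/
theorem hasTopologicalClique_of_adjCount [Finite V] (G : SimpleGraph V) (S₀ : Finset V) (k γ : ℕ)
    (hk : 1 ≤ k) (hγ : 2 ^ 42 * k ^ 12 ≤ γ) (hS₀ : S₀.Nonempty)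
    (h : 2 * γ * #S₀ ≤ G.adjCount S₀ S₀) : G.HasTopologicalClique k := by
  have hk2 : k ≤ k ^ 12 := Nat.le_self_pow (by norm_num) k
  have hk4 : k ^ 2 ≤ k ^ 12 := Nat.pow_le_pow_right hk (by norm_num)
  have hkk : k ≤ k ^ 2 := Nat.le_self_pow (by norm_num) k
  have hk24 : k ^ 2 ≤ k ^ 4 := Nat.pow_le_pow_right hk (by norm_num)
  -- For `n = 64k²` fan ends the rooted minor needs `n² + n ≤ 4160k⁴` branch sets.
  set t : ℕ := 4160 * k ^ 4 with ht
  have ht3 : 16 * t ^ 3 = 1151860736000 * k ^ 12 := by rw [ht]; ring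
  -- Connectivity for `64k²` disjoint paths after the removal of the `8k` candidate branch vertices.
  set c : ℕ := 64 * k ^ 2 + 8 * k with hc
  obtain ⟨S, hSc, hdeg, hadj, hsep⟩ := exists_highly_connected_set G S₀ γ c (by omega) (by omega)
    hS₀ h
  obtain ⟨F, hFS, hF⟩ := exists_subset_card_eq (s := S) (n := 8 * k) (by omega)
  obtain ⟨v'⟩ : Nonempty (Fin (8 * k) ≃ F) := ⟨(Fintype.equivFinOfCardEq (by simpa using hF)).symm⟩
  let v : Fin (8 * k) ↪ V := v'.toEmbedding.trans (Function.Embedding.subtype _)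
  have hvF : ∀ i, v i ∈ F := fun i => (v' i).2
  set R : Finset V := S \ F with hR
  -- a complete minor outside `F`
  have hRcount : 2 * (16 * t ^ 3) * #R ≤ (G.restrict R).adjCount R R := by
    have e1 : (G.restrict R).adjCount R R = G.adjCount R R := by
      rw [adjCount_eq_card, adjCount_eq_card]
      congr 1; ext ⟨a, b⟩
      rw [mem_filter, mem_filter, mem_product]
      exact ⟨fun h => ⟨h.1, h.2.1⟩, fun h => ⟨h.1, h.2, h.1⟩⟩
    have hd : Disjoint R F := sdiff_disjoint
    have hRF : R ∪ F = S := sdiff_union_of_subset hFS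
    have e2 := adjCount_union_self (G := G) hd
    rw [hRF] at e2
    have e3 : G.adjCount R F ≤ #S * (8 * k) := by
      refine adjCount_le_card_mul.trans ?_
      rw [hF]
      exact Nat.mul_le_mul_right _ (card_le_card sdiff_subset)
    have e4 : G.adjCount F F ≤ #S * (8 * k) := by
      refine adjCount_le_card_mul.trans ?_
      rw [hF]
      exact Nat.mul_le_mul_right _ (hF ▸ card_le_card hFS)
    have e5 : #R ≤ #S := card_le_card sdiff_subset
    have e6 : γ * (2 * c) ≤ γ * #S := Nat.mul_le_mul_left _ hSc.le
    have e7 : 2 * γ * c = γ * (2 * c) := by ring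
    have e8 : 2 * (16 * t ^ 3) * #R ≤ 2 * (16 * t ^ 3) * #S := Nat.mul_le_mul_left _ e5
    -- The set `S` has more than `γ #S` adjacent pairs, and removing `F` loses at most `24k #S`. The
    -- constant `2 ^ 42` is chosen for this inequality.
    have e9 : (2 * (16 * t ^ 3) + 24 * k) * #S ≤ γ * #S := Nat.mul_le_mul_right _ (by omega)
    have e10 : (2 * (16 * t ^ 3) + 24 * k) * #S =
      2 * (16 * t ^ 3) * #S + 3 * (#S * (8 * k)) := by ring
    have e11 : 2 * γ * #S = γ * #S + γ * #S := by ring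
    omega
  have hRne : R.Nonempty := by
    rw [← card_pos, hR, card_sdiff_of_subset hFS]
    omega
  obtain ⟨B, hB⟩ := exists_isCliqueModel (G.restrict R) R (16 * t ^ 3) t (by omega) le_rfl hRne
    hRcount
  -- the fans
  obtain ⟨z, hzinj, hz⟩ := exists_injective_mem
    (fun p : Fin (8 * k) × Fin (8 * k) => {u ∈ R | G.Adj (v p.1) u}) (by
      intro p
      have h1 := hdeg (v p.1) (hFS (hvF _))
      have h2 : G.degIn (v p.1) S ≤ #{u ∈ R | G.Adj (v p.1) u} + 8 * k := by
        refine (card_le_card (t := {u ∈ R | G.Adj (v p.1) u} ∪ F) fun u hu => ?_).trans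
          ((card_union_le _ _).trans (Nat.add_le_add_left hF.le _))
        simp only [hR, mem_filter, mem_union, mem_sdiff] at hu ⊢
        tauto
      have h3 : 8 * k * (8 * k) = 64 * k ^ 2 := by ring
      simp only [Fintype.card_prod, Fintype.card_fin]
      omega)
  simp only [mem_filter] at hz
  have hcard : Fintype.card (Fin (8 * k) × Fin (8 * k)) = 64 * k ^ 2 := by
    simp only [Fintype.card_prod, Fintype.card_fin]; ring
  -- representatives of the branch sets
  have hrep : ∀ c, ∃ x, x ∈ B c := fun c => (hB.connectedOn c).1
  choose r hr using hrep
  have hrinj : ∀ c c', r c = r c' → c = c' := by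
    intro c c' h'
    by_contra hne
    exact Finset.disjoint_left.1 (hB.disjoint c c' hne) (hr c) (h' ▸ hr c')
  have hpaths : (G.restrict R).HasDisjointPaths (univ.image z) (univ.image r) (64 * k ^ 2) := by
    refine hasDisjointPaths_of_no_separation hsep ?_ ?_ ?_ ?_ (by omega)
    · intro x hx
      obtain ⟨p, -, rfl⟩ := mem_image.1 hx
      exact (hz p).1
    · intro x hx
      obtain ⟨p, -, rfl⟩ := mem_image.1 hx
      exact hB.subset _ (hr p)
    · rw [card_image_of_injective _ hzinj, card_univ, hcard]
    · rw [card_image_of_injective _ hrinj, card_univ, Fintype.card_fin]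
      omega
  obtain ⟨a, w, hw, hwd⟩ := hpaths.symm.exists_of_card_eq
    (by rw [card_image_of_injective _ hzinj, card_univ, hcard])
  have hzm : ∀ p, z p ∈ univ.image z := fun p => mem_image_of_mem _ (mem_univ p)
  have he : ∀ p, ∃ c, r c = a (z p) := by
    intro p
    obtain ⟨c, -, hc⟩ := mem_image.1 (hw (z p) (hzm p)).2
    exact ⟨c, hc⟩
  choose e he using he
  have hlink : IsRootedLinkage B e (fun p => (⟨a (z p), (w (z p)).reverse⟩ :
      Σ x, (G.restrict R).Walk (z p) x)) := by
    refine ⟨fun p q hpq => ?_, fun p => ?_, fun p q hpq => ?_⟩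
    · by_contra hne
      have := hwd (z p) (hzm p) (z q) (hzm q) (fun h => hne (hzinj h)) (a (z p)) (by simp)
      rw [← he p, hpq, he q] at this
      simp at this
    · simp only
      rw [← he p]; exact hr _
    · simpa using hwd (z p) (hzm p) (z q) (hzm q) (fun h => hpq (hzinj h))
  obtain ⟨J, Q, hJ, hQz, hQc, hQd, hQa⟩ := exists_rooted_cliqueModel hB (by
    rw [hcard, Fintype.card_fin]
    have : 64 * k ^ 2 * (64 * k ^ 2) = 4096 * k ^ 4 := by ring
    omega) hlink
  have hQR : ∀ l, Q l ⊆ R := by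
    intro l x hx
    obtain ⟨w, -⟩ := (hQc l).2 _ (hQz l) x hx
    exact mem_of_mem_support_restrict w (hz _).1 (by simp)
  refine hasTopologicalClique_of_fans (by omega) v z (fun p => (hz p).2) J Q ?_ hQz
    (fun p => (hQc p).mono (restrict_le R)) hQd (fun p q hpq => ?_) (fun p i hi => ?_)
  · rw [hcard] at hJ
    have : 8 * k * k = 8 * k ^ 2 := by ring
    have : k * (8 * k) = 8 * k ^ 2 := by ring
    omega
  · obtain ⟨x, hx, y, hy, hxy⟩ := hQa p q hpq
    exact ⟨x, hx, y, hy, hxy.1⟩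
  · exact (mem_sdiff.1 (hQR p hi)).2 (hvF i)

end TopologicalClique
end SimpleGraph

namespace SimpleGraph
-- From induced 1-subdivisions to induced subdivisions of cliques.
section InducedSubdivision
open Finset Classical

variable {V : Type*}

/-- `A` and `B` are disjoint independent sets, every vertex of `B` has exactly two neighbours in
`A`, and distinct vertices of `B` have distinct neighbourhoods in `A`: then `A ∪ B` induces the
`1`-subdivision of a graph on `A`. -/
structure IsOneSubdivision (G : SimpleGraph V) (A B : Finset V) : Prop where
  disjoint : Disjoint A B
  left : ∀ x ∈ A, ∀ y ∈ A, ¬ G.Adj x y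
  right : ∀ x ∈ B, ∀ y ∈ B, ¬ G.Adj x y
  card : ∀ b ∈ B, #{a ∈ A | G.Adj b a} = 2
  inj : ∀ b ∈ B, ∀ b' ∈ B, {a ∈ A | G.Adj b a} = {a ∈ A | G.Adj b' a} → b = b'

/-- The graph on `A` whose edges are subdivided by the vertices of `B`. -/
def subdivided (G : SimpleGraph V) (A B : Finset V) : SimpleGraph V where
  Adj x y := x ≠ y ∧ x ∈ A ∧ y ∈ A ∧ ∃ b ∈ B, G.Adj b x ∧ G.Adj b y
  symm := ⟨fun _ _ ⟨h, hx, hy, b, hb, h1, h2⟩ => ⟨h.symm, hy, hx, b, hb, h2, h1⟩⟩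
  loopless := ⟨fun _ h => h.1 rfl⟩

variable {G : SimpleGraph V} {A B : Finset V}

/-- Each vertex of `B` contributes both orderings of its pair of neighbours, and different vertices
have different pairs. -/
theorem IsOneSubdivision.two_mul_card_le (h : G.IsOneSubdivision A B) :
    2 * #B ≤ (G.subdivided A B).adjCount A A := by
  rw [adjCount_eq_card]
  have h1 : #(B.biUnion fun b => ({a ∈ A | G.Adj b a}).offDiag) = 2 * #B := by
    rw [card_biUnion]
    · rw [sum_congr rfl (g := fun _ => 2)]
      · simp [mul_comm]
      · intro b hb
        rw [offDiag_card, h.card b hb]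
    · intro b hb b' hb' hne
      refine Finset.disjoint_left.2 ?_
      rintro ⟨x, y⟩ hx hy
      rw [mem_offDiag] at hx hy
      have aux : ∀ b ∈ B, x ∈ ({a ∈ A | G.Adj b a} : Finset V) → y ∈ ({a ∈ A | G.Adj b a} : Finset V) →
          {x, y} = ({a ∈ A | G.Adj b a} : Finset V) := by
        intro b hb h1 h2
        apply eq_of_subset_of_card_le
        · intro z hz
          rcases mem_insert.1 hz with rfl | hz
          · exact h1
          · rw [mem_singleton.1 hz]; exact h2
        · rw [h.card b hb, card_pair hx.2.2]
      exact hne (h.inj b hb b' hb' ((aux b hb hx.1 hx.2.1).symm.trans (aux b' hb' hy.1 hy.2.1)))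
  rw [← h1]
  refine card_le_card ?_
  rintro ⟨x, y⟩ hxy
  rw [mem_biUnion] at hxy
  obtain ⟨b, hb, hxy⟩ := hxy
  rw [mem_offDiag, mem_filter, mem_filter] at hxy
  rw [mem_filter, mem_product]
  exact ⟨⟨hxy.1.1, hxy.2.1.1⟩, hxy.2.2, hxy.1.1, hxy.2.1.1, b, hb, hxy.1.2, hxy.2.1.2⟩

theorem IsOneSubdivision.mem_pair (h : G.IsOneSubdivision A B) {b x y z : V} (hb : b ∈ B)
    (hx : x ∈ A) (hy : y ∈ A) (hxy : x ≠ y) (hbx : G.Adj b x) (hby : G.Adj b y) (hz : z ∈ A)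
    (hbz : G.Adj b z) : z = x ∨ z = y := by
  have : {x, y} = ({a ∈ A | G.Adj b a} : Finset V) := by
    apply eq_of_subset_of_card_le
    · intro z hz
      rcases mem_insert.1 hz with rfl | hz
      · exact mem_filter.2 ⟨hx, hbx⟩
      · rw [mem_singleton.1 hz]; exact mem_filter.2 ⟨hy, hby⟩
    · rw [h.card b hb, card_pair hxy]
  have hz' : z ∈ ({a ∈ A | G.Adj b a} : Finset V) := mem_filter.2 ⟨hz, hbz⟩
  rw [← this] at hz'
  simpa using hz'

/-- A walk in the subdivided graph lifts to the subdivision. -/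
theorem IsOneSubdivision.lift_walk (h : G.IsOneSubdivision A B) {T : Finset V} {x y : V}
    (w : (G.subdivided A B).Walk x y) (hw : ∀ v ∈ w.support, v ∈ T) :
    ∃ w' : G.Walk x y, ∀ v ∈ w'.support, v ∈ T ∨ (v ∈ B ∧ ∀ a ∈ A, G.Adj v a → a ∈ T) := by
  induction w with
  | nil => exact ⟨.nil, fun v hv => .inl (hw v hv)⟩
  | @cons x u y hxu p ih =>
    obtain ⟨w', hw'⟩ := ih (fun v hv => hw v (by simp [hv]))
    have hxT : x ∈ T := hw x (by simp)
    have huT : u ∈ T := hw u (by simp)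
    obtain ⟨hne, hxA, huA, b, hb, hbx, hbu⟩ := hxu
    refine ⟨.cons hbx.symm (.cons hbu w'), ?_⟩
    intro v hv
    simp only [Walk.support_cons, List.mem_cons] at hv
    rcases hv with rfl | rfl | hv
    · exact .inl hxT
    · refine .inr ⟨hb, fun a ha hva => ?_⟩
      rcases h.mem_pair hb hxA huA hne hbx hbu ha hva with rfl | rfl <;> assumption
    · exact hw' v hv

theorem Walk.map_val_support_induce {R : Set V} {u v : V} (p : G.Walk u v)
    (hp : ∀ x ∈ p.support, x ∈ R) : (p.induce R hp).support.map Subtype.val = p.support := by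
  rw [support_induce, List.attachWith_map_subtype_val]

theorem Walk.mem_support_induce {R : Set V} {u v : V} (p : G.Walk u v)
    (hp : ∀ x ∈ p.support, x ∈ R) (x : R) : x ∈ (p.induce R hp).support ↔ (x : V) ∈ p.support := by
  rw [support_induce, List.mem_attachWith]

theorem Walk.IsPath.induce {R : Set V} {u v : V} {p : G.Walk u v} (h : p.IsPath)
    (hp : ∀ x ∈ p.support, x ∈ R) : (p.induce R hp).IsPath := by
  rw [Walk.isPath_def] at h ⊢
  rw [← p.map_val_support_induce hp] at h
  exact h.of_map _

theorem Walk.induce_eq_reverse {R : Set V} {u v : V} {p : G.Walk u v} {q : G.Walk v u}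
    (h : q = p.reverse) (hp : ∀ x ∈ p.support, x ∈ R) (hq : ∀ x ∈ q.support, x ∈ R) :
    q.induce R hq = (p.induce R hp).reverse := by
  apply Walk.ext_support
  apply List.map_injective_iff.2 Subtype.val_injective
  rw [map_val_support_induce, support_reverse, List.map_reverse, map_val_support_induce, h,
    support_reverse]

/-- An inner vertex of a path lies on two edges of the path. -/
theorem Walk.IsPath.exists_two_edges {u v y : V} {p : G.Walk u v} (hp : p.IsPath)
    (hy : y ∈ p.support) (hu : y ≠ u) (hv : y ≠ v) :
    ∃ a c, a ≠ c ∧ s(a, y) ∈ p.edges ∧ s(y, c) ∈ p.edges := by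
  obtain ⟨q, r, rfl⟩ : ∃ (q : G.Walk u y) (r : G.Walk y v), p = q.append r :=
    ⟨p.takeUntil y hy, p.dropUntil y hy, (p.take_spec hy).symm⟩
  have hnodup := hp.support_nodup
  rw [Walk.support_append] at hnodup
  cases r with
  | nil => exact absurd rfl hv
  | @cons _ c _ hc r =>
    obtain ⟨q', hq'⟩ : ∃ q', q.reverse = q' := ⟨_, rfl⟩
    have hq : q = q'.reverse := by rw [← hq', Walk.reverse_reverse]
    cases q' with
    | nil => exact absurd rfl hu
    | @cons _ a _ ha q' =>
      refine ⟨a, c, ?_, ?_, ?_⟩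
      · rintro rfl
        rw [List.nodup_append] at hnodup
        refine hnodup.2.2 a ?_ a ?_ rfl
        · rw [hq]; simp
        · simp
      · rw [hq]; simp [Sym2.eq_swap]
      · simp

/-- A topological clique in the subdivided graph gives an induced subdivision of a clique. -/
theorem IsOneSubdivision.containsInducedSubdivision (h : G.IsOneSubdivision A B) {k : ℕ}
    (hk : 2 ≤ k) (hT : (G.subdivided A B).HasTopologicalClique k) :
    G.ContainsInducedSubdivision (⊤ : SimpleGraph (Fin k)) := by
  obtain ⟨b, T, hsymm, hconn, hbT, hdisj⟩ := hT
  have hAdjA : ∀ {x y}, (G.subdivided A B).Adj x y → x ∈ A := fun h => h.2.1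
  -- A connecting set has two distinct branch vertices, so each of its vertices lies on an edge of
  -- the subdivided graph, and edges live on `A`.
  have hTA : ∀ i j, i ≠ j → ∀ x ∈ T i j, x ∈ A := by
    intro i j hij x hx
    obtain ⟨hc, hi, hj⟩ := hconn i j hij
    have aux : ∀ y ∈ T i j, x ≠ y → x ∈ A := by
      intro y hy hxy
      obtain ⟨w, -⟩ := hc.2 x hx y hy
      cases w with
      | nil => exact absurd rfl hxy
      | cons h' _ => exact hAdjA h'
    by_cases hxi : x = b i
    · exact aux (b j) hj (fun h' => hij (b.injective (hxi.symm.trans h')))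
    · exact aux (b i) hi hxi
  have hother : ∀ i : Fin k, ∃ j : Fin k, i ≠ j := by
    intro i
    have : Nontrivial (Fin k) := Fin.nontrivial_iff_two_le.2 hk
    obtain ⟨j, hj⟩ := exists_ne i
    exact ⟨j, hj.symm⟩
  have hbA : ∀ i, b i ∈ A := by
    intro i
    obtain ⟨j, hj⟩ := hother i
    exact hTA i j hj _ (hconn i j hj).2.1
  let T' : Fin k → Fin k → V → Prop := fun i j v =>
    v ∈ T i j ∨ (v ∈ B ∧ ∀ a ∈ A, G.Adj v a → a ∈ T i j)
  have hw : ∀ i j, ∃ w : G.Walk (b i) (b j), i ≠ j → w.IsPath ∧ ∀ v ∈ w.support, T' i j v := by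
    intro i j
    by_cases hij : i = j
    · subst hij; exact ⟨.nil, fun h => absurd rfl h⟩
    · obtain ⟨hc, hi, hj⟩ := hconn i j hij
      obtain ⟨w, hw⟩ := hc.2 _ hi _ hj
      obtain ⟨w', hw'⟩ := h.lift_walk w hw
      exact ⟨w'.bypass, fun _ => ⟨w'.bypass_isPath, fun v hv =>
        hw' v (w'.support_bypass_subset_support hv)⟩⟩
  choose w hw using hw
  -- Only the paths with `i < j` are chosen; the others are their reverses, as the definition of a
  -- subdivision demands.
  let q : ∀ i j, G.Walk (b i) (b j) := fun i j => if i < j then w i j else (w j i).reverse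
  have hqrev : ∀ i j, i ≠ j → q j i = (q i j).reverse := by
    intro i j hij
    rcases lt_or_gt_of_ne hij with hlt | hlt
    · simp [q, hlt, hlt.not_gt]
    · simp [q, hlt, hlt.not_gt]
  have hq : ∀ i j, i ≠ j → (q i j).IsPath ∧ ∀ v ∈ (q i j).support, T' i j v := by
    intro i j hij
    by_cases hlt : i < j
    · simp only [q, hlt, if_true]; exact hw i j hij
    · simp only [q, hlt, if_false]
      refine ⟨(hw j i hij.symm).1.reverse, fun v hv => ?_⟩
      rw [Walk.support_reverse, List.mem_reverse] at hv
      have := (hw j i hij.symm).2 v hv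
      simp only [T'] at this ⊢
      rwa [hsymm i j]
  let R : Set V := {v | v ∈ Set.range b ∨ ∃ i j, i ≠ j ∧ v ∈ (q i j).support}
  have hqR : ∀ i j, i ≠ j → ∀ v ∈ (q i j).support, v ∈ R := fun i j hij v hv => .inr ⟨i, j, hij, hv⟩
  let b' : Fin k ↪ R := ⟨fun i => ⟨b i, .inl ⟨i, rfl⟩⟩, fun i j hij =>
    b.injective (congrArg Subtype.val hij)⟩
  let p : ∀ i j, (⊤ : SimpleGraph (Fin k)).Adj i j → (G.induce R).Walk (b' i) (b' j) :=
    fun i j hij => (q i j).induce R (hqR i j hij.ne)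
  have hpsupp : ∀ i j (hij : (⊤ : SimpleGraph (Fin k)).Adj i j) x,
      x ∈ (p i j hij).support ↔ (x : V) ∈ (q i j).support :=
    fun i j hij x => Walk.mem_support_induce _ _ x
  have hpath : ∀ i j (hij : (⊤ : SimpleGraph (Fin k)).Adj i j), (p i j hij).IsPath :=
    fun i j hij => (hq i j hij.ne).1.induce _
  refine ⟨R, b', p, ?_, ?_, ?_, ?_, ?_, ?_⟩
  · exact hpath
  · intro i j hij
    exact Walk.induce_eq_reverse (hqrev i j hij.ne) _ _
  · intro i j hij l hl
    rw [hpsupp i j hij] at hl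
    rcases (hq i j hij.ne).2 _ hl with h1 | h1
    · exact hbT i j hij.ne l h1
    · exact absurd h1.1 (Finset.disjoint_left.1 h.disjoint (hbA l))
  · intro i j hij i' j' hij' hne x hx hx'
    rw [hpsupp i j hij] at hx
    rw [hpsupp i' j' hij'] at hx'
    suffices hs : (x : V) ∈ Set.range b by
      obtain ⟨l, hl⟩ := hs
      exact ⟨l, Subtype.ext hl⟩
    have hij := hij.ne
    have hij' := hij'.ne
    rcases (hq i j hij).2 _ hx with h1 | h1 <;> rcases (hq i' j' hij').2 _ hx' with h2 | h2
    · exact hdisj i j i' j' hij hij' hne x h1 h2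
    · exact absurd h2.1 (Finset.disjoint_left.1 h.disjoint (hTA i j hij _ h1))
    · exact absurd h1.1 (Finset.disjoint_left.1 h.disjoint (hTA i' j' hij' _ h2))
    -- A subdividing vertex on both paths would have its two neighbours in both connecting sets.
    -- They would be two branch vertices, which determine the pair of indices.
    · exfalso
      obtain ⟨a, c, hac, hset⟩ := card_eq_two.1 (h.card x h1.1)
      have ha : a ∈ ({a ∈ A | G.Adj x a} : Finset V) := by rw [hset]; simp
      have hc : c ∈ ({a ∈ A | G.Adj x a} : Finset V) := by rw [hset]; simp
      rw [mem_filter] at ha hc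
      have ha1 := h1.2 a ha.1 ha.2
      have ha2 := h2.2 a ha.1 ha.2
      have hc1 := h1.2 c hc.1 hc.2
      have hc2 := h2.2 c hc.1 hc.2
      obtain ⟨l, rfl⟩ := hdisj i j i' j' hij hij' hne a ha1 ha2
      obtain ⟨m, rfl⟩ := hdisj i j i' j' hij hij' hne c hc1 hc2
      have hlm : l ≠ m := fun h' => hac (by rw [h'])
      have e1 := hbT i j hij l ha1
      have e2 := hbT i j hij m hc1
      have e3 := hbT i' j' hij' l ha2
      have e4 := hbT i' j' hij' m hc2
      have f1 : s(i, j) = s(l, m) := by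
        rw [Sym2.eq_iff]
        rcases e1 with e1 | e1 <;> rcases e2 with e2 | e2
        · exact absurd (e1.trans e2.symm) hlm
        · exact .inl ⟨e1.symm, e2.symm⟩
        · exact .inr ⟨e2.symm, e1.symm⟩
        · exact absurd (e1.trans e2.symm) hlm
      have f2 : s(i', j') = s(l, m) := by
        rw [Sym2.eq_iff]
        rcases e3 with e1 | e1 <;> rcases e4 with e2 | e2
        · exact absurd (e1.trans e2.symm) hlm
        · exact .inl ⟨e1.symm, e2.symm⟩
        · exact .inr ⟨e2.symm, e1.symm⟩
        · exact absurd (e1.trans e2.symm) hlm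
      exact hne (f1.trans f2.symm)
  · rintro ⟨x, hx⟩
    rcases hx with ⟨i, hi⟩ | ⟨i, j, hij, hx⟩
    · exact .inl ⟨i, Subtype.ext hi⟩
    · exact .inr ⟨i, j, hij, (hpsupp i j hij _).2 hx⟩
  · have hRAB : ∀ x ∈ R, x ∈ A ∨ (x ∈ B ∧ ∃ i j, i ≠ j ∧ x ∈ (q i j).support) := by
      rintro x (⟨i, rfl⟩ | ⟨i, j, hij, hx⟩)
      · exact .inl (hbA i)
      · rcases (hq i j hij).2 x hx with h1 | h1
        · exact .inl (hTA i j hij x h1)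
        · exact .inr ⟨h1.1, i, j, hij, hx⟩
    -- This is where inducedness holds: `y` is an inner vertex of its path, its two path neighbours
    -- lie in `A` because `B` is independent, and it has no third neighbour in `A`.
    have key : ∀ x y : R, (x : V) ∈ A → (y : V) ∈ B → G.Adj x y →
        ∃ u v, ∃ huv : (⊤ : SimpleGraph (Fin k)).Adj u v, s(x, y) ∈ (p u v huv).edges := by
      intro x y hxA hyB hxy
      have hyA : (y : V) ∉ A := Finset.disjoint_right.1 h.disjoint hyB
      obtain ⟨-, i, j, hij, hy⟩ := (hRAB y y.2).resolve_left hyA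
      refine ⟨i, j, hij, ?_⟩
      have hy' : y ∈ (p i j hij).support := (hpsupp i j hij _).2 hy
      have hne : ∀ l, y ≠ b' l := by
        rintro l rfl
        exact hyA (hbA l)
      obtain ⟨a, c, hac, h1, h2⟩ := (hpath i j hij).exists_two_edges hy' (hne i) (hne j)
      have adj1 : G.Adj y a := ((p i j hij).adj_of_mem_edges h1).symm
      have adj2 : G.Adj y c := (p i j hij).adj_of_mem_edges h2
      have mA : ∀ z : R, G.Adj y z → (z : V) ∈ A := by
        intro z hz
        rcases hRAB z z.2 with hzA | hzB
        · exact hzA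
        · exact absurd hz (h.right _ hyB _ hzB.1)
      rcases h.mem_pair hyB (mA a adj1) (mA c adj2) (fun h' => hac (Subtype.ext h')) adj1 adj2
        hxA hxy.symm with hx | hx
      · obtain rfl : x = a := Subtype.ext hx
        exact h1
      · obtain rfl : x = c := Subtype.ext hx
        rw [Sym2.eq_swap]; exact h2
    intro e
    induction e using Sym2.ind with
    | _ x y =>
    intro hxy
    have hxy : G.Adj x y := hxy
    rcases hRAB x x.2 with hx | hx <;> rcases hRAB y y.2 with hy | hy
    · exact absurd hxy (h.left _ hx _ hy)
    · exact key x y hx hy.1 hxy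
    · rw [Sym2.eq_swap]; exact key y x hy hx.1 hxy.symm
    · exact absurd hxy (h.right _ hx.1 _ hy.1)

/-- A sufficiently dense induced `1`-subdivision contains an induced subdivision of a clique. -/
theorem IsOneSubdivision.containsInducedSubdivision_of_card [Finite V]
    (h : G.IsOneSubdivision A B) {k : ℕ} (hk : 2 ≤ k) (hA : A.Nonempty)
    (hcard : 2 ^ 42 * k ^ 12 * #A ≤ #B) :
    G.ContainsInducedSubdivision (⊤ : SimpleGraph (Fin k)) := by
  refine h.containsInducedSubdivision hk
    (hasTopologicalClique_of_adjCount _ A k _ (by omega) le_rfl hA ?_)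
  have := h.two_mul_card_le
  rw [mul_assoc]
  omega

end InducedSubdivision
end SimpleGraph

namespace SimpleGraph
-- The Kővári–Sós–Turán bound.
section CompleteBipartiteFree
open Finset Classical

variable {V : Type*} {G : SimpleGraph V} {s : ℕ}

theorem Free.card_lt_of_adj (h : (completeBipartiteGraph (Fin s) (Fin s)).Free G) {X T : Finset V}
    (hT : #T = s) (hX : ∀ x ∈ X, ∀ y ∈ T, G.Adj x y) : #X < s := by
  by_contra hcon
  push Not at hcon
  obtain ⟨X', hX', hc⟩ := exists_subset_card_eq hcon
  let e := X'.equivFinOfCardEq hc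
  let f := T.equivFinOfCardEq hT
  have hadj : ∀ i j, G.Adj (e.symm i) (f.symm j) := fun i j =>
    hX _ (hX' (e.symm i).2) _ (f.symm j).2
  refine h ⟨⟨⟨Sum.elim (fun i => (e.symm i : V)) (fun j => (f.symm j : V)), ?_⟩, ?_⟩⟩
  · rintro (i | i) (j | j) hij
    · simp at hij
    · exact hadj i j
    · exact (hadj j i).symm
    · simp at hij
  · rintro (i | i) (j | j) hij
    · exact congrArg _ (e.symm.injective (Subtype.ext hij))
    · exact absurd hij (hadj i j).ne
    · exact absurd hij.symm (hadj j i).ne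
    · exact congrArg _ (f.symm.injective (Subtype.ext hij))

/-- Double counting: an `s`-subset of `Y` is contained in the neighbourhoods of fewer than `s`
vertices. -/
theorem Free.sum_choose_degIn_le (h : (completeBipartiteGraph (Fin s) (Fin s)).Free G)
    (X Y : Finset V) : ∑ x ∈ X, (G.degIn x Y).choose s ≤ s * (#Y).choose s := by
  have h1 : ∑ x ∈ X, (G.degIn x Y).choose s =
      ∑ x ∈ X, ∑ T ∈ Y.powersetCard s, if ∀ y ∈ T, G.Adj x y then 1 else 0 := by
    refine sum_congr rfl fun x _ => ?_
    rw [degIn, ← card_powersetCard, ← card_filter]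
    congr 1
    ext T
    simp only [mem_powersetCard, mem_filter, subset_iff]
    exact ⟨fun h => ⟨⟨fun y hy => (h.1 hy).1, h.2⟩, fun y hy => (h.1 hy).2⟩,
      fun h => ⟨fun y hy => ⟨h.1.1 hy, h.2 y hy⟩, h.1.2⟩⟩
  rw [h1, sum_comm, mul_comm, ← card_powersetCard, ← smul_eq_mul]
  refine sum_le_card_nsmul _ _ _ fun T hT => ?_
  rw [← card_filter]
  exact (h.card_lt_of_adj (mem_powersetCard.1 hT).2 fun x hx => (mem_filter.1 hx).2).le

/-- A graph without `K_{s,s}` has small density between sets that are not too small. -/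
theorem Free.mul_adjCount_le (h : (completeBipartiteGraph (Fin s) (Fin s)).Free G)
    {X Y : Finset V} {x y η : ℝ} (hη : 1 ≤ η) (hX : #X ≤ x) (hY : #Y ≤ y) (hs : 0 < s)
    (hy : 4 * η * s ≤ y) (hx : 2 * η * (s * (4 * η) ^ s) ≤ x) : η * G.adjCount X Y ≤ x * y := by
  have hs' : (1 : ℝ) ≤ s := by exact_mod_cast hs
  have hypos : 0 < y := lt_of_lt_of_le (by positivity) hy
  have hx0 : 0 ≤ x := (Nat.cast_nonneg _).trans hX
  -- Vertices of degree at least `y / (2η)` are so few that even full degree `y` costs only `xy /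
  -- (2η)` in total; the remaining vertices cost no more than that either.
  set X' := {v ∈ X | y ≤ 2 * η * G.degIn v Y} with hX'
  have key : (#X' : ℝ) ≤ s * (4 * η) ^ s := by
    have h1 := h.sum_choose_degIn_le X' Y
    have h2 : ∀ v ∈ X', (y / (4 * η)) ^ s ≤ (s.factorial : ℝ) * (G.degIn v Y).choose s := by
      intro v hv
      have hv' := (mem_filter.1 hv).2
      have hle : s ≤ G.degIn v Y := by
        have : (s : ℝ) ≤ G.degIn v Y := by nlinarith
        exact_mod_cast this
      have h3 : ((G.degIn v Y + 1 - s : ℕ) : ℝ) ^ s ≤ (s.factorial : ℝ) * (G.degIn v Y).choose s := by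
        have := Nat.pow_sub_le_descFactorial (G.degIn v Y) s
        rw [Nat.descFactorial_eq_factorial_mul_choose] at this
        exact_mod_cast this
      refine le_trans (pow_le_pow_left₀ (by positivity) ?_ s) h3
      rw [Nat.cast_sub (by omega), div_le_iff₀ (by positivity)]
      push_cast
      nlinarith
    have h4 : (s.factorial : ℝ) * (#Y).choose s ≤ y ^ s := by
      have := Nat.descFactorial_le_pow (#Y) s
      rw [Nat.descFactorial_eq_factorial_mul_choose] at this
      calc (s.factorial : ℝ) * (#Y).choose s ≤ (#Y : ℝ) ^ s := by exact_mod_cast this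
        _ ≤ y ^ s := by gcongr
    have h5 : (#X' : ℝ) * (y / (4 * η)) ^ s ≤ s * y ^ s := by
      calc (#X' : ℝ) * (y / (4 * η)) ^ s ≤ ∑ v ∈ X', (s.factorial : ℝ) * (G.degIn v Y).choose s := by
            rw [← nsmul_eq_mul]; exact card_nsmul_le_sum _ _ _ h2
        _ = s.factorial * ((∑ v ∈ X', (G.degIn v Y).choose s : ℕ) : ℝ) := by
            rw [← mul_sum]; push_cast; rfl
        _ ≤ s.factorial * ((s * (#Y).choose s : ℕ) : ℝ) := by gcongr
        _ = s * (s.factorial * (#Y).choose s) := by push_cast; ring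
        _ ≤ s * y ^ s := by gcongr
    rw [div_pow, mul_div_assoc', div_le_iff₀ (by positivity)] at h5
    refine le_of_mul_le_mul_right ?_ (pow_pos hypos s)
    linarith
  have h6 : 2 * η * (G.adjCount X Y : ℝ) ≤ ∑ v ∈ X, (y + if v ∈ X' then 2 * η * y else 0) := by
    rw [adjCount, Nat.cast_sum, mul_sum]
    refine sum_le_sum fun v hv => ?_
    by_cases hv' : v ∈ X'
    · rw [if_pos hv']
      have : (G.degIn v Y : ℝ) ≤ y := le_trans (by exact_mod_cast degIn_le_card) hY
      nlinarith
    · rw [if_neg hv', add_zero]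
      rw [hX', mem_filter, not_and, not_le] at hv'
      exact (hv' hv).le
  rw [sum_add_distrib, sum_const, ← sum_filter, sum_const, nsmul_eq_mul, nsmul_eq_mul,
    filter_mem_eq_inter, inter_eq_right.2 (filter_subset _ _)] at h6
  have h7 : (#X : ℝ) * y ≤ x * y := by gcongr
  have h8 : (#X' : ℝ) * (2 * η * y) ≤ x * y := by
    have : (#X' : ℝ) * (2 * η) ≤ x := by nlinarith
    nlinarith
  linarith

end CompleteBipartiteFree

/-! ### Cherries, blocking sets and conflicts in a random sample. -/

section Sampling
open Finset Classical

variable {V : Type*} {G : SimpleGraph V}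

/-- A union bound: from `p ^ #P` one subtracts at most `p ^ (#P + 1)` for each element of `Z`. -/
theorem le_randomSubsetExp_of_disjoint {p : ℝ} {A P Z : Finset V} (hp : 0 ≤ p) (hp1 : p ≤ 1)
    (hP : P ⊆ A) (hZ : Disjoint P Z) (hZp : p * #Z ≤ 1 / 2) :
    p ^ #P / 2 ≤ randomSubsetExp p A (fun R => if P ⊆ R ∧ Disjoint Z R then 1 else 0) := by
  have h1 : randomSubsetExp p A (fun R => (if P ⊆ R then 1 else 0) -
      ∑ z ∈ Z ∩ A, if insert z P ⊆ R then 1 else 0) ≤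
      randomSubsetExp p A (fun R => if P ⊆ R ∧ Disjoint Z R then 1 else 0) := by
    refine randomSubsetExp_mono hp hp1 fun R hR => ?_
    by_cases hPR : P ⊆ R
    · by_cases hd : Disjoint Z R
      · rw [if_pos hPR, if_pos ⟨hPR, hd⟩]
        have : (0 : ℝ) ≤ ∑ z ∈ Z ∩ A, if insert z P ⊆ R then 1 else 0 :=
          sum_nonneg fun _ _ => by positivity
        linarith
      · rw [if_pos hPR, if_neg (fun h => hd h.2)]
        obtain ⟨z, hz, hzR⟩ := not_disjoint_iff.1 hd
        have := single_le_sum (f := fun z => if insert z P ⊆ R then (1 : ℝ) else 0)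
          (fun _ _ => by positivity) (mem_inter.2 ⟨hz, hR hzR⟩)
        rw [if_pos (insert_subset hzR hPR)] at this
        linarith
    · rw [if_neg hPR, if_neg (fun h => hPR h.1)]
      have : (0 : ℝ) ≤ ∑ z ∈ Z ∩ A, if insert z P ⊆ R then 1 else 0 :=
        sum_nonneg fun _ _ => by positivity
      linarith
  refine le_trans ?_ h1
  rw [randomSubsetExp_sub, randomSubsetExp_subset hP, randomSubsetExp_sum,
    sum_congr rfl (g := fun _ => p ^ (#P + 1)), sum_const, nsmul_eq_mul]
  · have h2 : (#(Z ∩ A) : ℝ) ≤ #Z := by exact_mod_cast card_le_card inter_subset_left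
    have h3 : (#(Z ∩ A) : ℝ) * p ^ (#P + 1) ≤ p ^ #P * (1 / 2) := by
      calc (#(Z ∩ A) : ℝ) * p ^ (#P + 1) ≤ #Z * p ^ (#P + 1) := by gcongr
        _ = p ^ #P * (p * #Z) := by ring
        _ ≤ p ^ #P * (1 / 2) := by gcongr
    linarith
  · intro z hz
    rw [mem_inter] at hz
    rw [randomSubsetExp_subset (insert_subset hz.2 hP),
      card_insert_of_notMem (fun h => Finset.disjoint_left.1 hZ h hz.1)]

/-- The pairs of neighbours of `b` in `A` that are not adjacent. -/
noncomputable def cherries (G : SimpleGraph V) (A B : Finset V) : Finset (V × Finset V) :=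
  {c ∈ B ×ˢ A.powersetCard 2 | (∀ a ∈ c.2, G.Adj c.1 a) ∧ ∀ x ∈ c.2, ∀ y ∈ c.2, ¬ G.Adj x y}

theorem mem_cherries {A B : Finset V} {c : V × Finset V} : c ∈ G.cherries A B ↔
    c.1 ∈ B ∧ c.2 ⊆ A ∧ #c.2 = 2 ∧ (∀ a ∈ c.2, G.Adj c.1 a) ∧
      ∀ x ∈ c.2, ∀ y ∈ c.2, ¬ G.Adj x y := by
  simp only [cherries, mem_filter, mem_product, mem_powersetCard]
  tauto

/-- The set a random set has to avoid for the cherry `c` to be isolated from the rest. -/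
noncomputable def blocking (G : SimpleGraph V) (A : Finset V) (out : V → Finset V)
    (c : V × Finset V) : Finset V :=
  ({a ∈ A | G.Adj c.1 a} \ c.2) ∪ insert c.1 (c.2.biUnion out)

theorem card_blocking_le {A : Finset V} {out : V → Finset V} {c : V × Finset V} {d θ : ℝ}
    (hc : #c.2 = 2) (hd : G.degIn c.1 A ≤ d) (hout : ∀ v, #(out v) ≤ θ) :
    (#(G.blocking A out c) : ℝ) ≤ d + (1 + 2 * θ) := by
  have h1 : #(G.blocking A out c) ≤ G.degIn c.1 A + (∑ a ∈ c.2, #(out a) + 1) := by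
    refine (card_union_le _ _).trans (add_le_add ?_ ?_)
    · exact card_le_card sdiff_subset
    · exact (card_insert_le _ _).trans (by gcongr; exact card_biUnion_le)
  have h2 : ∑ a ∈ c.2, (#(out a) : ℝ) ≤ 2 * θ := by
    have := sum_le_card_nsmul c.2 (fun a => (#(out a) : ℝ)) θ fun a _ => hout a
    rw [hc] at this
    simpa using this
  have h3 : (#(G.blocking A out c) : ℝ) ≤ G.degIn c.1 A + (∑ a ∈ c.2, (#(out a) : ℝ) + 1) := by
    exact_mod_cast h1
  linarith

theorem disjoint_blocking {A B : Finset V} {out : V → Finset V} {c : V × Finset V}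
    (hc : c ∈ G.cherries A B) (hout : ∀ x, ∀ y ∈ out x, G.Adj x y) :
    Disjoint c.2 (G.blocking A out c) := by
  rw [mem_cherries] at hc
  refine Finset.disjoint_left.2 fun a ha hb => ?_
  simp only [blocking, mem_union, mem_sdiff, mem_insert, mem_biUnion] at hb
  rcases hb with hb | rfl | ⟨x, hx, hb⟩
  · exact hb.2 ha
  · exact (hc.2.2.2.1 _ ha).ne rfl
  · exact hc.2.2.2.2 x hx a ha (hout x a hb)

/-- The cherries in `𝒞` whose pair lies in `R` and which are isolated from the rest of `R`. -/
noncomputable def isolatedIn (G : SimpleGraph V) (A : Finset V) (out : V → Finset V)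
    (𝒞 : Finset (V × Finset V)) (R : Finset V) : Finset (V × Finset V) :=
  {c ∈ 𝒞 | c.2 ⊆ R ∧ Disjoint (G.blocking A out c) R}

/-- Cherries are in conflict if their centres are adjacent or they have the same pair. -/
def conflict (G : SimpleGraph V) : SimpleGraph (V × Finset V) where
  Adj c c' := c ≠ c' ∧ (G.Adj c.1 c'.1 ∨ c.2 = c'.2)
  symm := ⟨fun _ _ h => ⟨h.1.symm, h.2.imp (fun h => h.symm) (fun h => h.symm)⟩⟩
  loopless := ⟨fun _ h => h.1 rfl⟩

variable {A B R : Finset V} {out : V → Finset V} {𝒞 : Finset (V × Finset V)}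

theorem eq_of_mem_isolatedIn (h𝒞 : 𝒞 ⊆ G.cherries A B) (hR : R ⊆ A) {c : V × Finset V}
    (hc : c ∈ G.isolatedIn A out 𝒞 R) {a : V} (ha : a ∈ R) : G.Adj c.1 a ↔ a ∈ c.2 := by
  obtain ⟨hc1, hc2, hc3⟩ := mem_filter.1 hc
  have hc4 := mem_cherries.1 (h𝒞 hc1)
  refine ⟨fun h => ?_, fun h => hc4.2.2.2.1 a h⟩
  by_contra hcon
  refine Finset.disjoint_left.1 hc3 ?_ ha
  simp only [blocking, mem_union, mem_sdiff, mem_filter]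
  exact .inl ⟨⟨hR ha, h⟩, hcon⟩

/-- The pair of a surviving cherry is the set of all neighbours of its centre in `R`, so the centre
determines it. -/
theorem injOn_fst_isolatedIn (h𝒞 : 𝒞 ⊆ G.cherries A B) (hR : R ⊆ A) :
    Set.InjOn Prod.fst (G.isolatedIn A out 𝒞 R : Set (V × Finset V)) := by
  have aux : ∀ c ∈ G.isolatedIn A out 𝒞 R, ∀ c' ∈ G.isolatedIn A out 𝒞 R, c.1 = c'.1 →
      c.2 ⊆ c'.2 := by
    intro c hc c' hc' h a ha
    have haR : a ∈ R := (mem_filter.1 hc).2.1 ha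
    exact (eq_of_mem_isolatedIn h𝒞 hR hc' haR).1
      (h ▸ (eq_of_mem_isolatedIn h𝒞 hR hc haR).2 ha)
  intro c hc c' hc' h
  exact Prod.ext h ((aux c hc c' hc' h).antisymm (aux c' hc' c hc h.symm))

/-- Every sample gives an induced `1`-subdivision. -/
theorem exists_isOneSubdivision_of_subset (h𝒞 : 𝒞 ⊆ G.cherries A B) (hR : R ⊆ A)
    (hout' : ∀ x y, G.Adj x y → y ∈ out x ∨ x ∈ out y) {ρ : ℝ} (h0 : 0 ≤ ρ) (h1 : ρ ≤ 1) :
    ∃ A' B' : Finset V, G.IsOneSubdivision A' B' ∧ A' ⊆ R ∧ (B'.Nonempty → A'.Nonempty) ∧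
      ρ * #(G.isolatedIn A out 𝒞 R) -
        ρ ^ 2 * G.conflict.adjCount (G.isolatedIn A out 𝒞 R) (G.isolatedIn A out 𝒞 R) ≤ #B' := by
  obtain ⟨I, hI, hind, hcard⟩ := exists_independent_subset G.conflict
    (G.isolatedIn A out 𝒞 R) h0 h1
  -- Sampled vertices without sampled out-neighbours are independent, since every edge is oriented.
  -- Pairs of surviving cherries remain, because their out-neighbours are blocked.
  set A' := {a ∈ R | Disjoint (out a) R} with hA'
  have hsub : ∀ c ∈ I, c.2 ⊆ A' := by
    intro c hc a ha
    obtain ⟨-, hc2, hc3⟩ := mem_filter.1 (hI hc)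
    refine mem_filter.2 ⟨hc2 ha, disjoint_of_subset_left ?_ hc3⟩
    exact (subset_biUnion_of_mem out ha).trans ((subset_insert _ _).trans subset_union_right)
  have hnbr : ∀ c ∈ I, ({a ∈ A' | G.Adj c.1 a} : Finset V) = c.2 := by
    intro c hc
    ext a
    rw [mem_filter]
    refine ⟨fun h => (eq_of_mem_isolatedIn h𝒞 hR (hI hc) (mem_filter.1 h.1).1).1 h.2, fun h => ?_⟩
    have := hsub c hc h
    exact ⟨this, (eq_of_mem_isolatedIn h𝒞 hR (hI hc) (mem_filter.1 this).1).2 h⟩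
  have hinj : Set.InjOn Prod.fst (I : Set (V × Finset V)) :=
    (injOn_fst_isolatedIn h𝒞 hR).mono (by exact_mod_cast hI)
  refine ⟨A', I.image Prod.fst, ⟨?_, ?_, ?_, ?_, ?_⟩, filter_subset _ _, ?_, ?_⟩
  · refine Finset.disjoint_left.2 fun x hx hx' => ?_
    obtain ⟨c, hc, rfl⟩ := mem_image.1 hx'
    refine Finset.disjoint_left.1 (mem_filter.1 (hI hc)).2.2 ?_ (mem_filter.1 hx).1
    simp [blocking]
  · intro x hx y hy hxy
    rw [hA', mem_filter] at hx hy
    rcases hout' x y hxy with h | h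
    · exact Finset.disjoint_left.1 hx.2 h hy.1
    · exact Finset.disjoint_left.1 hy.2 h hx.1
  · intro x hx y hy hxy
    obtain ⟨c, hc, rfl⟩ := mem_image.1 hx
    obtain ⟨c', hc', rfl⟩ := mem_image.1 hy
    exact hind c hc c' hc' ⟨fun h => hxy.ne (by rw [h]), .inl hxy⟩
  · intro b hb
    obtain ⟨c, hc, rfl⟩ := mem_image.1 hb
    rw [hnbr c hc]
    exact (mem_cherries.1 (h𝒞 (mem_filter.1 (hI hc)).1)).2.2.1
  · intro b hb b' hb' h
    obtain ⟨c, hc, rfl⟩ := mem_image.1 hb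
    obtain ⟨c', hc', rfl⟩ := mem_image.1 hb'
    rw [hnbr c hc, hnbr c' hc'] at h
    by_contra hne
    exact hind c hc c' hc' ⟨fun h => hne (by rw [h]), .inr h⟩
  · rintro ⟨b, hb⟩
    obtain ⟨c, hc, rfl⟩ := mem_image.1 hb
    have h2 := (mem_cherries.1 (h𝒞 (mem_filter.1 (hI hc)).1)).2.2.1
    exact (card_pos.1 (by omega : 0 < #c.2)).mono (hsub c hc)
  · rwa [card_image_of_injOn hinj]

theorem le_randomSubsetExp_card_isolatedIn {p : ℝ} (hp : 0 ≤ p) (hp1 : p ≤ 1)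
    (h𝒞 : 𝒞 ⊆ G.cherries A B) (hout : ∀ x, ∀ y ∈ out x, G.Adj x y)
    (hZ : ∀ c ∈ 𝒞, p * #(G.blocking A out c) ≤ 1 / 2) :
    #𝒞 * (p ^ 2 / 2) ≤ randomSubsetExp p A (fun R => (#(G.isolatedIn A out 𝒞 R) : ℝ)) := by
  simp only [isolatedIn, card_filter, Nat.cast_sum, Nat.cast_ite, Nat.cast_one, Nat.cast_zero]
  rw [randomSubsetExp_sum, ← nsmul_eq_mul]
  refine card_nsmul_le_sum _ _ _ fun c hc => ?_
  have hc' := mem_cherries.1 (h𝒞 hc)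
  have := le_randomSubsetExp_of_disjoint hp hp1 hc'.2.1 (disjoint_blocking (h𝒞 hc) hout) (hZ c hc)
  rwa [hc'.2.2.1] at this

/-- For an upper bound the blocking condition is dropped: if both cherries survive, `R` contains the
union of their pairs. -/
theorem randomSubsetExp_conflict_le {p : ℝ} (hp : 0 ≤ p) (hp1 : p ≤ 1)
    (h𝒞 : 𝒞 ⊆ G.cherries A B) :
    randomSubsetExp p A (fun R => (G.conflict.adjCount (G.isolatedIn A out 𝒞 R)
      (G.isolatedIn A out 𝒞 R) : ℝ)) ≤
      ∑ c ∈ 𝒞, ∑ c' ∈ 𝒞 with G.conflict.Adj c c', p ^ #(c.2 ∪ c'.2) := by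
  have h1 : ∀ c ∈ 𝒞, ∀ c' ∈ 𝒞, randomSubsetExp p A
      (fun R => if c.2 ∪ c'.2 ⊆ R then 1 else 0) = p ^ #(c.2 ∪ c'.2) := fun c hc c' hc' =>
    randomSubsetExp_subset (union_subset (mem_cherries.1 (h𝒞 hc)).2.1
      (mem_cherries.1 (h𝒞 hc')).2.1)
  rw [sum_congr rfl fun c hc => sum_congr rfl fun c' hc' => (h1 c hc c' (mem_filter.1 hc').1).symm]
  simp only [← randomSubsetExp_sum]
  refine randomSubsetExp_mono hp hp1 fun R _ => ?_
  rw [adjCount]; push_cast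
  have hsub : G.isolatedIn A out 𝒞 R ⊆ 𝒞 := filter_subset _ _
  refine (sum_le_sum fun c hc => ?_).trans (sum_le_sum_of_subset_of_nonneg hsub fun _ _ _ =>
    sum_nonneg fun _ _ => by positivity)
  rw [← sum_filter, sum_const, nsmul_eq_mul, mul_one, degIn]
  norm_cast
  refine card_le_card fun c' hc' => ?_
  rw [mem_filter] at hc'
  simp only [mem_filter]
  exact ⟨⟨hsub hc'.1, hc'.2⟩, union_subset (mem_filter.1 hc).2.1 (mem_filter.1 hc'.1).2.1⟩

end Sampling
end SimpleGraph

namespace SimpleGraph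
-- Dense 1-subdivisions from many second neighbours.
section Unbalanced
open Finset Classical

variable {V : Type*} {G : SimpleGraph V}

/-- A graph in which all subgraphs are sparse has an orientation with small out-degrees. -/
theorem exists_orientation [Finite V] {θ : ℝ} (h0 : 0 ≤ θ)
    (hθ : ∀ X : Finset V, G.adjCount X X ≤ θ * #X) :
    ∃ out : V → Finset V, (∀ x, ∀ y ∈ out x, G.Adj x y) ∧ (∀ v, #(out v) ≤ θ) ∧
      ∀ x y, G.Adj x y → y ∈ out x ∨ x ∈ out y := by
  have main : ∀ n : ℕ, ∀ X : Finset V, #X = n → ∃ out : V → Finset V,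
      (∀ x, ∀ y ∈ out x, G.Adj x y) ∧ (∀ v, #(out v) ≤ θ) ∧
      ∀ x ∈ X, ∀ y ∈ X, G.Adj x y → y ∈ out x ∨ x ∈ out y := by
    intro n
    induction n with
    | zero =>
      intro X hX
      rw [card_eq_zero] at hX
      subst hX
      exact ⟨fun _ => ∅, by simp, fun _ => by simpa using h0, by simp⟩
    | succ n ih =>
      intro X hX
      -- Degeneracy: a vertex of at most average degree sends out all its edges within `X`, and
      -- induction orients the rest.
      obtain ⟨v, hv, hdeg⟩ : ∃ v ∈ X, (G.degIn v X : ℝ) ≤ θ := by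
        refine exists_le_of_sum_le (card_pos.1 (by omega)) ?_
        rw [sum_const, nsmul_eq_mul, mul_comm]
        have := hθ X
        rw [adjCount] at this
        exact_mod_cast this
      obtain ⟨out, h1, h2, h3⟩ := ih (X.erase v) (by rw [card_erase_of_mem hv, hX]; rfl)
      refine ⟨Function.update out v {y ∈ X | G.Adj v y}, ?_, ?_, ?_⟩
      · intro x y hy
        by_cases hx : x = v
        · subst hx
          rw [Function.update_self] at hy
          exact (mem_filter.1 hy).2
        · rw [Function.update_of_ne hx] at hy
          exact h1 x y hy
      · intro x
        by_cases hx : x = v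
        · subst hx
          rw [Function.update_self]
          exact hdeg
        · rw [Function.update_of_ne hx]
          exact h2 x
      · intro x hx y hy hxy
        by_cases hxv : x = v
        · subst hxv
          left
          rw [Function.update_self]
          exact mem_filter.2 ⟨hy, hxy⟩
        · by_cases hyv : y = v
          · subst hyv
            right
            rw [Function.update_self]
            exact mem_filter.2 ⟨hx, hxy.symm⟩
          · rw [Function.update_of_ne hxv, Function.update_of_ne hyv]
            exact h3 x (mem_erase.2 ⟨hxv, hx⟩) y (mem_erase.2 ⟨hyv, hy⟩) hxy
  have := Fintype.ofFinite V
  obtain ⟨out, h1, h2, h3⟩ := main _ univ rfl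
  exact ⟨out, h1, h2, fun x y h => h3 x (mem_univ x) y (mem_univ y) h⟩

theorem card_le_two_mul_card_image_pair {α : Type*} (E : Finset (α × α)) :
    #E ≤ 2 * #(E.image fun e => ({e.1, e.2} : Finset α)) := by
  refine card_le_mul_card_image _ _ fun P hP => ?_
  obtain ⟨e, -, rfl⟩ := mem_image.1 hP
  refine (card_le_card (t := {e, e.swap}) ?_).trans card_le_two
  intro f hf
  have h := (mem_filter.1 hf).2
  have h1 : f.1 ∈ ({e.1, e.2} : Finset α) := h ▸ by simp
  have h2 : f.2 ∈ ({e.1, e.2} : Finset α) := h ▸ by simp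
  have h3 : e.1 ∈ ({f.1, f.2} : Finset α) := h ▸ by simp
  have h4 : e.2 ∈ ({f.1, f.2} : Finset α) := h ▸ by simp
  obtain ⟨a, b⟩ := e
  obtain ⟨x, y⟩ := f
  simp only [mem_insert, mem_singleton, Prod.mk.injEq, Prod.swap_prod_mk] at *
  grind

variable {A B : Finset V} {𝒞 : Finset (V × Finset V)} {out : V → Finset V} {θ : ℝ}

/-- With all pairs distinct, conflicts come from adjacent centres only; as the centres are distinct,
the conflict graph on `I` is a subgraph of `G`. -/
theorem conflict_adjCount_le {I : Finset (V × Finset V)}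
    (hθ : ∀ X : Finset V, G.adjCount X X ≤ θ * #X)
    (h1 : Set.InjOn Prod.fst (I : Set (V × Finset V)))
    (h2 : Set.InjOn Prod.snd (I : Set (V × Finset V))) :
    (G.conflict.adjCount I I : ℝ) ≤ θ * #I := by
  rw [← card_image_of_injOn h1]
  refine le_trans ?_ (hθ _)
  norm_cast
  rw [adjCount, adjCount, sum_image h1]
  refine sum_le_sum fun c hc => ?_
  rw [degIn, degIn]
  refine card_le_card_of_injOn Prod.fst ?_ (h1.mono ?_)
  · intro c' hc'
    have hc' := mem_filter.1 hc'
    refine mem_filter.2 ⟨mem_image_of_mem _ hc'.1, ?_⟩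
    exact hc'.2.2.resolve_right fun h => hc'.2.1 (h2 hc hc'.1 h)
  · intro c' hc'
    exact (mem_filter.1 hc').1

/-- If many pairs of vertices of `A` have common neighbours in `B`, a dense induced
`1`-subdivision exists. -/
theorem exists_isOneSubdivision_of_secondNeighbors [Finite V] {K : ℝ} (hK : 1 ≤ K) (h1 : 1 ≤ θ)
    (hθ : ∀ X : Finset V, G.adjCount X X ≤ θ * #X) (hA : A.Nonempty)
    (hB : ∀ b ∈ B, (G.degIn b A : ℝ) ≤ θ)
    (hN : ∀ a ∈ A, 200 * K * θ ^ 2 ≤ #{a' ∈ A | ∃ b ∈ B, G.Adj b a ∧ G.Adj b a'}) :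
    ∃ A' B' : Finset V, G.IsOneSubdivision A' B' ∧ A'.Nonempty ∧ K * #A' ≤ #B' := by
  obtain ⟨out, ho1, ho2, ho3⟩ := exists_orientation (by linarith) hθ
  set N2 : V → Finset V := fun a => {a' ∈ A | ∃ b ∈ B, G.Adj b a ∧ G.Adj b a'} with hN2
  set E : Finset (V × V) :=
    {e ∈ A ×ˢ A | e.1 ≠ e.2 ∧ ¬ G.Adj e.1 e.2 ∧ ∃ b ∈ B, G.Adj b e.1 ∧ G.Adj b e.2} with hE
  set 𝒬 := E.image fun e => ({e.1, e.2} : Finset V) with h𝒬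
  have hrep : ∀ P : Finset V, ∃ b, P ∈ 𝒬 → (b, P) ∈ G.cherries A B := by
    intro P
    by_cases hP : P ∈ 𝒬
    · obtain ⟨⟨x, y⟩, he, rfl⟩ := mem_image.1 hP
      obtain ⟨hmem, hne, hadj, b, hb, hbx, hby⟩ := mem_filter.1 he
      rw [mem_product] at hmem
      refine ⟨b, fun _ => mem_cherries.2 ⟨hb, ?_, card_pair hne, ?_, ?_⟩⟩
      · exact insert_subset hmem.1 (singleton_subset_iff.2 hmem.2)
      · simp [hbx, hby]
      · have hadj' : ¬ G.Adj y x := fun h => hadj h.symm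
        simpa using ⟨hadj, hadj'⟩
    · obtain ⟨a, -⟩ := hA
      exact ⟨a, fun h => absurd h hP⟩
  choose r hr using hrep
  -- One cherry for each pair, so that no two have the same pair.
  set 𝒞 := 𝒬.image fun P => (r P, P) with h𝒞def
  have h𝒞 : 𝒞 ⊆ G.cherries A B := by
    intro c hc
    obtain ⟨P, hP, rfl⟩ := mem_image.1 hc
    exact hr P hP
  have hcard𝒞 : #𝒞 = #𝒬 := card_image_of_injective _ fun P P' h => (Prod.mk.inj h).2
  have hsnd : Set.InjOn Prod.snd (𝒞 : Set (V × Finset V)) := by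
    intro c hc c' hc' h
    obtain ⟨P, hP, rfl⟩ := mem_image.1 hc
    obtain ⟨P', hP', rfl⟩ := mem_image.1 hc'
    obtain rfl : P = P' := h
    rfl
  have hEcard : (#A : ℝ) * (200 * K * θ ^ 2 - 1 - θ) ≤ #E := by
    have e1 : ∑ a ∈ A, #(N2 a) ≤ #E + #A + G.adjCount A A := by
      have e2 : #E = ∑ a ∈ A, #{a' ∈ A | a ≠ a' ∧ ¬ G.Adj a a' ∧ ∃ b ∈ B, G.Adj b a ∧ G.Adj b a'} := by
        rw [hE, card_filter, sum_product]
        exact sum_congr rfl fun a _ => (card_filter _ _).symm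
      rw [e2, adjCount, card_eq_sum_ones A, ← sum_add_distrib, ← sum_add_distrib]
      refine sum_le_sum fun a ha => ?_
      rw [degIn, ← card_singleton a]
      refine (card_le_card ?_).trans
        ((card_union_le _ _).trans (add_le_add_left (card_union_le _ _) _))
      intro a' ha'
      rw [hN2, mem_filter] at ha'
      simp only [mem_union, mem_filter, mem_singleton]
      by_cases h1 : a = a'
      · exact .inl (.inr h1.symm)
      · by_cases h2 : G.Adj a a'
        · exact .inr ⟨ha'.1, h2⟩
        · exact .inl (.inl ⟨ha'.1, h1, h2, ha'.2⟩)
    have e3 : (∑ a ∈ A, (#(N2 a) : ℝ)) ≤ #E + #A + G.adjCount A A := by exact_mod_cast e1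
    have e4 := card_nsmul_le_sum A (fun a => (#(N2 a) : ℝ)) _ hN
    rw [nsmul_eq_mul] at e4
    have e5 := hθ A
    linarith
  have hE𝒞 : (#E : ℝ) ≤ 2 * #𝒞 := by
    rw [hcard𝒞]
    exact_mod_cast card_le_two_mul_card_image_pair E
  have hApos : (0 : ℝ) < #A := by exact_mod_cast hA.card_pos
  have h𝒞card : (#A : ℝ) * (98 * K * θ ^ 2) < #𝒞 := by
    have : 1 + θ < 4 * (K * θ ^ 2) := by nlinarith
    have : (#A : ℝ) * (196 * K * θ ^ 2) < #A * (200 * K * θ ^ 2 - 1 - θ) := by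
      gcongr; linarith
    linarith
  -- Blocking sets have at most `θ + 1 + 2θ ≤ 6θ` elements, so a cherry is blocked with probability
  -- at most 1/2.
  set p : ℝ := 1 / (12 * θ) with hp
  have hp0 : 0 < p := by positivity
  have hp1 : p ≤ 1 := by
    rw [hp, div_le_one (by positivity)]; linarith
  have hZ : ∀ c ∈ 𝒞, p * #(G.blocking A out c) ≤ 1 / 2 := by
    intro c hc
    have hc' := mem_cherries.1 (h𝒞 hc)
    have := card_blocking_le hc'.2.2.1 (hB c.1 hc'.1) ho2
    calc p * #(G.blocking A out c) ≤ p * (6 * θ) := by gcongr; linarith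
      _ = 1 / 2 := by rw [hp]; field_simp; norm_num
  have hg := le_randomSubsetExp_card_isolatedIn hp0.le hp1 h𝒞 ho1 hZ
  -- The factor `1 / (4θ)` is `ρ - ρ²θ` for `ρ = 1 / (2θ)`, the share of survivors that can be made
  -- conflict-free.
  obtain ⟨R, hR, hRF⟩ := exists_le_of_randomSubsetExp (A := A)
    (F := fun R => (1 / (4 * θ)) * (#(G.isolatedIn A out 𝒞 R) : ℝ) - K * #R) hp0.le hp1
  rw [randomSubsetExp_sub, randomSubsetExp_const_mul, randomSubsetExp_const_mul,
    randomSubsetExp_card] at hRF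
  have hpos : 0 < (1 / (4 * θ)) * (#(G.isolatedIn A out 𝒞 R) : ℝ) - K * #R := by
    refine lt_of_lt_of_le ?_ hRF
    have q1 : (1 / (4 * θ)) * ((#A : ℝ) * (98 * K * θ ^ 2) * (p ^ 2 / 2)) ≤
        (1 / (4 * θ)) * (#𝒞 * (p ^ 2 / 2)) := by gcongr
    have q2 : (1 / (4 * θ)) * ((#A : ℝ) * (98 * K * θ ^ 2) * (p ^ 2 / 2)) =
        98 / 96 * (K * (p * #A)) := by
      rw [hp]; field_simp; norm_num
    have q3 : (1 / (4 * θ)) * (#𝒞 * (p ^ 2 / 2)) ≤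
        (1 / (4 * θ)) * randomSubsetExp p A (fun R => (#(G.isolatedIn A out 𝒞 R) : ℝ)) := by gcongr
    have q4 : 0 < K * (p * #A) := by positivity
    linarith
  have hρ0 : (0 : ℝ) ≤ 1 / (2 * θ) := by positivity
  have hρ1 : 1 / (2 * θ) ≤ 1 := by
    rw [div_le_one (by positivity)]; linarith
  obtain ⟨A', B', hsub, hA'R, hne, hB'⟩ :=
    exists_isOneSubdivision_of_subset h𝒞 hR ho3 hρ0 hρ1
  have hconf := conflict_adjCount_le hθ (injOn_fst_isolatedIn (out := out) h𝒞 hR)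
    (hsnd.mono (by exact_mod_cast filter_subset _ _))
  have hB'' : 1 / (4 * θ) * (#(G.isolatedIn A out 𝒞 R) : ℝ) ≤ #B' := by
    refine le_trans ?_ hB'
    have : (1 / (2 * θ)) ^ 2 * (G.conflict.adjCount (G.isolatedIn A out 𝒞 R)
      (G.isolatedIn A out 𝒞 R) : ℝ) ≤ (1 / (2 * θ)) ^ 2 * (θ * #(G.isolatedIn A out 𝒞 R)) := by
      gcongr
    refine le_trans (le_of_eq ?_) (sub_le_sub_left this _)
    field_simp
    ring
  have hAR : (#A' : ℝ) ≤ #R := by exact_mod_cast card_le_card hA'R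
  have hKA : K * #A' ≤ K * #R := by gcongr
  have hKA0 : 0 ≤ K * (#A' : ℝ) := by positivity
  refine ⟨A', B', hsub, hne (card_pos.1 ?_), by linarith⟩
  have : (0 : ℝ) < #B' := by linarith
  exact_mod_cast this

end Unbalanced
end SimpleGraph

namespace SimpleGraph
-- The unbalanced case: vertices of huge degree matter.
section Unbalanced
open Finset Classical

variable {V : Type*} {G : SimpleGraph V} {s : ℕ} {θ : ℝ}

/-- If all vertices of `B` have at least `s` neighbours in `L`, and `B` is much larger than `L`,
then passing to a suitable subset of `L` every vertex has many second neighbours. -/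
theorem exists_secondNeighbors (h : (completeBipartiteGraph (Fin s) (Fin s)).Free G) (hs : 0 < s)
    {L B : Finset V} {y : ℝ} (hdeg : ∀ b ∈ B, s ≤ G.degIn b L) (hcard : s * y ^ s * #L < #B) :
    ∃ A ⊆ L, A.Nonempty ∧ ∃ B' ⊆ B,
      ∀ a ∈ A, y ≤ #{a' ∈ A | ∃ b ∈ B', G.Adj b a ∧ G.Adj b a'} := by
  set W : Finset V → Finset V := fun X => {b ∈ B | ∀ a ∈ L, G.Adj b a → a ∈ X} with hW
  have hWL : W L = B := filter_true_of_mem fun b _ a ha _ => ha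
  -- In a smallest `X` with `W X` still large, a vertex with fewer than `y` second neighbours could
  -- be erased: the vertices of `W X` adjacent to it have at least `s` neighbours among those few,
  -- so by K_{s,s}-freeness there are at most `s y ^ s` of them.
  obtain ⟨X, hX, hmin⟩ := exists_min_image
    {X ∈ L.powerset | s * y ^ s * #X < #(W X)} card ⟨L, by simp [hWL, hcard]⟩
  rw [mem_filter, mem_powerset] at hX
  have hsub : ∀ b ∈ W X, s ≤ #{a ∈ X | G.Adj b a} := by
    intro b hb
    rw [hW, mem_filter] at hb
    refine (hdeg b hb.1).trans (card_le_card fun a ha => ?_)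
    rw [mem_filter] at ha ⊢
    exact ⟨hb.2 a ha.1 ha.2, ha.2⟩
  refine ⟨X, hX.1, ?_, W X, filter_subset _ _, ?_⟩
  · by_contra hne
    rw [not_nonempty_iff_eq_empty] at hne
    subst hne
    have : W ∅ = ∅ := by
      rw [eq_empty_iff_forall_notMem]
      intro b hb
      have := hsub b hb
      simp at this
      omega
    rw [this] at hX
    simp at hX
  · intro a ha
    by_contra hcon
    push Not at hcon
    have h1 : ¬ (s * y ^ s * #(X.erase a) < #(W (X.erase a))) := by
      intro hlt
      have := hmin (X.erase a) (mem_filter.2 ⟨mem_powerset.2 ((erase_subset _ _).trans hX.1), hlt⟩)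
      rw [card_erase_of_mem ha] at this
      have := card_pos.2 ⟨a, ha⟩
      omega
    set F := {b ∈ W X | G.Adj b a} with hF
    have h2 : #(W X) ≤ #(W (X.erase a)) + #F := by
      refine (card_le_card fun b hb => ?_).trans (card_union_le _ _)
      rw [mem_union]
      by_cases hba : G.Adj b a
      · exact .inr (mem_filter.2 ⟨hb, hba⟩)
      · refine .inl (mem_filter.2 ⟨(mem_filter.1 hb).1, fun x hx hbx => ?_⟩)
        exact mem_erase.2 ⟨fun h => hba (h ▸ hbx), (mem_filter.1 hb).2 x hx hbx⟩
    set N := {a' ∈ X | ∃ b ∈ W X, G.Adj b a ∧ G.Adj b a'} with hN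
    have h3 := h.sum_choose_degIn_le F N
    have h4 : #F ≤ ∑ b ∈ F, (G.degIn b N).choose s := by
      rw [card_eq_sum_ones]
      refine sum_le_sum fun b hb => ?_
      rw [hF, mem_filter] at hb
      refine Nat.choose_pos ((hsub b hb.1).trans (card_le_card fun x hx => ?_))
      rw [mem_filter] at hx
      exact mem_filter.2 ⟨mem_filter.2 ⟨hx.1, b, hb.1, hb.2, hx.2⟩, hx.2⟩
    have h5 : (#F : ℝ) ≤ s * (#N : ℝ) ^ s := by
      have := (h4.trans h3).trans (Nat.mul_le_mul_left s (Nat.choose_le_pow (#N) s))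
      exact_mod_cast this
    have h6 : (#F : ℝ) ≤ s * y ^ s := h5.trans (by gcongr)
    have h7 : (#(W X) : ℝ) ≤ #(W (X.erase a)) + #F := by exact_mod_cast h2
    have h8 : (#(X.erase a) : ℝ) = #X - 1 := by
      rw [card_erase_of_mem ha, Nat.cast_sub (card_pos.2 ⟨a, ha⟩)]; simp
    rw [h8] at h1
    have := hX.2
    linarith

/-- If few of the edges avoid the vertices of large degree, there is a dense induced
`1`-subdivision. -/
theorem exists_isOneSubdivision_of_unbalanced [Finite V]
    (h : (completeBipartiteGraph (Fin s) (Fin s)).Free G) (hs : 0 < s) {K Δ : ℝ} (hK : 1 ≤ K)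
    (hsθ : 16 * s ≤ θ) (hθ : ∀ X : Finset V, G.adjCount X X ≤ θ * #X) {S : Finset V}
    (hS : S.Nonempty) (hSθ : θ * #S ≤ G.adjCount S S)
    (hΔ : 32 * θ * (s * (200 * K * θ ^ 2) ^ s) ≤ Δ)
    (hU : 2 * (G.adjCount {v ∈ S | G.degIn v S ≤ Δ} {v ∈ S | G.degIn v S ≤ Δ} : ℝ) ≤ θ * #S) :
    ∃ A' B' : Finset V, G.IsOneSubdivision A' B' ∧ A'.Nonempty ∧ K * #A' ≤ #B' := by
  have hs1 : (1 : ℝ) ≤ s := by exact_mod_cast hs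
  have h1 : 1 ≤ θ := by linarith
  have hSpos : (0 : ℝ) < #S := by exact_mod_cast hS.card_pos
  set D : ℝ := s * (200 * K * θ ^ 2) ^ s with hD
  have hD1 : 1 ≤ D := by
    rw [hD]
    refine one_le_mul_of_one_le_of_one_le hs1 (one_le_pow₀ ?_)
    nlinarith
  set S' := {v ∈ S | (G.degIn v S : ℝ) ≤ Δ} with hS'
  set L := {v ∈ S | ¬ (G.degIn v S : ℝ) ≤ Δ} with hL
  have hdisj : Disjoint S' L := disjoint_filter_filter_not _ _ _
  have hun : S' ∪ L = S := filter_union_filter_not_eq _ _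
  have hLcard : 32 * (D * #L) ≤ #S := by
    have e1 : (#L : ℝ) * Δ ≤ θ * #S := by
      refine le_trans ?_ (hθ S)
      have e2 : (#L : ℝ) * Δ ≤ ∑ v ∈ L, (G.degIn v S : ℝ) := by
        rw [← nsmul_eq_mul]
        exact card_nsmul_le_sum _ _ _ fun v hv => (not_le.1 (mem_filter.1 hv).2).le
      refine e2.trans ?_
      rw [adjCount]
      exact_mod_cast sum_le_sum_of_subset (filter_subset _ _)
    have e3 : (#L : ℝ) * (32 * θ * D) ≤ θ * #S := le_trans (by gcongr) e1
    refine le_of_mul_le_mul_left ?_ (by linarith : 0 < θ)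
    linarith
  have hLcard' : 32 * (#L : ℝ) ≤ #S := by
    have : (#L : ℝ) ≤ D * #L := le_mul_of_one_le_left (by positivity) hD1
    linarith
  have hsum : (G.adjCount S S : ℝ) = G.adjCount S' S' + 2 * G.adjCount S' L + G.adjCount L L := by
    rw [← hun]
    exact_mod_cast adjCount_union_self hdisj
  have hLL := hθ L
  have hSL : 15 * (θ * #S) ≤ 64 * G.adjCount S' L := by
    have : θ * (32 * #L) ≤ θ * #S := by gcongr
    linarith
  set B := {b ∈ S' | s ≤ G.degIn b L ∧ (G.degIn b L : ℝ) ≤ θ} with hB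
  set H := {b ∈ S' | ¬ (G.degIn b L : ℝ) ≤ θ} with hH
  -- Sparsity of `H ∪ L` gives `2e(H, L) ≤ θ(#H + #L)`, while `e(H, L) ≥ θ #H` by the choice of `H`.
  have hHL : (G.adjCount H L : ℝ) ≤ θ * #L := by
    have hd : Disjoint H L := disjoint_of_subset_left (filter_subset _ _) hdisj
    have e1 := hθ (H ∪ L)
    rw [adjCount_union_self hd, card_union_of_disjoint hd] at e1
    push_cast at e1
    have e2 : (#H : ℝ) * θ ≤ G.adjCount H L := by
      rw [← nsmul_eq_mul, adjCount, Nat.cast_sum]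
      exact card_nsmul_le_sum _ _ _ fun v hv => (not_le.1 (mem_filter.1 hv).2).le
    have e3 : (0 : ℝ) ≤ G.adjCount H H := by positivity
    have e4 : (0 : ℝ) ≤ G.adjCount L L := by positivity
    linarith
  have hBL : (G.adjCount S' L : ℝ) ≤ G.adjCount B L + G.adjCount H L + s * #S := by
    have e1 : G.adjCount S' L ≤ G.adjCount B L + G.adjCount H L + s * #S' := by
      have e2 : S' = (B ∪ H) ∪ {b ∈ S' | b ∉ B ∪ H} := by
        rw [filter_notMem_eq_sdiff, union_sdiff_of_subset]
        exact union_subset (filter_subset _ _) (filter_subset _ _)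
      have e3 : G.adjCount (B ∪ H) L ≤ G.adjCount B L + G.adjCount H L := by
        rw [adjCount, adjCount, adjCount, ← sum_union_inter]
        exact Nat.le_add_right _ _
      have e4 : G.adjCount {b ∈ S' | b ∉ B ∪ H} L ≤ s * #S' := by
        rw [adjCount, mul_comm, ← smul_eq_mul]
        refine (sum_le_card_nsmul _ _ s fun b hb => ?_).trans
          (Nat.mul_le_mul_right _ (card_le_card (filter_subset _ _)))
        simp only [mem_filter, mem_union, hB, hH] at hb
        by_contra hcon
        push Not at hcon
        by_cases hb' : (G.degIn b L : ℝ) ≤ θ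
        · exact hb.2 (.inl ⟨hb.1, hcon.le, hb'⟩)
        · exact hb.2 (.inr ⟨hb.1, hb'⟩)
      conv_lhs => rw [e2, adjCount_union_left (by
        rw [filter_notMem_eq_sdiff]; exact disjoint_sdiff)]
      omega
    have e5 : s * #S' ≤ s * #S := Nat.mul_le_mul_left _ (card_le_card (filter_subset _ _))
    exact_mod_cast e1.trans (by omega)
  -- Of at least `15θ#S/64` edges between `S'` and `L`, at most `θ#S/32` meet `H` and at most
  -- `θ#S/16` start at vertices with fewer than `s` neighbours in `L`. The rest meet `B`, at most
  -- `θ` at each vertex.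
  have hBcard : (#S : ℝ) < 32 * #B := by
    have e1 : (G.adjCount B L : ℝ) ≤ #B * θ := by
      rw [← nsmul_eq_mul, adjCount, Nat.cast_sum]
      exact sum_le_card_nsmul _ _ _ fun v hv => (mem_filter.1 hv).2.2
    have e2 : 16 * s * (#S : ℝ) ≤ θ * #S := by gcongr
    have e3 : θ * (32 * #L) ≤ θ * #S := by gcongr
    have e4 : 0 < θ * (#S : ℝ) := by positivity
    have e5 : θ * #S < θ * (32 * #B) := by linarith
    exact lt_of_mul_lt_mul_left e5 (by linarith)
  obtain ⟨A, hAL, hA, B', hB', hN⟩ := exists_secondNeighbors h hs (L := L) (B := B)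
    (y := 200 * K * θ ^ 2) (fun b hb => (mem_filter.1 hb).2.1) (by linarith)
  exact exists_isOneSubdivision_of_secondNeighbors hK h1 hθ hA (B := B') (fun b hb =>
    le_trans (by exact_mod_cast degIn_mono hAL) (mem_filter.1 (hB' hb)).2.2) hN

end Unbalanced
end SimpleGraph

namespace SimpleGraph
-- Counting cherries and conflicting pairs of cherries.
section Balanced
open Finset Classical

variable {V : Type*} {G : SimpleGraph V}

theorem sum_le_sum_pairs {α : Type*} {N : Finset α} {𝒬 : Finset (Finset α)}
    (h𝒬 : 𝒬 ⊆ N.powersetCard 2) (g : Finset α → ℕ) :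
    ∑ P ∈ 𝒬, g P ≤ ∑ a ∈ N, ∑ a' ∈ N, g {a, a'} := by
  have h1 : 𝒬 ⊆ (N ×ˢ N).image fun e => ({e.1, e.2} : Finset α) := by
    intro P hP
    obtain ⟨hPN, hP2⟩ := mem_powersetCard.1 (h𝒬 hP)
    obtain ⟨x, y, -, rfl⟩ := card_eq_two.1 hP2
    refine mem_image.2 ⟨(x, y), mem_product.2 ⟨hPN (by simp), hPN (by simp)⟩, rfl⟩
  rw [← sum_product' N N (fun a a' => g {a, a'})]
  refine (sum_le_sum_of_subset h1).trans ?_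
  exact sum_image_le_of_nonneg (fun _ _ => Nat.zero_le _)

/-- The pairs of cherries in `A` with centre `b`. -/
noncomputable def cherryPairs (G : SimpleGraph V) (A : Finset V) (b : V) : Finset (Finset V) :=
  {P ∈ A.powersetCard 2 | (∀ a ∈ P, G.Adj b a) ∧ ∀ x ∈ P, ∀ y ∈ P, ¬ G.Adj x y}

variable {A B : Finset V} {b : V}

theorem sum_cherries {M : Type*} [AddCommMonoid M] (f : V × Finset V → M) :
    ∑ c ∈ G.cherries A B, f c = ∑ b ∈ B, ∑ P ∈ G.cherryPairs A b, f (b, P) := by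
  rw [cherries, sum_filter, sum_product]
  simp only [cherryPairs, sum_filter]

theorem sum_sum_cherries {M : Type*} [AddCommMonoid M] (f : V × Finset V → V × Finset V → M) :
    ∑ c ∈ G.cherries A B, ∑ c' ∈ G.cherries A B, f c c' = ∑ b ∈ B, ∑ b' ∈ B,
      ∑ P ∈ G.cherryPairs A b, ∑ P' ∈ G.cherryPairs A b', f (b, P) (b', P') := by
  rw [sum_cherries]
  refine sum_congr rfl fun b _ => ?_
  rw [sum_congr rfl fun P _ => sum_cherries _, sum_comm]

theorem cherryPairs_subset :
    G.cherryPairs A b ⊆ ({a ∈ A | G.Adj b a} : Finset V).powersetCard 2 := by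
  intro P hP
  simp only [cherryPairs, mem_filter, mem_powersetCard] at hP
  exact mem_powersetCard.2 ⟨fun a ha => mem_filter.2 ⟨hP.1.1 ha, hP.2.1 a ha⟩, hP.1.2⟩

theorem adj_of_mem_cherryPairs {P : Finset V} (hP : P ∈ G.cherryPairs A b) {a : V} (ha : a ∈ P) :
    G.Adj b a := (mem_filter.1 hP).2.1 a ha

theorem card_cherryPairs_le : #(G.cherryPairs A b) ≤ G.degIn b A ^ 2 := by
  have := sum_le_sum_pairs (G.cherryPairs_subset (A := A) (b := b)) (fun _ => 1)
  simpa [degIn, sq] using this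

theorem card_cherryPairs_filter_mem_le (a : V) :
    #{P ∈ G.cherryPairs A b | a ∈ P} ≤ if G.Adj b a then G.degIn b A else 0 := by
  by_cases hab : G.Adj b a
  · rw [if_pos hab, degIn]
    refine (card_le_card (t := ({x ∈ A | G.Adj b x}).image fun x => ({a, x} : Finset V)) ?_).trans
      card_image_le
    intro P hP
    obtain ⟨hP, ha⟩ := mem_filter.1 hP
    obtain ⟨hPN, hP2⟩ := mem_powersetCard.1 (cherryPairs_subset hP)
    obtain ⟨x, hx⟩ := card_eq_one.1 (show #(P.erase a) = 1 by rw [card_erase_of_mem ha, hP2])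
    have : P = {a, x} := by rw [← insert_erase ha, hx]
    exact mem_image.2 ⟨x, hPN (by rw [this]; simp), this.symm⟩
  · rw [if_neg hab, Nat.le_zero, card_eq_zero, filter_eq_empty_iff]
    exact fun P hP ha => hab (adj_of_mem_cherryPairs hP ha)

/-- An ordered pair of neighbours of `b` is diagonal, adjacent, or one of the two orderings of a
cherry. -/
theorem sq_degIn_le_cherryPairs (A : Finset V) (b : V) :
    G.degIn b A ^ 2 ≤ 2 * #(G.cherryPairs A b) + G.degIn b A +
      G.adjCount {a ∈ A | G.Adj b a} {a ∈ A | G.Adj b a} := by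
  set N := {a ∈ A | G.Adj b a} with hN
  set E : Finset (V × V) := {e ∈ N ×ˢ N | e.1 ≠ e.2 ∧ ¬ G.Adj e.1 e.2} with hE
  have h1 : #E ≤ 2 * #(G.cherryPairs A b) := by
    refine (card_le_two_mul_card_image_pair E).trans (Nat.mul_le_mul_left 2 (card_le_card ?_))
    intro P hP
    obtain ⟨⟨x, y⟩, he, rfl⟩ := mem_image.1 hP
    simp only [hE, hN, mem_filter, mem_product] at he
    obtain ⟨⟨⟨hx, hbx⟩, hy, hby⟩, hne, hadj⟩ := he
    have hadj' : ¬ G.Adj y x := fun h => hadj h.symm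
    refine mem_filter.2 ⟨mem_powersetCard.2 ⟨?_, card_pair hne⟩, ?_, ?_⟩
    · exact insert_subset hx (singleton_subset_iff.2 hy)
    · simp [hbx, hby]
    · simpa using ⟨hadj, hadj'⟩
  have h2 : N ×ˢ N ⊆ (E ∪ N.image fun a => (a, a)) ∪ {e ∈ N ×ˢ N | G.Adj e.1 e.2} := by
    rintro ⟨x, y⟩ hxy
    simp only [hE, mem_union, mem_filter, mem_image, Prod.mk.injEq]
    by_cases hne : x = y
    · subst hne
      exact .inl (.inr ⟨x, (mem_product.1 hxy).1, rfl, rfl⟩)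
    · by_cases hadj : G.Adj x y
      · exact .inr ⟨hxy, hadj⟩
      · exact .inl (.inl ⟨hxy, hne, hadj⟩)
  have h3 := (card_le_card h2).trans ((card_union_le _ _).trans
    (add_le_add_left (card_union_le _ _) _))
  rw [card_product, ← adjCount_eq_card] at h3
  have h4 : #(N.image fun a => (a, a)) ≤ #N := card_image_le
  have h5 : G.degIn b A = #N := rfl
  rw [h5, sq]
  omega

/-- Cherries with centres `b`, `b'` and the same pair `{a, a'}` make `b'a'` an edge between the
neighbourhood of `a` in `B` and that of `b` in `A`. -/
theorem sum_same_pair_le :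
    ∑ c ∈ G.cherries A B, ∑ c' ∈ G.cherries A B, (if c.2 = c'.2 then 1 else 0) ≤
      ∑ b ∈ B, ∑ a ∈ A with G.Adj b a,
        G.adjCount {b' ∈ B | G.Adj a b'} {a' ∈ A | G.Adj b a'} := by
  rw [sum_cherries]
  refine sum_le_sum fun b hb => ?_
  have h1 : ∀ P ∈ G.cherryPairs A b,
      ∑ c' ∈ G.cherries A B, (if P = c'.2 then 1 else 0) ≤
        ∑ b' ∈ B, if ∀ a ∈ P, G.Adj b' a then 1 else 0 := by
    intro P hP
    rw [sum_cherries]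
    refine sum_le_sum fun b' _ => ?_
    rw [sum_ite_eq]
    by_cases hP' : P ∈ G.cherryPairs A b'
    · rw [if_pos hP', if_pos fun a ha => adj_of_mem_cherryPairs hP' ha]
    · rw [if_neg hP']; exact Nat.zero_le _
  have h2 := sum_le_sum_pairs (G.cherryPairs_subset (A := A) (b := b))
    fun P => ∑ b' ∈ B, if ∀ a ∈ P, G.Adj b' a then 1 else 0
  refine (sum_le_sum h1).trans (h2.trans ?_)
  refine sum_le_sum fun a ha => ?_
  rw [adjCount_eq_sum, sum_comm]
  rw [sum_filter (fun b' => G.Adj a b')]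
  refine sum_le_sum fun b' _ => ?_
  by_cases h1 : G.Adj b' a
  · rw [if_pos h1.symm]
    refine sum_le_sum fun a' _ => ?_
    by_cases h2 : G.Adj b' a' <;> simp [h1, h2]
  · simp [h1]

theorem sum_adj_le {d : ℕ} (hd : ∀ b ∈ B, G.degIn b A ≤ d) :
    ∑ c ∈ G.cherries A B, ∑ c' ∈ G.cherries A B, (if G.Adj c.1 c'.1 then 1 else 0) ≤
      d ^ 4 * G.adjCount B B := by
  rw [sum_sum_cherries, adjCount_eq_sum, mul_sum]
  refine sum_le_sum fun b hb => ?_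
  rw [mul_sum]
  refine sum_le_sum fun b' hb' => ?_
  by_cases hbb : G.Adj b b'
  · simp only [if_pos hbb, sum_const, smul_eq_mul, mul_one]
    calc _ ≤ d ^ 2 * d ^ 2 := Nat.mul_le_mul
          (card_cherryPairs_le.trans (Nat.pow_le_pow_left (hd b hb) 2))
          (card_cherryPairs_le.trans (Nat.pow_le_pow_left (hd b' hb') 2))
      _ = d ^ 4 := by ring
  · simp [hbb]

/-- For a shared vertex `a`, the centres are adjacent neighbours of `a`, and each pair is completed
in at most `d` ways. -/
theorem sum_adj_inter_le {d : ℕ} (hd : ∀ b ∈ B, G.degIn b A ≤ d) :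
    ∑ c ∈ G.cherries A B, ∑ c' ∈ G.cherries A B,
      (if G.Adj c.1 c'.1 then #(c.2 ∩ c'.2) else 0) ≤
      d ^ 2 * ∑ a ∈ A, G.adjCount {b ∈ B | G.Adj a b} {b ∈ B | G.Adj a b} := by
  have h1 : ∀ b b', ∑ P ∈ G.cherryPairs A b, ∑ P' ∈ G.cherryPairs A b', #(P ∩ P') =
      ∑ a ∈ A, #{P ∈ G.cherryPairs A b | a ∈ P} * #{P ∈ G.cherryPairs A b' | a ∈ P} := by
    intro b b'
    have e1 : ∀ P ∈ G.cherryPairs A b, ∀ P' ∈ G.cherryPairs A b', #(P ∩ P') =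
        ∑ a ∈ A, (if a ∈ P then 1 else 0) * (if a ∈ P' then 1 else 0) := by
      intro P hP P' _
      have hPA : P ⊆ A := fun a ha =>
        (mem_filter.1 ((mem_powersetCard.1 (cherryPairs_subset hP)).1 ha)).1
      rw [card_eq_sum_ones, ← sum_subset (inter_subset_left.trans hPA) (s₁ := P ∩ P')]
      · refine sum_congr rfl fun a ha => ?_
        rw [mem_inter] at ha
        rw [if_pos ha.1, if_pos ha.2]
      · intro a _ ha
        rw [mem_inter, not_and] at ha
        by_cases h : a ∈ P
        · rw [if_neg (ha h), mul_zero]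
        · rw [if_neg h, zero_mul]
    rw [sum_congr rfl fun P hP => sum_congr rfl fun P' hP' => e1 P hP P' hP']
    simp only [card_filter, sum_mul_sum]
    rw [sum_congr rfl fun P _ => sum_comm, sum_comm]
  have h2 : ∀ b ∈ B, ∀ b' ∈ B, ∀ a,
      #{P ∈ G.cherryPairs A b | a ∈ P} * #{P ∈ G.cherryPairs A b' | a ∈ P} ≤
        d ^ 2 * if G.Adj a b ∧ G.Adj a b' then 1 else 0 := by
    intro b hb b' hb' a
    have e1 := card_cherryPairs_filter_mem_le (G := G) (A := A) (b := b) a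
    have e2 := card_cherryPairs_filter_mem_le (G := G) (A := A) (b := b') a
    refine (Nat.mul_le_mul e1 e2).trans ?_
    by_cases hab : G.Adj b a
    · by_cases hab' : G.Adj b' a
      · rw [if_pos hab, if_pos hab', if_pos ⟨hab.symm, hab'.symm⟩, mul_one, sq]
        exact Nat.mul_le_mul (hd b hb) (hd b' hb')
      · rw [if_neg hab', mul_zero]; exact Nat.zero_le _
    · rw [if_neg hab, zero_mul]; exact Nat.zero_le _
  have h3 : ∑ a ∈ A, G.adjCount {b ∈ B | G.Adj a b} {b ∈ B | G.Adj a b} =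
      ∑ b ∈ B, ∑ b' ∈ B, ∑ a ∈ A,
        if G.Adj b b' then (if G.Adj a b ∧ G.Adj a b' then 1 else 0) else 0 := by
    rw [sum_congr rfl fun b _ => sum_comm, sum_comm]
    refine sum_congr rfl fun a _ => ?_
    rw [adjCount_eq_sum, sum_filter]
    refine sum_congr rfl fun b _ => ?_
    rw [sum_filter]
    by_cases hab : G.Adj a b
    · rw [if_pos hab]
      refine sum_congr rfl fun b' _ => ?_
      by_cases hab' : G.Adj a b' <;> simp [hab, hab']
    · simp [hab]
  rw [sum_sum_cherries, h3, mul_sum]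
  refine sum_le_sum fun b hb => ?_
  rw [mul_sum]
  refine sum_le_sum fun b' hb' => ?_
  by_cases hbb : G.Adj b b'
  · simp only [if_pos hbb]
    rw [h1, mul_sum]
    exact sum_le_sum fun a _ => h2 b hb b' hb' a
  · simp [hbb]

end Balanced
end SimpleGraph

namespace SimpleGraph
-- The balanced case: nearly biregular sides.
section Balanced
open Finset Classical

variable {V : Type*} {G : SimpleGraph V} {A B : Finset V}

/-- Distinct pairs share at most one vertex, so the union has size 2, 3 or 4; the weight `#(c.2 ∩
c'.2)` picks out size 3. -/
theorem sum_conflict_le {p : ℝ} (hp : 0 ≤ p) :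
    ∑ c ∈ G.cherries A B, ∑ c' ∈ G.cherries A B with G.conflict.Adj c c', p ^ #(c.2 ∪ c'.2) ≤
      p ^ 2 * ((∑ c ∈ G.cherries A B, ∑ c' ∈ G.cherries A B,
        (if c.2 = c'.2 then 1 else 0) : ℕ) : ℝ) +
      p ^ 4 * ((∑ c ∈ G.cherries A B, ∑ c' ∈ G.cherries A B,
        (if G.Adj c.1 c'.1 then 1 else 0) : ℕ) : ℝ) +
      p ^ 3 * ((∑ c ∈ G.cherries A B, ∑ c' ∈ G.cherries A B,
        (if G.Adj c.1 c'.1 then #(c.2 ∩ c'.2) else 0) : ℕ) : ℝ) := by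
  push_cast
  simp only [mul_sum, ← sum_add_distrib]
  refine sum_le_sum fun c hc => ?_
  rw [sum_filter]
  refine sum_le_sum fun c' hc' => ?_
  have h1 := (mem_cherries.1 hc).2.2.1
  have h2 := (mem_cherries.1 hc').2.2.1
  by_cases hcc : G.conflict.Adj c c'
  · rw [if_pos hcc]
    by_cases hP : c.2 = c'.2
    · rw [← hP, union_self, h1, if_pos rfl, mul_one, add_assoc]
      exact le_add_of_nonneg_right (by positivity)
    · have hadj := hcc.2.resolve_right hP
      rw [if_neg hP, if_pos hadj, if_pos hadj]
      have h3 := card_union_add_card_inter c.2 c'.2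
      have h4 : #(c.2 ∩ c'.2) < 2 := by
        by_contra hcon
        push Not at hcon
        have e1 : c.2 ∩ c'.2 = c.2 := eq_of_subset_of_card_le inter_subset_left (by omega)
        have e2 : c.2 ∩ c'.2 = c'.2 := eq_of_subset_of_card_le inter_subset_right (by omega)
        exact hP (e1.symm.trans e2)
      interval_cases h5 : #(c.2 ∩ c'.2)
      · rw [show #(c.2 ∪ c'.2) = 4 by omega]; simp
      · rw [show #(c.2 ∪ c'.2) = 3 by omega]
        have : 0 ≤ p ^ 4 := by positivity
        simpa using this
  · rw [if_neg hcc]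
    positivity

/-- A lower bound for the number of cherries in a bipartite graph that is nearly regular on one
side and has sparse neighbourhoods. -/
theorem le_card_cherries {l d : ℝ} (hl : 8 ≤ l) (hB : ∀ b ∈ B, (G.degIn b A : ℝ) ≤ d)
    (hBpos : B.Nonempty) (hNB : #B * d ≤ l ^ 2 * G.adjCount B A) (hd : l ^ 50 ≤ d)
    (hdense : ∀ X : Finset V, (#X : ℝ) ≤ d → l ^ 50 * G.adjCount X X ≤ d * d) :
    #B * d ^ 2 ≤ l ^ 5 * #(G.cherries A B) := by
  have hBp : (0 : ℝ) < #B := by exact_mod_cast hBpos.card_pos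
  have hl0 : 0 < l := by linarith
  have hd0 : 0 < d := lt_of_lt_of_le (by positivity) hd
  have hcard : (#(G.cherries A B) : ℝ) = ∑ b ∈ B, (#(G.cherryPairs A b) : ℝ) := by
    rw [card_eq_sum_ones, sum_cherries]
    push_cast
    simp
  set N : ℝ := (G.adjCount B A : ℝ) with hN
  have hNsum : N = ∑ b ∈ B, (G.degIn b A : ℝ) := by rw [hN, adjCount]; push_cast; rfl
  set Q : ℝ := ∑ b ∈ B, (G.degIn b A : ℝ) ^ 2 with hQ
  have h1 : l ^ 50 * Q ≤ 2 * l ^ 50 * #(G.cherries A B) + l ^ 50 * N + #B * d ^ 2 := by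
    rw [hcard, hNsum, hQ, mul_sum, mul_sum, mul_sum, ← sum_add_distrib, ← nsmul_eq_mul,
      ← sum_const, ← sum_add_distrib]
    refine sum_le_sum fun b hb => ?_
    have e1 : (G.degIn b A : ℝ) ^ 2 ≤ 2 * #(G.cherryPairs A b) + G.degIn b A +
      G.adjCount {a ∈ A | G.Adj b a} {a ∈ A | G.Adj b a} := by
      exact_mod_cast sq_degIn_le_cherryPairs A b
    have e2 := hdense {a ∈ A | G.Adj b a} (hB b hb)
    have e3 := mul_le_mul_of_nonneg_left e1 (by positivity : 0 ≤ l ^ 50)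
    linarith
  have h2 : N ≤ #B * d := by
    rw [hNsum, ← nsmul_eq_mul]
    exact sum_le_card_nsmul _ _ _ hB
  have h3 : l ^ 50 * N ≤ #B * d ^ 2 := by
    calc l ^ 50 * N ≤ d * (#B * d) := by gcongr
      _ = #B * d ^ 2 := by ring
  -- Cauchy–Schwarz: near regularity makes the sum of squared degrees at least `#B d² / l⁴`, far
  -- above the diagonal and adjacent pairs.
  have h4 : N ^ 2 ≤ #B * Q := by
    rw [hNsum]; exact sq_sum_le_card_mul_sum_sq
  have h5 : #B * d ^ 2 ≤ l ^ 4 * Q := by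
    have e1 : (#B * d) ^ 2 ≤ (l ^ 2 * N) ^ 2 := by gcongr
    have e2 : l ^ 4 * N ^ 2 ≤ l ^ 4 * (#B * Q) := by gcongr
    refine le_of_mul_le_mul_left ?_ hBp
    linarith
  have h6 : l ^ 50 * (#B * d ^ 2) ≤ l ^ 4 * (2 * l ^ 50 * #(G.cherries A B) + 2 * (#B * d ^ 2)) := by
    calc l ^ 50 * (#B * d ^ 2) ≤ l ^ 50 * (l ^ 4 * Q) := by gcongr
      _ = l ^ 4 * (l ^ 50 * Q) := by ring
      _ ≤ _ := by gcongr; linarith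
  have h7 : 4 * l ^ 4 * (#B * d ^ 2) ≤ l ^ 50 * (#B * d ^ 2) := by
    have : 4 * l ^ 4 ≤ l ^ 50 := by
      calc 4 * l ^ 4 ≤ l * l ^ 4 := by gcongr; linarith
        _ = l ^ 5 := by ring
        _ ≤ l ^ 50 := pow_le_pow_right₀ (by linarith) (by norm_num)
    gcongr
  have h8 : l ^ 50 * (#B * d ^ 2) ≤ l ^ 50 * (4 * l ^ 4 * #(G.cherries A B)) := by linarith
  have h9 := le_of_mul_le_mul_left h8 (by positivity)
  refine h9.trans ?_
  calc 4 * l ^ 4 * (#(G.cherries A B) : ℝ) ≤ l * l ^ 4 * #(G.cherries A B) := by gcongr; linarith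
    _ = _ := by ring

/-- An upper bound for the expected number of conflicts. -/
theorem sum_conflict_le_of_dense {l d D θ p : ℝ} (hl : 8 ≤ l) (hp : p = 1 / (d * l ^ 20))
    (hB : ∀ b ∈ B, (G.degIn b A : ℝ) ≤ d) (hA : ∀ a ∈ A, (G.degIn a B : ℝ) ≤ D)
    (hNA : #A * D ≤ l ^ 2 * G.adjCount B A) (hdD : d ≤ D) (hd : l ^ 50 ≤ d) (hθd : θ ≤ l * d)
    (hθ : ∀ X : Finset V, G.adjCount X X ≤ θ * #X)
    (hdense : ∀ (X Y : Finset V) (x y : ℝ), d ≤ x → d ≤ y → #X ≤ x → #Y ≤ y →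
      l ^ 50 * G.adjCount X Y ≤ x * y) :
    ∑ c ∈ G.cherries A B, ∑ c' ∈ G.cherries A B with G.conflict.Adj c c', p ^ #(c.2 ∪ c'.2) ≤
      #B * D / l ^ 78 := by
  have hl0 : 0 < l := by linarith
  have hd0 : 0 < d := lt_of_lt_of_le (by positivity) hd
  have hD0 : 0 < D := lt_of_lt_of_le hd0 hdD
  have hp0 : 0 ≤ p := by rw [hp]; positivity
  refine (sum_conflict_le hp0).trans ?_
  have hfl : ∀ b ∈ B, G.degIn b A ≤ ⌊d⌋₊ := fun b hb => Nat.le_floor (hB b hb)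
  have hfld : (⌊d⌋₊ : ℝ) ≤ d := Nat.floor_le hd0.le
  have hN : (G.adjCount B A : ℝ) ≤ #B * d := by
    rw [adjCount, Nat.cast_sum, ← nsmul_eq_mul]
    exact sum_le_card_nsmul _ _ _ hB
  have hX : ∀ X Y : Finset V, ∀ x y : ℝ, d ≤ x → d ≤ y → #X ≤ x → #Y ≤ y →
      (G.adjCount X Y : ℝ) ≤ x * y / l ^ 50 := by
    intro X Y x y h1 h2 h3 h4
    rw [le_div_iff₀ (by positivity), mul_comm]
    exact hdense X Y x y h1 h2 h3 h4
  -- Equal pairs and shared vertices are controlled by the density of pairs of neighbourhoods, the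
  -- remaining conflicts by the sparsity of `B`.
  have t1 : p ^ 2 * ((∑ c ∈ G.cherries A B, ∑ c' ∈ G.cherries A B,
      (if c.2 = c'.2 then 1 else 0) : ℕ) : ℝ) ≤ #B * D / l ^ 90 := by
    have e1 : ((∑ c ∈ G.cherries A B, ∑ c' ∈ G.cherries A B,
        (if c.2 = c'.2 then 1 else 0) : ℕ) : ℝ) ≤ #B * d * (D * d / l ^ 50) := by
      refine le_trans (Nat.cast_le.2 sum_same_pair_le) ?_
      push_cast
      refine (sum_le_sum fun b hb => sum_le_card_nsmul _ _ (D * d / l ^ 50) fun a ha =>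
        hX _ _ _ _ hdD le_rfl (hA a (mem_filter.1 ha).1) (hB b hb)).trans ?_
      simp only [nsmul_eq_mul]
      rw [← sum_mul]
      gcongr
      refine le_trans (le_of_eq ?_) hN
      rw [adjCount, Nat.cast_sum]
      rfl
    calc _ ≤ p ^ 2 * (#B * d * (D * d / l ^ 50)) := by gcongr
      _ = #B * D / l ^ 90 := by rw [hp]; field_simp
  have t2 : p ^ 4 * ((∑ c ∈ G.cherries A B, ∑ c' ∈ G.cherries A B,
      (if G.Adj c.1 c'.1 then 1 else 0) : ℕ) : ℝ) ≤ #B * D / l ^ 79 := by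
    have e1 : ((∑ c ∈ G.cherries A B, ∑ c' ∈ G.cherries A B,
        (if G.Adj c.1 c'.1 then 1 else 0) : ℕ) : ℝ) ≤ d ^ 4 * (l * D * #B) := by
      refine le_trans (Nat.cast_le.2 (sum_adj_le hfl)) ?_
      push_cast
      have e2 : θ * #B ≤ l * D * #B := by
        gcongr
        exact hθd.trans (by gcongr)
      have e3 := (hθ B).trans e2
      gcongr
    calc _ ≤ p ^ 4 * (d ^ 4 * (l * D * #B)) := by gcongr
      _ = #B * D / l ^ 79 := by rw [hp]; field_simp
  have t3 : p ^ 3 * ((∑ c ∈ G.cherries A B, ∑ c' ∈ G.cherries A B,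
      (if G.Adj c.1 c'.1 then #(c.2 ∩ c'.2) else 0) : ℕ) : ℝ) ≤ #B * D / l ^ 108 := by
    have e1 : ((∑ c ∈ G.cherries A B, ∑ c' ∈ G.cherries A B,
        (if G.Adj c.1 c'.1 then #(c.2 ∩ c'.2) else 0) : ℕ) : ℝ) ≤
        d ^ 2 * (l ^ 2 * (#B * d) * D / l ^ 50) := by
      refine le_trans (Nat.cast_le.2 (sum_adj_inter_le hfl)) ?_
      push_cast
      have e2 : ∑ a ∈ A, (G.adjCount {b ∈ B | G.Adj a b} {b ∈ B | G.Adj a b} : ℝ) ≤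
          #A * (D * D / l ^ 50) := by
        rw [← nsmul_eq_mul]
        exact sum_le_card_nsmul _ _ _ fun a ha => hX _ _ _ _ hdD hdD (hA a ha) (hA a ha)
      have e3 : #A * (D * D / l ^ 50) ≤ l ^ 2 * (#B * d) * D / l ^ 50 := by
        have e4 : #A * D ≤ l ^ 2 * (#B * d) := hNA.trans (by gcongr)
        calc #A * (D * D / l ^ 50) = #A * D * D / l ^ 50 := by ring
          _ ≤ _ := by gcongr
      have e4 := e2.trans e3
      gcongr
    calc _ ≤ p ^ 3 * (d ^ 2 * (l ^ 2 * (#B * d) * D / l ^ 50)) := by gcongr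
      _ = #B * D / l ^ 108 := by rw [hp]; field_simp
  have hmono : ∀ n, 79 ≤ n → #B * D / l ^ n ≤ #B * D / l ^ 79 := by
    intro n hn
    gcongr
    linarith
  have h90 := hmono 90 (by norm_num)
  have h108 := hmono 108 (by norm_num)
  have h0 : 0 ≤ #B * D / l ^ 79 :=
    div_nonneg (mul_nonneg (Nat.cast_nonneg _) hD0.le) (pow_nonneg hl0.le _)
  have h78 : 8 * (#B * D / l ^ 79) ≤ #B * D / l ^ 78 := by
    calc 8 * (#B * D / l ^ 79) ≤ l * (#B * D / l ^ 79) :=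
          mul_le_mul_of_nonneg_right hl h0
      _ = #B * D / l ^ 78 := by field_simp
  linarith

/-- A dense nearly biregular bipartite graph contains a dense induced `1`-subdivision, if pairs of
sufficiently large sets span few edges. -/
theorem exists_isOneSubdivision_of_balanced [Finite V] {K l d D θ : ℝ} (hK : 0 ≤ K) (hl : 8 ≤ l)
    (hKl : K ≤ l) (hθ0 : 0 ≤ θ) (hBne : B.Nonempty)
    (hB : ∀ b ∈ B, (G.degIn b A : ℝ) ≤ d) (hA : ∀ a ∈ A, (G.degIn a B : ℝ) ≤ D)
    (hNB : #B * d ≤ l ^ 2 * G.adjCount B A) (hNA : #A * D ≤ l ^ 2 * G.adjCount B A)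
    (hdD : d ≤ D) (hd : l ^ 50 ≤ d) (hθd : θ ≤ l * d)
    (hθ : ∀ X : Finset V, G.adjCount X X ≤ θ * #X)
    (hdense : ∀ (X Y : Finset V) (x y : ℝ), d ≤ x → d ≤ y → #X ≤ x → #Y ≤ y →
      l ^ 50 * G.adjCount X Y ≤ x * y) :
    ∃ A' B' : Finset V, G.IsOneSubdivision A' B' ∧ A'.Nonempty ∧ K * #A' ≤ #B' := by
  have hl0 : 0 < l := by linarith
  have hd0 : 0 < d := lt_of_lt_of_le (by positivity) hd
  have hD0 : 0 < D := lt_of_lt_of_le hd0 hdD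
  have hBpos : (0 : ℝ) < #B := by exact_mod_cast hBne.card_pos
  have hd1 : 1 ≤ d := (one_le_pow₀ (by linarith)).trans hd
  obtain ⟨out, ho1, ho2, ho3⟩ := exists_orientation hθ0 hθ
  obtain ⟨p, hp⟩ : ∃ p, p = 1 / (d * l ^ 20) := ⟨_, rfl⟩
  have hp0 : 0 ≤ p := by rw [hp]; positivity
  have hp1 : p ≤ 1 := by
    rw [hp, div_le_one (by positivity)]
    exact one_le_mul_of_one_le_of_one_le hd1 (one_le_pow₀ (by linarith))
  have hZ : ∀ c ∈ G.cherries A B, p * #(G.blocking A out c) ≤ 1 / 2 := by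
    intro c hc
    have hc' := mem_cherries.1 hc
    have := card_blocking_le hc'.2.2.1 (hB c.1 hc'.1) ho2
    have h4 : (#(G.blocking A out c) : ℝ) ≤ 4 * (l * d) := by nlinarith
    calc p * #(G.blocking A out c) ≤ p * (4 * (l * d)) := by gcongr
      _ = 4 / l ^ 19 := by rw [hp]; field_simp
      _ ≤ 4 / l ^ 1 := by gcongr <;> linarith
      _ ≤ 1 / 2 := by rw [pow_one, div_le_div_iff₀ hl0 (by norm_num)]; linarith
  have hg := le_randomSubsetExp_card_isolatedIn hp0 hp1 Subset.rfl ho1 hZ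
  have hcf := (randomSubsetExp_conflict_le (out := out) hp0 hp1 (Subset.refl (G.cherries A B))).trans
    (sum_conflict_le_of_dense hl hp hB hA hNA hdD hd hθd hθ hdense)
  have hcard := le_card_cherries hl hB hBne hNB hd fun X hX =>
    hdense X X d d le_rfl le_rfl hX hX
  have hN : (G.adjCount B A : ℝ) ≤ #B * d := by
    rw [adjCount, Nat.cast_sum, ← nsmul_eq_mul]
    exact sum_le_card_nsmul _ _ _ hB
  -- With this density, about `#B / (D l¹⁴)` cherries are kept, while the conflicts cost `#B / (D
  -- l¹⁶)` and the sampled part of `A`, weighted by `K`, costs `#B / (D l¹⁷)`.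
  set ρ : ℝ := l ^ 31 / D with hρ
  have hρ0 : 0 ≤ ρ := by positivity
  have hρ1 : ρ ≤ 1 := by
    rw [hρ, div_le_one hD0]
    exact (pow_le_pow_right₀ (by linarith) (by norm_num)).trans (hd.trans hdD)
  set I : Finset V → Finset (V × Finset V) := fun R => G.isolatedIn A out (G.cherries A B) R with hI
  obtain ⟨R, hR, hRF⟩ := exists_le_of_randomSubsetExp (A := A)
    (F := fun R => ρ * (#(I R) : ℝ) - ρ ^ 2 * G.conflict.adjCount (I R) (I R) - K * #R) hp0 hp1
  rw [randomSubsetExp_sub, randomSubsetExp_sub, randomSubsetExp_const_mul,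
    randomSubsetExp_const_mul, randomSubsetExp_const_mul, randomSubsetExp_card] at hRF
  have q1 : #B / (2 * D * l ^ 14) ≤ ρ * randomSubsetExp p A (fun R => (#(I R) : ℝ)) := by
    have e1 : #B * d ^ 2 / l ^ 5 ≤ #(G.cherries A B) := by
      rw [div_le_iff₀ (by positivity)]; linarith
    calc #B / (2 * D * l ^ 14) = ρ * (#B * d ^ 2 / l ^ 5 * (p ^ 2 / 2)) := by
          rw [hρ, hp]; field_simp
      _ ≤ ρ * (#(G.cherries A B) * (p ^ 2 / 2)) := by gcongr
      _ ≤ _ := by gcongr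
  have q2 : ρ ^ 2 * randomSubsetExp p A (fun R => (G.conflict.adjCount (I R) (I R) : ℝ)) ≤
      #B / (D * l ^ 16) := by
    calc _ ≤ ρ ^ 2 * (#B * D / l ^ 78) := by gcongr
      _ = #B / (D * l ^ 16) := by rw [hρ]; field_simp
  have q3 : K * (p * #A) ≤ #B / (D * l ^ 17) := by
    have e1 : (#A : ℝ) ≤ l ^ 2 * (#B * d) / D := by
      rw [le_div_iff₀ hD0]
      exact hNA.trans (by gcongr)
    calc K * (p * #A) ≤ l * (p * (l ^ 2 * (#B * d) / D)) := by gcongr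
      _ = #B / (D * l ^ 17) := by rw [hp]; field_simp
  have q4 : #B / (D * l ^ 16) + #B / (D * l ^ 17) < #B / (2 * D * l ^ 14) := by
    have e1 : #B / (D * l ^ 16) = #B / (D * l ^ 17) * l := by field_simp
    have e2 : #B / (2 * D * l ^ 14) = #B / (D * l ^ 17) * (l ^ 3 / 2) := by field_simp
    have e3 : 0 < #B / (D * l ^ 17) := by positivity
    have e4 : l + 1 < l ^ 3 / 2 := by nlinarith [pow_pos hl0 2]
    rw [e1, e2]
    nlinarith
  have hpos : 0 < ρ * (#(I R) : ℝ) - ρ ^ 2 * G.conflict.adjCount (I R) (I R) - K * #R :=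
    lt_of_lt_of_le (by linarith) hRF
  obtain ⟨A', B', hsub, hA'R, hne, hB'⟩ :=
    exists_isOneSubdivision_of_subset (out := out) (Subset.refl (G.cherries A B)) hR ho3 hρ0 hρ1
  have hAR : (#A' : ℝ) ≤ #R := by exact_mod_cast card_le_card hA'R
  have hKA : K * #A' ≤ K * #R := by gcongr
  have hKA0 : 0 ≤ K * (#A' : ℝ) := by positivity
  have hB'' : ρ * (#(I R) : ℝ) - ρ ^ 2 * G.conflict.adjCount (I R) (I R) ≤ #B' := hB'
  refine ⟨A', B', hsub, hne (card_pos.1 ?_), by linarith⟩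
  have : (0 : ℝ) < #B' := by linarith
  exact_mod_cast this

end Balanced
end SimpleGraph

namespace SimpleGraph
-- Degree scales, the two cases, and the choice of parameters.
section Main
open Finset Classical

variable {V : Type*} {G : SimpleGraph V}

/-- Splitting the vertices according to the order of magnitude of their degrees, some pair of
classes spans a large share of the edges. -/
theorem exists_degree_classes {S : Finset V} {l T : ℝ} {r : ℕ} (hl : 1 < l)
    (hdeg : ∀ v ∈ S, (G.degIn v S : ℝ) ≤ l ^ r) (hT : (r + 1) ^ 2 * T ≤ G.adjCount S S) :
    ∃ i j : ℕ, i ≤ j ∧ ∃ B ⊆ S, ∃ A ⊆ S,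
      (∀ v ∈ B, l ^ i ≤ G.degIn v S ∧ (G.degIn v S : ℝ) ≤ l ^ (i + 1)) ∧
      (∀ v ∈ A, l ^ j ≤ G.degIn v S ∧ (G.degIn v S : ℝ) ≤ l ^ (j + 1)) ∧ T ≤ G.adjCount B A := by
  set W : ℕ → Finset V := fun i => {v ∈ S | l ^ i ≤ G.degIn v S ∧ (G.degIn v S : ℝ) ≤ l ^ (i + 1)}
    with hW
  -- Only vertices on an edge need a class, and classes may overlap at powers of `l`: an upper bound
  -- by covering is enough.
  have hmem : ∀ v ∈ S, ∀ w ∈ S, G.Adj v w → ∃ i ∈ range (r + 1), v ∈ W i := by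
    intro v hv w hw hvw
    have h1 : 1 ≤ G.degIn v S := card_pos.2 ⟨w, mem_filter.2 ⟨hw, hvw⟩⟩
    obtain ⟨n, hn1, hn2⟩ := exists_nat_pow_near (by exact_mod_cast h1 : (1 : ℝ) ≤ G.degIn v S) hl
    refine ⟨n, ?_, mem_filter.2 ⟨hv, hn1, hn2.le⟩⟩
    have := (pow_le_pow_iff_right₀ hl).1 (hn1.trans (hdeg v hv))
    exact mem_range.2 (by omega)
  have hsum : G.adjCount S S ≤
      ∑ e ∈ range (r + 1) ×ˢ range (r + 1), G.adjCount (W e.1) (W e.2) := by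
    simp only [adjCount_eq_card]
    refine (card_le_card ?_).trans card_biUnion_le
    rintro ⟨x, y⟩ hxy
    obtain ⟨hmem', hadj⟩ := mem_filter.1 hxy
    rw [mem_product] at hmem'
    obtain ⟨i, hi, hxi⟩ := hmem x hmem'.1 y hmem'.2 hadj
    obtain ⟨j, hj, hyj⟩ := hmem y hmem'.2 x hmem'.1 hadj.symm
    exact mem_biUnion.2 ⟨(i, j), mem_product.2 ⟨hi, hj⟩,
      mem_filter.2 ⟨mem_product.2 ⟨hxi, hyj⟩, hadj⟩⟩
  obtain ⟨e, -, he⟩ : ∃ e ∈ range (r + 1) ×ˢ range (r + 1),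
      T ≤ (G.adjCount (W e.1) (W e.2) : ℝ) := by
    refine exists_le_of_sum_le ⟨(0, 0), by simp⟩ ?_
    rw [sum_const, card_product, card_range, nsmul_eq_mul]
    have hsum' : (G.adjCount S S : ℝ) ≤
        ∑ e ∈ range (r + 1) ×ˢ range (r + 1), (G.adjCount (W e.1) (W e.2) : ℝ) := by
      exact_mod_cast hsum
    refine le_trans (le_of_eq ?_) (hT.trans hsum')
    push_cast; ring
  rcases le_total e.1 e.2 with h | h
  · exact ⟨e.1, e.2, h, W e.1, filter_subset _ _, W e.2, filter_subset _ _,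
      fun v hv => (mem_filter.1 hv).2, fun v hv => (mem_filter.1 hv).2, he⟩
  · exact ⟨e.2, e.1, h, W e.2, filter_subset _ _, W e.1, filter_subset _ _,
      fun v hv => (mem_filter.1 hv).2, fun v hv => (mem_filter.1 hv).2, by rwa [adjCount_comm]⟩

theorem card_mul_le_adjCount {X Y : Finset V} {x : ℝ} (h : ∀ v ∈ X, x ≤ G.degIn v Y) :
    #X * x ≤ G.adjCount X Y := by
  rw [adjCount, Nat.cast_sum, ← nsmul_eq_mul]
  exact card_nsmul_le_sum _ _ _ h

theorem adjCount_le_card_mul_of_degIn_le {X Y : Finset V} {x : ℝ}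
    (h : ∀ v ∈ X, G.degIn v Y ≤ x) : G.adjCount X Y ≤ #X * x := by
  rw [adjCount, Nat.cast_sum, ← nsmul_eq_mul]
  exact sum_le_card_nsmul _ _ _ h

/-- A graph without `K_{s,s}` whose average degree is large and maximal among its induced subgraphs
contains a dense induced `1`-subdivision. -/
theorem exists_isOneSubdivision_of_free [Finite V] {s m : ℕ}
    (h : (completeBipartiteGraph (Fin s) (Fin s)).Free G) (hs : 0 < s) {K l : ℝ} (hK : 1 ≤ K)
    (hm : 51 * s + 52 ≤ m) (hls : 32 * s ≤ l) (hlK : 200 * K ≤ l)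
    (hlm : 2 * ((1 + m + s * (1 + 2 * m) : ℕ) + 1 : ℝ) ^ 2 ≤ l)
    (hθ : ∀ X : Finset V, G.adjCount X X ≤ l ^ m * #X) {S : Finset V} (hS : S.Nonempty)
    (hSθ : l ^ m * #S ≤ G.adjCount S S) :
    ∃ A' B' : Finset V, G.IsOneSubdivision A' B' ∧ A'.Nonempty ∧ K * #A' ≤ #B' := by
  have hs1 : (1 : ℝ) ≤ s := by exact_mod_cast hs
  have hl : 8 ≤ l := by linarith
  have hl0 : 0 < l := by linarith
  have hl1 : 1 < l := by linarith
  have hSpos : (0 : ℝ) < #S := by exact_mod_cast hS.card_pos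
  -- The exponent for which `l ^ r` dominates the threshold `32θ s (200Kθ²) ^ s` of the unbalanced
  -- case, where `θ = l ^ m`.
  set r := 1 + m + s * (1 + 2 * m) with hr
  by_cases hU : 2 * (G.adjCount {v ∈ S | (G.degIn v S : ℝ) ≤ l ^ r}
      {v ∈ S | (G.degIn v S : ℝ) ≤ l ^ r} : ℝ) ≤ l ^ m * #S
  · refine exists_isOneSubdivision_of_unbalanced h hs hK ?_ hθ hS hSθ ?_ hU
    · calc 16 * (s : ℝ) ≤ l := by linarith
        _ = l ^ 1 := (pow_one l).symm
        _ ≤ l ^ m := pow_le_pow_right₀ hl1.le (by omega)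
    · calc 32 * l ^ m * (s * (200 * K * (l ^ m) ^ 2) ^ s)
          = 32 * s * (l ^ m * (200 * K * (l ^ m) ^ 2) ^ s) := by ring
        _ ≤ l * (l ^ m * (l * (l ^ m) ^ 2) ^ s) := by gcongr
        _ = l ^ r := by
          rw [hr, ← pow_mul, ← pow_succ', ← pow_mul, ← pow_add, ← pow_succ']
          congr 1; ring
  · push Not at hU
    set S' := {v ∈ S | (G.degIn v S : ℝ) ≤ l ^ r} with hS'
    have hS'S : S' ⊆ S := filter_subset _ _
    -- One factor `l` pays for the loss `2(r + 1)²` in the choice of two degree classes.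
    obtain ⟨n, rfl⟩ : ∃ n, m = n + 1 := ⟨m - 1, by omega⟩
    have hT : ((r : ℝ) + 1) ^ 2 * (l ^ n * #S) ≤ G.adjCount S' S' := by
      have : 2 * ((r : ℝ) + 1) ^ 2 * (l ^ n * #S) ≤ l * (l ^ n * #S) := by gcongr
      rw [pow_succ] at hU
      linarith
    obtain ⟨i, j, hij, B, hBS, A, hAS, hB, hA, hN⟩ := exists_degree_classes hl1 (fun v hv =>
      le_trans (by exact_mod_cast degIn_mono hS'S) (mem_filter.1 hv).2) hT
    have hTpos : 0 < l ^ n * #S := by positivity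
    have hBd : ∀ b ∈ B, (G.degIn b A : ℝ) ≤ l ^ (i + 1) := fun b hb =>
      le_trans (by exact_mod_cast degIn_mono hAS) (hB b hb).2
    have hAd : ∀ a ∈ A, (G.degIn a B : ℝ) ≤ l ^ (j + 1) := fun a ha =>
      le_trans (by exact_mod_cast degIn_mono hBS) (hA a ha).2
    have hcard : ∀ X ⊆ S', ∀ t : ℕ, (∀ v ∈ X, l ^ t ≤ G.degIn v S') →
        #X * l ^ (t + 1) ≤ l ^ 2 * G.adjCount B A := by
      intro X hX t ht
      have e1 : (#X : ℝ) * l ^ t ≤ l ^ (n + 1) * #S := by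
        refine (card_mul_le_adjCount ht).trans (le_trans ?_ (hθ S))
        exact_mod_cast adjCount_mono (hX.trans hS'S) hS'S
      calc #X * l ^ (t + 1) = #X * l ^ t * l := by ring
        _ ≤ l ^ (n + 1) * #S * l := by gcongr
        _ = l ^ 2 * (l ^ n * #S) := by ring
        _ ≤ _ := by gcongr
    have hBne : B.Nonempty := by
      by_contra hne
      rw [not_nonempty_iff_eq_empty] at hne
      subst hne
      simp only [adjCount, sum_empty, Nat.cast_zero] at hN
      linarith
    -- The smaller degree scale is still large, since `B` sends at least `l ^ n #S` edges to `A`. As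
    -- `n ≥ 51s + 51`, sets of size `l ^ (i + 1)` are large enough for the Kővári–Sós–Turán bound
    -- with `η = l ^ 50`.
    have hni : n ≤ i + 1 := by
      have e1 : l ^ n * #S ≤ l ^ (i + 1) * #S := by
        refine hN.trans ((adjCount_le_card_mul_of_degIn_le hBd).trans ?_)
        rw [mul_comm]
        have : (#B : ℝ) ≤ #S := by exact_mod_cast card_le_card (hBS.trans hS'S)
        gcongr
      exact (pow_le_pow_iff_right₀ hl1).1 (le_of_mul_le_mul_right e1 hSpos)
    have hpow : ∀ t, t ≤ n → l ^ t ≤ l ^ (i + 1) := fun t ht =>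
      pow_le_pow_right₀ hl1.le (ht.trans hni)
    refine exists_isOneSubdivision_of_balanced (A := A) (B := B) (l := l) (d := l ^ (i + 1))
      (D := l ^ (j + 1)) (θ := l ^ (n + 1)) (by linarith) hl (by linarith) (by positivity) hBne
      hBd hAd (hcard B hBS i fun v hv => (hB v hv).1) (hcard A hAS j fun v hv => (hA v hv).1)
      (pow_le_pow_right₀ hl1.le (by omega)) (hpow 50 (by omega)) ?_ hθ ?_
    · rw [← pow_succ']
      exact pow_le_pow_right₀ hl1.le (by omega)
    · intro X Y x y hx hy hX hY
      refine h.mul_adjCount_le (one_le_pow₀ hl1.le) hX hY hs (le_trans ?_ hy) (le_trans ?_ hx)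
      · calc 4 * l ^ 50 * s = 4 * s * l ^ 50 := by ring
          _ ≤ l * l ^ 50 := by gcongr; linarith
          _ = l ^ 51 := by ring
          _ ≤ _ := hpow 51 (by omega)
      · calc 2 * l ^ 50 * (s * (4 * l ^ 50) ^ s) = 2 * s * l ^ 50 * (4 * l ^ 50) ^ s := by ring
          _ ≤ l * l ^ 50 * (l * l ^ 50) ^ s := by gcongr <;> linarith
          _ = l ^ (51 + 51 * s) := by
            rw [← pow_succ', ← pow_succ', ← pow_mul]; congr 1; ring
          _ ≤ _ := hpow _ (by omega)

/-- Some nonempty set of vertices spans a subgraph of maximum average degree. -/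
theorem exists_max_averageDegree [Fintype V] [Nonempty V] (G : SimpleGraph V) :
    ∃ S : Finset V, S.Nonempty ∧ ∃ θ : ℝ, G.averageDegree ≤ θ ∧
      (∀ X : Finset V, G.adjCount X X ≤ θ * #X) ∧ θ * #S ≤ G.adjCount S S := by
  obtain ⟨S, hS, hmax⟩ := exists_max_image ({X : Finset V | X.Nonempty} : Finset (Finset V))
    (fun X => (G.adjCount X X : ℝ) / #X) ⟨univ, by simp⟩
  have hS' : S.Nonempty := by simpa using hS
  have hSpos : (0 : ℝ) < #S := by exact_mod_cast hS'.card_pos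
  refine ⟨S, hS', (G.adjCount S S : ℝ) / #S, ?_, ?_, ?_⟩
  · have := hmax univ (by simp)
    rw [averageDegree]
    rw [← two_mul_ncard_edgeSet, card_univ] at this
    exact_mod_cast this
  · intro X
    rcases X.eq_empty_or_nonempty with rfl | hX
    · simp [adjCount]
    · have := hmax X (by simpa using hX)
      rwa [div_le_iff₀ (by exact_mod_cast hX.card_pos)] at this
  · rw [div_mul_cancel₀ _ hSpos.ne']

theorem containsInducedSubdivision_of_subsingleton {W : Type*} [Subsingleton W]
    (f : W → V) : G.ContainsInducedSubdivision (⊤ : SimpleGraph W) := by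
  have hno : ∀ {u v : W}, ¬ (⊤ : SimpleGraph W).Adj u v := fun h => h.ne (Subsingleton.elim _ _)
  have hf : ∀ x y : Set.range f, x = y := by
    rintro ⟨-, u, rfl⟩ ⟨-, v, rfl⟩
    exact Subtype.ext (congrArg f (Subsingleton.elim u v))
  refine ⟨Set.range f, ⟨fun w => ⟨f w, w, rfl⟩, fun u v _ => Subsingleton.elim u v⟩,
    fun u v h => absurd h hno, fun u v h => absurd h hno, fun u v h => absurd h hno,
    fun u v h => absurd h hno, fun u v h => absurd h hno, ?_, ?_⟩
  · rintro ⟨-, w, rfl⟩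
    exact .inl ⟨w, rfl⟩
  · intro e
    induction e using Sym2.ind with
    | _ x y =>
    intro hxy
    exact absurd (hf x y) ((mem_edgeSet _).1 hxy).ne

theorem not_free_zero : ¬ (completeBipartiteGraph (Fin 0) (Fin 0)).Free G := fun h =>
  h ⟨⟨⟨fun x => x.elim Fin.elim0 Fin.elim0, fun {a} => a.elim Fin.elim0 Fin.elim0⟩,
    fun a => a.elim Fin.elim0 Fin.elim0⟩⟩

/-- The lower bounds on the base of the degree scale that the main argument needs. -/
theorem scale_bounds {k s : ℕ} (hk : 2 ≤ k) (hs : 0 < s) :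
    32 * s ≤ k ^ (70 * s ^ 2) ∧ 200 * (2 ^ 42 * k ^ 12) ≤ k ^ (70 * s ^ 2) ∧
      2 * (1 + 110 * s + s * (1 + 2 * (110 * s)) + 1) ^ 2 ≤ k ^ (70 * s ^ 2) := by
  have hs2 : s ≤ s ^ 2 := Nat.le_self_pow (by norm_num) s
  have h2 : s ≤ 2 ^ s := Nat.lt_two_pow_self.le
  have hpow : ∀ a, a ≤ 70 * s ^ 2 → 2 ^ a ≤ k ^ (70 * s ^ 2) := fun a ha =>
    (Nat.pow_le_pow_left hk a).trans (Nat.pow_le_pow_right (by omega) ha)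
  refine ⟨?_, ?_, ?_⟩
  · calc 32 * s ≤ 2 ^ 5 * 2 ^ s := Nat.mul_le_mul (by norm_num) h2
      _ = 2 ^ (5 + s) := (pow_add 2 5 s).symm
      _ ≤ _ := hpow _ (by omega)
  · calc 200 * (2 ^ 42 * k ^ 12) ≤ 2 ^ 50 * k ^ 12 := by
          rw [← mul_assoc]; exact Nat.mul_le_mul_right _ (by norm_num)
      _ ≤ k ^ 50 * k ^ 12 := Nat.mul_le_mul_right _ (Nat.pow_le_pow_left hk 50)
      _ = k ^ 62 := (pow_add k 50 12).symm
      _ ≤ _ := Nat.pow_le_pow_right (by omega) (by omega)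
  · have h3 : 1 + 110 * s + s * (1 + 2 * (110 * s)) + 1 ≤ 333 * s ^ 2 := by nlinarith
    calc 2 * (1 + 110 * s + s * (1 + 2 * (110 * s)) + 1) ^ 2 ≤ 2 * (333 * s ^ 2) ^ 2 := by gcongr
      _ ≤ 2 ^ 18 * s ^ 4 := by rw [mul_pow, ← mul_assoc, ← pow_mul]; gcongr; norm_num
      _ ≤ 2 ^ 18 * (2 ^ s) ^ 4 := by gcongr
      _ = 2 ^ (18 + s * 4) := by rw [← pow_mul, ← pow_add]
      _ ≤ _ := hpow _ (by omega)

end Main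
end SimpleGraph

theorem corollary1p5 :
    ∃ C : ℕ, ∀ (k s : ℕ) (V : Type*) [Fintype V] (G : SimpleGraph V),
      (completeBipartiteGraph (Fin s) (Fin s)).Free G →
      (k : ℝ) ^ (C * s ^ 3) ≤ G.averageDegree →
      G.ContainsInducedSubdivision (⊤ : SimpleGraph (Fin k)) := by
  -- The constant is 70 · 110: the scale `l` is at least `k ^ (70 s²)`, and `θ = l ^ (110 s)`.
  refine ⟨7700, fun k s V _ G hfree hdeg => ?_⟩
  rcases Nat.eq_zero_or_pos s with rfl | hs
  · exact absurd hfree SimpleGraph.not_free_zero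
  rcases Nat.eq_zero_or_pos k with rfl | hk
  · exact SimpleGraph.containsInducedSubdivision_of_subsingleton Fin.elim0
  have hne : Nonempty V := by
    by_contra hV
    rw [not_nonempty_iff] at hV
    have h0 : G.averageDegree = 0 := by simp [SimpleGraph.averageDegree]
    have hpos : (0 : ℝ) < (k : ℝ) ^ (7700 * s ^ 3) := pow_pos (by exact_mod_cast hk) _
    linarith
  rcases Nat.lt_or_ge k 2 with hk1 | hk2
  · obtain rfl : k = 1 := by omega
    exact SimpleGraph.containsInducedSubdivision_of_subsingleton fun _ => hne.some
  obtain ⟨S, hS, θ, hGθ, hθ, hSθ⟩ := SimpleGraph.exists_max_averageDegree G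
  have hkθ : ((k : ℝ) ^ (70 * s ^ 2)) ^ (110 * s) ≤ θ := by
    rw [← pow_mul]
    refine le_trans (le_of_eq ?_) (hdeg.trans hGθ)
    congr 1; ring
  have hθ0 : 0 ≤ θ := le_trans (by positivity) hkθ
  have hm : 110 * s ≠ 0 := by omega
  -- The scale is defined from the maximal average degree θ rather than from `k`, so that θ is
  -- exactly a power of it.
  obtain ⟨l, hl0, hl⟩ : ∃ l : ℝ, 0 ≤ l ∧ l ^ (110 * s) = θ :=
    ⟨θ ^ ((110 * s : ℕ) : ℝ)⁻¹, by positivity, Real.rpow_inv_natCast_pow hθ0 hm⟩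
  subst hl
  have hkl : (k : ℝ) ^ (70 * s ^ 2) ≤ l := le_of_pow_le_pow_left₀ hm hl0 hkθ
  obtain ⟨b1, b2, b3⟩ := SimpleGraph.scale_bounds hk2 hs
  have c : ∀ a : ℕ, a ≤ k ^ (70 * s ^ 2) → (a : ℝ) ≤ l := fun a ha =>
    le_trans (by exact_mod_cast ha) hkl
  obtain ⟨A, B, hAB, hA, hcard⟩ := SimpleGraph.exists_isOneSubdivision_of_free hfree hs
    (K := ((2 ^ 42 * k ^ 12 : ℕ) : ℝ)) (l := l) (m := 110 * s)
    (by exact_mod_cast Nat.mul_pos (by norm_num) (Nat.pow_pos hk)) (by omega)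
    (by exact_mod_cast c _ b1) (by exact_mod_cast c _ b2) (by exact_mod_cast c _ b3) hθ hS hSθ
  exact hAB.containsInducedSubdivision_of_card hk2 hA (by exact_mod_cast hcard)
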